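/- **Setting.** Let $\mathbf W$ be a cocomplete model category which is both a closed symmetric monoidal model category (pushout-product axiom) with cofibrant unit object $I$ and a simplicial model category, with simplicial copower $\odot$. Let $k$ be a ring and let $\chi:\mathrm{ob}\,\mathbf W\rightharpoonup k$ be a *multiplicative Euler characteristic*: a partial function, whose domain is called the class of *finite* objects, such that (i) if $A\to B$ is a weak equivalence, then $A$ is finite iff $B$ is, and then $\chi(A)=\chi(B)$; (ii) the initial object is finite with $\chi(\emptyset)=0$; (iii) if $A,B,C$ are finite, then the homotopy pushout of any span $B\leftarrow A\to C$ is finite, with Euler characteristic $\chi(B)+\chi(C)-\chi(A)$; (iv) $I$ is finite and $\chi(I)=1$; (v) if $A,B$ are finite and cofibrant, then $A\otimes B$ is finite and $\chi(A\otimes B)=\chi(A)\chi(B)$. Let $\mathbf V$ be a semicartesian monoidal category (its unit object $1$ is terminal), let $\Sigma:\mathbf V\to\mathbf W$ be a strong monoidal functor all of whose values are finite, and put $\#=\chi\circ\Sigma$. Let $X$ be a small $\mathbf V$-category and let $\Sigma X$ be the $\mathbf W$-category with the same objects and with hom-objects $\Sigma(X(x,x'))$. Assume that $\Sigma X$ is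 *cofibrant*: each $\Sigma X(x,x')$ is cofibrant and each identity-assigning map $I\to\Sigma X(x,x)$ is a cofibration. Let $\mathbb 1$ be the $(\Sigma X,\Sigma X)$-bimodule that is constant at $\Sigma 1$, with actions induced by the unique maps to the terminal object $1$. The *magnitude nerve* $B_\bullet=B_\bullet(\Sigma X,\mathbb 1)$ is the simplicial (cyclic bar construction) object $$B_n=\coprod_{x_0,\dots,x_n}B_{x_0,\dots,x_n},\qquad B_{x_0,\dots,x_n}=\Sigma X(x_0,x_1)\otimes\cdots\otimes\Sigma X(x_{n-1},x_n)\otimes\mathbb 1(x_n,x_0).$$ The first (resp. last) face map lets the first (resp. last) hom-object act on $\mathbb 1$ from the right (resp. left), the inner face maps compose, and the degeneracy maps insert identities. Let $L_nB$ be the $n$th latching object of $B_\bullet$, and let $L_{x_0,\dots,x_n}B$ be the colimit of all summands $B_{y_0,\dots,y_k}$ ($k<n$) over the degeneracy maps that send them into the summand $B_{x_0,\dots,x_n}$. Let $|B_\bullet|=\int^n B_n\odot\Delta^n$ be the realization, also written $B(\Sigma X,\mathbb 1)$, and let $|B_\bullet|_n$ be the $n$th stage of its skeletal filtration, i.e.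 the coend $\int^{m\le n}B_m\odot\Delta^m$ over the full subcategory of $\Delta$ on $[0],\dots,[n]$. Call $B_\bullet$ *$n$-skeletal* if $L_mB\to B_m$ is an isomorphism for all $m>n$. **Theorem.** All $B_{x_0,\dots,x_n}$ and $L_{x_0,\dots,x_n}B$ are finite. Define $$\mathrm{wgt}(x_0,\dots,x_n)=\chi(B_{x_0,\dots,x_n})-\chi(L_{x_0,\dots,x_n}B).$$ Then $\mathrm{wgt}(x_0)=1$, and for $n\ge 1$ $$\mathrm{wgt}(x_0,x_1,\dots,x_n)=\begin{cases}\#X(x_0,x_1)\cdot\mathrm{wgt}(x_1,\dots,x_n)& x_0\ne x_1,\\ (\#X(x_0,x_1)-1)\cdot\mathrm{wgt}(x_1,\dots,x_n)& x_0=x_1.\end{cases}$$ Thus, for all $n\ge 0$ (the factors being multiplied in the order $j=1,\dots,n$ if $k$ is not commutative), $$\mathrm{wgt}(x_0,\dots,x_n)=\prod_{j=1}^n\bigl(\#X(x_{j-1},x_j)-\delta_{x_{j-1},x_j}\bigr).$$ Furthermore, if $X$ has finitely many objects, then every $|B_\bullet|_n$ is finite, $\chi(|B_\bullet|_0)=\sum_{x_0}\mathrm{wgt}(x_0)$,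 and for all $n\ge1$ $$\chi(|B_\bullet|_n)=\chi(|B_\bullet|_{n-1})+(-1)^n\sum_{x_0,\dots,x_n}\mathrm{wgt}(x_0,\dots,x_n).$$ Therefore, if $B_\bullet$ is additionally $n$-skeletal for some $n\ge0$, then $B(\Sigma X,\mathbb 1)$ is finite and $$\chi(B(\Sigma X,\mathbb 1))=\sum_{j=0}^n(-1)^j\sum_{x_0,\dots,x_j}\mathrm{wgt}(x_0,\dots,x_j).$$ -/

import Mathlib

open CategoryTheory CategoryTheory.Limits MonoidalCategory HomotopicalAlgebra Opposite

universe v u v₁ u₁ w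

namespace MagnitudeNerve

noncomputable section

section ModelStructures

variable (W : Type u) [Category.{v} W]

/-- Copowers (tensors) of a simplicial category: for every object `A` and simplicial set `K` an
object `T = A ⊙ K` with a natural isomorphism `sHom T B ≅ (sHom A B)^K` of simplicial sets,
expressed on maps out of an arbitrary simplicial set `L`. -/
class HasCopowers [SimplicialCategory W] : Prop where
  exists_copower (A : W) (K : SSet.{v}) : ∃ (T : W) (η : K ⟶ A ⟶[SSet.{v}] T),
    ∀ (B : W) (L : SSet.{v}), Function.Bijective
      (fun g : L ⟶ (T ⟶[SSet.{v}] B) => (η ⊗ₘ g) ≫ eComp SSet.{v} A T B)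

/-- Powers (cotensors) of a simplicial category: for every object `B` and simplicial set `K` an
object `P = B^K` with a natural isomorphism `sHom A P ≅ (sHom A B)^K` of simplicial sets. -/
class HasPowers [SimplicialCategory W] : Prop where
  exists_power (B : W) (K : SSet.{v}) : ∃ (P : W) (η : K ⟶ P ⟶[SSet.{v}] B),
    ∀ (A : W) (L : SSet.{v}), Function.Bijective
      (fun g : L ⟶ (A ⟶[SSet.{v}] P) => (g ⊗ₘ η) ≫ eComp SSet.{v} A P B)

variable {W}

section Copower

variable [SimplicialCategory W] [HasCopowers W]

/-- The copower `A ⊙ K`. -/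
def copower (A : W) (K : SSet.{v}) : W :=
  (HasCopowers.exists_copower A K).choose

/-- The unit `K ⟶ sHom A (A ⊙ K)`. -/
def copowerUnit (A : W) (K : SSet.{v}) : K ⟶ A ⟶[SSet.{v}] copower A K :=
  (HasCopowers.exists_copower A K).choose_spec.choose

lemma copower_bijective (A : W) (K : SSet.{v}) (B : W) : Function.Bijective
    (fun f : copower A K ⟶ B => copowerUnit A K ≫ eHomWhiskerLeft SSet.{v} A f) := by
  have h := (HasCopowers.exists_copower A K).choose_spec.choose_spec B (𝟙_ SSet.{v})
  have h2 := (((ρ_ K).homFromEquiv (Z := A ⟶[SSet.{v}] B)).bijective.comp h).comp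
    (eHomEquiv SSet.{v} (X := copower A K) (Y := B)).bijective
  convert h2 using 1
  funext f
  change _ = (ρ_ K).inv ≫ (copowerUnit A K ⊗ₘ eHomEquiv SSet.{v} f) ≫ eComp SSet.{v} A _ B
  rw [MonoidalCategory.tensorHom_def, Category.assoc, ← rightUnitor_inv_naturality_assoc]
  rfl

/-- Maps out of a copower. -/
def copowerDesc {A : W} {K : SSet.{v}} {B : W} (s : K ⟶ A ⟶[SSet.{v}] B) : copower A K ⟶ B :=
  ((copower_bijective A K B).2 s).choose

lemma copower_fac {A : W} {K : SSet.{v}} {B : W} (s : K ⟶ A ⟶[SSet.{v}] B) :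
    copowerUnit A K ≫ eHomWhiskerLeft SSet.{v} A (copowerDesc s) = s :=
  ((copower_bijective A K B).2 s).choose_spec

lemma copower_hom_ext {A : W} {K : SSet.{v}} {B : W} {f g : copower A K ⟶ B}
    (h : copowerUnit A K ≫ eHomWhiskerLeft SSet.{v} A f =
      copowerUnit A K ≫ eHomWhiskerLeft SSet.{v} A g) : f = g :=
  (copower_bijective A K B).1 h

variable (W) in
/-- The bifunctor `(A, K) ↦ A ⊙ K`. -/
def copowerFunctor : W ⥤ SSet.{v} ⥤ W where
  obj A :=
    { obj K := copower A K
      map s := copowerDesc (s ≫ copowerUnit A _)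
      map_id K := copower_hom_ext (by rw [copower_fac]; simp)
      map_comp s t := copower_hom_ext (by
        rw [copower_fac, eHomWhiskerLeft_comp, ← Category.assoc, copower_fac,
          Category.assoc, Category.assoc, copower_fac]) }
  map {A A'} a :=
    { app K := copowerDesc (copowerUnit A' K ≫ eHomWhiskerRight SSet.{v} a _)
      naturality K K' s := copower_hom_ext (by
        dsimp only
        rw [eHomWhiskerLeft_comp, ← Category.assoc, copower_fac, Category.assoc, copower_fac,
          eHomWhiskerLeft_comp, ← Category.assoc (copowerUnit A K), copower_fac, Category.assoc,
          ← eHom_whisker_exchange, ← Category.assoc (copowerUnit A' K), copower_fac,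
          Category.assoc]) }
  map_id A := by
    ext K
    exact copower_hom_ext (by rw [copower_fac]; simp)
  map_comp a b := by
    ext K
    exact copower_hom_ext (by
      dsimp only [NatTrans.comp_app]
      rw [copower_fac, eHomWhiskerLeft_comp, ← Category.assoc, copower_fac, Category.assoc,
        ← eHom_whisker_exchange, ← Category.assoc, copower_fac, Category.assoc,
        eHomWhiskerRight_comp])

end Copower

variable (W)

/-- The pushout-product axiom of a monoidal model category, with cofibrant unit object. -/
class IsMonoidalModelCategory [ModelCategory W] [MonoidalCategory W] : Prop where
  cofibrant_unit : IsCofibrant (𝟙_ W)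
  cofibration {A A' B B' : W} (f : A ⟶ A') (g : B ⟶ B') [Cofibration f] [Cofibration g]
    (sq : (curriedTensor W).PushoutObjObj f g) : Cofibration sq.ι
  weakEquivalence {A A' B B' : W} (f : A ⟶ A') (g : B ⟶ B') [Cofibration f] [Cofibration g]
    (sq : (curriedTensor W).PushoutObjObj f g) (h : WeakEquivalence f ∨ WeakEquivalence g) :
    WeakEquivalence sq.ι

/-- A simplicial model category: copowers, powers and the pushout-product axiom for the copower
bifunctor (the cofibrations of simplicial sets are the monomorphisms and the trivial cofibrations
are the anodyne extensions). -/
class IsSimplicialModelCategory [ModelCategory W] [SimplicialCategory W] : Prop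
    extends HasCopowers W, HasPowers W where
  cofibration {A A' : W} {K K' : SSet.{v}} (f : A ⟶ A') (g : K ⟶ K') [Cofibration f] [Mono g]
    (sq : (copowerFunctor W).PushoutObjObj f g) : Cofibration sq.ι
  weakEquivalence {A A' : W} {K K' : SSet.{v}} (f : A ⟶ A') (g : K ⟶ K') [Cofibration f] [Mono g]
    (sq : (copowerFunctor W).PushoutObjObj f g)
    (h : WeakEquivalence f ∨ SSet.anodyneExtensions g) : WeakEquivalence sq.ι

end ModelStructures

section EulerCharacteristic

variable {W : Type u} [Category.{v} W] [ModelCategory W]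

/-- `P` is a homotopy pushout of the span `B ← A → C`: it is weakly equivalent to the pushout of a
cofibrant replacement of the span in which one leg is a cofibration. -/
def IsHomotopyPushout {A B C : W} (f : A ⟶ B) (g : A ⟶ C) (P : W) : Prop :=
  ∃ (A' B' C' P' : W) (f' : A' ⟶ B') (g' : A' ⟶ C') (i : B' ⟶ P') (j : C' ⟶ P')
    (a : A' ⟶ A) (b : B' ⟶ B) (c : C' ⟶ C) (p : P' ⟶ P),
    IsCofibrant A' ∧ IsCofibrant C' ∧ Cofibration f' ∧
    WeakEquivalence a ∧ WeakEquivalence b ∧ WeakEquivalence c ∧ WeakEquivalence p ∧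
    f' ≫ b = a ≫ f ∧ g' ≫ c = a ≫ g ∧ IsPushout f' g' i j

variable (W) in
/-- An Euler characteristic on a model category: a partial function on objects, with values in an
abelian group. -/
structure EulerCharacteristic (k : Type w) [AddCommGroup k] where
  toPFun : W →. k
  weakEquivalence {A B : W} (f : A ⟶ B) [WeakEquivalence f] : toPFun A = toPFun B
  initial : 0 ∈ toPFun (⊥_ W)
  homotopyPushout {A B C P : W} {f : A ⟶ B} {g : A ⟶ C} (h : IsHomotopyPushout f g P) {a b c : k}
    (ha : a ∈ toPFun A) (hb : b ∈ toPFun B) (hc : c ∈ toPFun C) : b + c - a ∈ toPFun P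

variable (W) in
/-- A multiplicative Euler characteristic, with values in a ring. -/
structure MultiplicativeEulerCharacteristic (k : Type w) [Ring k] [MonoidalCategory W]
    extends EulerCharacteristic W k where
  unit : 1 ∈ toPFun (𝟙_ W)
  tensor {A B : W} [IsCofibrant A] [IsCofibrant B] {a b : k} (ha : a ∈ toPFun A)
    (hb : b ∈ toPFun B) : a * b ∈ toPFun (A ⊗ B)

namespace EulerCharacteristic

variable {k : Type w} [AddCommGroup k] (χ : EulerCharacteristic W k)

/-- An object is finite if its Euler characteristic is defined. -/
def IsFinite (A : W) : Prop := (χ.toPFun A).Dom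

open Classical in
/-- The Euler characteristic of an object (zero if the object is not finite). -/
def val (A : W) : k := if h : χ.IsFinite A then (χ.toPFun A).get h else 0

end EulerCharacteristic

end EulerCharacteristic

section Simplicial

variable {W : Type u} [Category.{v} W]

section Latching

variable {E : Type u₁} [Category.{v₁} E] (π : E ⥤ SimplexCategoryᵒᵖ) (p : E)

/-- The proper degeneracy operators with target `p`, in a category `E` over `Δᵒᵖ`: the maps
`q ⟶ p` that lie over a non-invertible surjection. -/
def IsDegeneracy : ObjectProperty (Over p) := fun d =>
  Function.Surjective (π.map d.hom).unop.toOrderHom ∧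
    (π.obj d.left).unop.len < (π.obj p).unop.len

variable [HasColimitsOfShape (IsDegeneracy π p).FullSubcategory W] (F : E ⥤ W)

/-- The latching object of `F` at `p`: the colimit of the domains of all proper degeneracy maps
with target `F p`. -/
def latchingObj : W :=
  colimit ((IsDegeneracy π p).ι ⋙ Over.forget p ⋙ F)

/-- The canonical map from the latching object of `F` at `p` to `F p`. -/
def latchingMap : latchingObj π p F ⟶ F.obj p :=
  colimit.desc ((IsDegeneracy π p).ι ⋙ Over.forget p ⋙ F)
    { pt := F.obj p
      ι :=
        { app d := F.map d.obj.hom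
          naturality d d' f := by
            have h : f.hom.left ≫ d'.obj.hom = d.obj.hom := Over.w f.hom
            simp [← F.map_comp, h] } }

end Latching

section Realization

variable [HasColimits W]

instance : HasColimitsOfSize.{0, v} W := hasColimitsOfSizeShrink.{0, v, v, v} W

instance : HasColimitsOfSize.{0, 0} W := hasColimitsOfSizeShrink.{0, 0, v, v} W

/-- A simplicial object is `n`-skeletal if its `k`th latching map is an isomorphism for all
`k > n`. -/
def IsSkeletal (n : ℕ) (B : SimplicialObject W) : Prop :=
  ∀ k > n, IsIso (latchingMap (𝟭 SimplexCategoryᵒᵖ) (op (SimplexCategory.mk k)) B)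

variable [SimplicialCategory W] [HasCopowers W]

/-- The bifunctor `([n], [m]) ↦ B_n ⊙ Δ^m`. -/
def realizationDiagram (B : SimplicialObject W) :
    SimplexCategoryᵒᵖ ⥤ SimplexCategory ⥤ W :=
  B ⋙ copowerFunctor W ⋙ (Functor.whiskeringLeft _ _ _).obj SSet.stdSimplex.{v}

/-- The geometric realization `|B| = ∫ⁿ B_n ⊙ Δ^n`. -/
def realization (B : SimplicialObject W) : W :=
  coend (realizationDiagram B)

/-- The `n`th stage `|B|_n` of the skeletal filtration of the geometric realization: the coend
`∫ᵏ B_k ⊙ Δ^k` taken over the full subcategory of `Δ` on `[0], …, [n]`. -/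
def skeletalRealization (n : ℕ) (B : SimplicialObject W) : W :=
  coend ((SimplexCategory.Truncated.inclusion n).op ⋙ realizationDiagram B ⋙
    (Functor.whiskeringLeft _ _ _).obj (SimplexCategory.Truncated.inclusion n))

end Realization

end Simplicial

section Bar

variable {W : Type u} [Category.{v} W] [MonoidalCategory W]

variable (W) in
/-- A `(Y, Y)`-bimodule in `W` for a `W`-category `Y`, i.e. a `W`-profunctor from `Y` to itself,
given by its objects `M(a, b)` and its left and right actions. -/
structure Bimodule (Y : Type w) [EnrichedCategory W Y] where
  obj : Y → Y → W
  lact (a b c : Y) : (a ⟶[W] b) ⊗ obj b c ⟶ obj a c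
  ract (a b c : Y) : obj a b ⊗ (b ⟶[W] c) ⟶ obj a c
  id_lact (a b : Y) : eId W a ▷ obj a b ≫ lact a a b = (λ_ (obj a b)).hom
  comp_lact (a b c d : Y) : eComp W a b c ▷ obj c d ≫ lact a c d =
    (α_ _ _ _).hom ≫ (a ⟶[W] b) ◁ lact b c d ≫ lact a b d
  ract_id (a b : Y) : obj a b ◁ eId W b ≫ ract a b b = (ρ_ (obj a b)).hom
  ract_comp (a b c d : Y) : obj a b ◁ eComp W b c d ≫ ract a b d =
    (α_ _ _ _).inv ≫ ract a b c ▷ (c ⟶[W] d) ≫ ract a c d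
  lact_ract (a b c d : Y) : lact a b c ▷ (c ⟶[W] d) ≫ ract a c d =
    (α_ _ _ _).hom ≫ (a ⟶[W] b) ◁ ract b c d ≫ lact a b d

variable {Y : Type w} [EnrichedCategory W Y]

section Plain

/-- `chain y Z r = Y(y r, y (r-1)) ⊗ (Y(y (r-1), y (r-2)) ⊗ (⋯ ⊗ (Y(y 1, y 0) ⊗ Z)))`. The words of
the bar construction are indexed from right to left, so that the recursion is on the leftmost
tensor factor. -/
@[reducible] def chain (y : ℕ → Y) (Z : W) : ℕ → W
  | 0 => Z
  | r + 1 => (y (r + 1) ⟶[W] y r) ⊗ chain y Z r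

/-- Compose the factors of `chain y Z r` to the left of `chain y Z s` (insert an identity if
`r = s`). -/
def push (y : ℕ → Y) (Z : W) {s r : ℕ} (h : s ≤ r) :
    chain y Z r ⟶ (y r ⟶[W] y s) ⊗ chain y Z s :=
  Nat.leRec (motive := fun r _ => chain y Z r ⟶ (y r ⟶[W] y s) ⊗ chain y Z s)
    ((λ_ _).inv ≫ eId W (y s) ▷ _)
    (fun r _ p => (y (r + 1) ⟶[W] y r) ◁ p ≫ (α_ _ _ _).inv ≫
      eComp W (y (r + 1)) (y r) (y s) ▷ _) h

lemma push_self (y : ℕ → Y) (Z : W) (s : ℕ) :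
    push y Z (le_refl s) = (λ_ _).inv ≫ eId W (y s) ▷ _ := by
  simp [push, Nat.leRec_self]

lemma push_succ (y : ℕ → Y) (Z : W) {s r : ℕ} (h : s ≤ r) :
    push y Z (Nat.le_succ_of_le h) = (y (r + 1) ⟶[W] y r) ◁ push y Z h ≫ (α_ _ _ _).inv ≫
      eComp W (y (r + 1)) (y r) (y s) ▷ _ := by
  rw [push, Nat.leRec_succ _ _ h]; rfl

lemma push_push (y : ℕ → Y) (Z : W) {t s r : ℕ} (h : s ≤ r) (h' : t ≤ s) :
    push y Z h ≫ (y r ⟶[W] y s) ◁ push y Z h' ≫ (α_ _ _ _).inv ≫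
      eComp W (y r) (y s) (y t) ▷ _ = push y Z (h'.trans h) := by
  induction r, h using Nat.le_induction with
  | base =>
    rw [push_self, Category.assoc, ← whisker_exchange_assoc, id_whiskerLeft_assoc,
      Iso.inv_hom_id_assoc, associator_inv_naturality_left_assoc, ← comp_whiskerRight]
    have h2 : eId W (y s) ▷ (y s ⟶[W] y t) ≫ eComp W (y s) (y s) (y t) = (λ_ _).hom := by
      rw [← cancel_epi (λ_ _).inv, e_id_comp, Iso.inv_hom_id]
    rw [h2]
    simp
  | succ r h ih =>
    rw [push_succ y Z h, push_succ y Z (h'.trans h), ← ih]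
    simp only [MonoidalCategory.whiskerLeft_comp, Category.assoc]
    rw [← whisker_exchange_assoc, associator_inv_naturality_left_assoc, ← comp_whiskerRight,
      ← e_assoc' W (y (r + 1)) (y r) (y s) (y t)]
    simp

/-- Along a monotone `q`: compose the hom-factors between consecutive `y (q (r+1))`, `y (q r)`
(inserting identities where `q (r+1) = q r`), and let the factors to the right of `y (q 0)` act
on the bimodule from the left. -/
def pull (M : Bimodule W Y) (y : ℕ → Y) (c : Y) (q : ℕ → ℕ) (hq : Monotone q) :
    ∀ m : ℕ, chain y (M.obj (y 0) c) (q m) ⟶ chain (fun r => y (q r)) (M.obj (y (q 0)) c) m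
  | 0 => push y _ (Nat.zero_le (q 0)) ≫ M.lact (y (q 0)) (y 0) c
  | m + 1 => push y _ (hq (Nat.le_succ m)) ≫
      (y (q (m + 1)) ⟶[W] y (q m)) ◁ pull M y c q hq m

lemma pull_push (M : Bimodule W Y) (y : ℕ → Y) (c : Y) (q : ℕ → ℕ) (hq : Monotone q)
    {k m : ℕ} (h : k ≤ m) :
    pull M y c q hq m ≫ push (fun r => y (q r)) _ h =
      push y _ (hq h) ≫ (y (q m) ⟶[W] y (q k)) ◁ pull M y c q hq k := by
  induction m, h using Nat.le_induction with
  | base =>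
    rw [push_self, push_self, Category.assoc, ← whisker_exchange]
    simp
  | succ m h ih =>
    rw [push_succ _ _ h, ← push_push y _ (hq (Nat.le_succ m)) (hq h), pull]
    simp only [Category.assoc]
    rw [← whisker_exchange, ← associator_inv_naturality_right_assoc,
      ← MonoidalCategory.whiskerLeft_comp_assoc, ← MonoidalCategory.whiskerLeft_comp_assoc, ← ih]

lemma pull_pull (M : Bimodule W Y) (y : ℕ → Y) (c : Y) (q p : ℕ → ℕ) (hq : Monotone q)
    (hp : Monotone p) (m : ℕ) :
    pull M y c q hq (p m) ≫ pull M (fun r => y (q r)) c p hp m =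
      pull M y c (fun r => q (p r)) (hq.comp hp) m := by
  induction m with
  | zero =>
    rw [pull, ← Category.assoc, pull_push, pull, pull, ← push_push y _ (hq (Nat.zero_le (p 0)))
      (Nat.zero_le (q 0))]
    simp only [Category.assoc, MonoidalCategory.whiskerLeft_comp, M.comp_lact,
      Iso.inv_hom_id_assoc]
  | succ m ih =>
    rw [pull, ← Category.assoc, pull_push, pull, ← ih, Category.assoc,
      MonoidalCategory.whiskerLeft_comp]

lemma chain_congr (y y' : ℕ → Y) (Z : W) (m : ℕ) (h : ∀ r ≤ m, y r = y' r) :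
    chain y Z m = chain y' Z m := by
  induction m with
  | zero => rfl
  | succ m ih =>
    rw [chain, chain, h m (by lia), h (m + 1) (by lia), ih fun r hr => h r (by lia)]

lemma push_one (y : ℕ → Y) (Z : W) (m : ℕ) : push y Z (Nat.le_succ m) = 𝟙 _ := by
  refine (push_succ y Z (le_refl m)).trans ?_
  have h : (y (m + 1) ⟶[W] y m) ◁ eId W (y m) ≫ eComp W (y (m + 1)) (y m) (y m) =
      (ρ_ _).hom := by
    rw [← cancel_epi (ρ_ _).inv, e_comp_id, Iso.inv_hom_id]
  rw [push_self, MonoidalCategory.whiskerLeft_comp, Category.assoc,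
    associator_inv_naturality_middle_assoc, ← comp_whiskerRight, h]
  simp

lemma push_one' (y : ℕ → Y) (Z C : W) {m a b : ℕ} (ha : a = m) (hb : b = m + 1) (h : a ≤ b)
    (e : chain y Z a = C) (e' : chain y Z b = ((y b ⟶[W] y a) ⊗ C : W)) :
    push y Z h ≫ (y b ⟶[W] y a) ◁ eqToHom e = eqToHom e' := by
  subst ha hb e
  simp [push_one]

lemma pull_id (M : Bimodule W Y) (y : ℕ → Y) (c : Y) (q : ℕ → ℕ) (hq : Monotone q) (m : ℕ)
    (hm : ∀ r ≤ m, q r = r) (e : chain y (M.obj (y 0) c) (q m) =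
      chain (fun r => y (q r)) (M.obj (y (q 0)) c) m) :
    pull M y c q hq m = eqToHom e := by
  induction m with
  | zero =>
    have key : ∀ (a : ℕ) (h : 0 ≤ a) (_ : a = 0) (e : chain y (M.obj (y 0) c) a =
        M.obj (y a) c), push y _ h ≫ M.lact (y a) (y 0) c = eqToHom e := by
      rintro a h rfl e
      have := push_self y (M.obj (y 0) c) 0
      rw [this, Category.assoc, M.id_lact, Iso.inv_hom_id]
      rfl
    exact key (q 0) (Nat.zero_le _) (hm 0 le_rfl) e
  | succ m ih =>
    have e1 : chain y (M.obj (y 0) c) (q m) =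
        chain (fun r => y (q r)) (M.obj (y (q 0)) c) m := by
      rw [hm m (by lia), hm 0 (by lia)]
      exact chain_congr _ _ _ _ fun r hr => by rw [hm r (by lia)]
    rw [pull, ih (fun r hr => hm r (by lia)) e1]
    exact push_one' y _ _ (hm m (by lia)) (hm (m + 1) le_rfl) _ _ _

end Plain

section Braided

variable [BraidedCategory W]

/-- Exchange the first two of three tensor factors. -/
def swap (A B C : W) : A ⊗ (B ⊗ C) ⟶ B ⊗ (A ⊗ C) :=
  (α_ A B C).inv ≫ (β_ A B).hom ▷ C ≫ (α_ B A C).hom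

/-- Move a factor `Y(b, c)` past the whole chain and let it act on the bimodule from the right. -/
def turn (M : Bimodule W Y) (y : ℕ → Y) (b c : Y) :
    ∀ r : ℕ, (b ⟶[W] c) ⊗ chain y (M.obj (y 0) b) r ⟶ chain y (M.obj (y 0) c) r
  | 0 => (β_ _ _).hom ≫ M.ract (y 0) b c
  | r + 1 => swap _ _ _ ≫ (y (r + 1) ⟶[W] y r) ◁ turn M y b c r

lemma swap_unit (A B C : W) (e : 𝟙_ W ⟶ A) :
    e ▷ (B ⊗ C) ≫ swap A B C = (λ_ (B ⊗ C)).hom ≫ B ◁ ((λ_ C).inv ≫ e ▷ C) := by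
  simp [swap, ← comp_whiskerRight_assoc]

lemma swap_unit' (A B C : W) (e : 𝟙_ W ⟶ B) :
    A ◁ ((λ_ C).inv ≫ e ▷ C) ≫ swap A B C = (λ_ (A ⊗ C)).inv ≫ e ▷ (A ⊗ C) := by
  have h : (A ◁ e ≫ (β_ A B).hom) ▷ C = ((ρ_ A).hom ≫ (λ_ A).inv ≫ e ▷ A) ▷ C := by
    simp
  rw [swap, MonoidalCategory.whiskerLeft_comp, Category.assoc,
    associator_inv_naturality_middle_assoc, ← comp_whiskerRight_assoc, h]
  simp

lemma swap_comp (A B B' D C : W) (f : B ⊗ B' ⟶ D) :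
    A ◁ ((α_ _ _ _).inv ≫ f ▷ C) ≫ swap A D C =
      swap A B (B' ⊗ C) ≫ B ◁ swap A B' C ≫ (α_ _ _ _).inv ≫ f ▷ (A ⊗ C) := by
  have h : (A ◁ f ≫ (β_ A D).hom) ▷ C = ((β_ A (B ⊗ B')).hom ≫ f ▷ A) ▷ C := by
    simp
  rw [swap, MonoidalCategory.whiskerLeft_comp, Category.assoc,
    associator_inv_naturality_middle_assoc, ← comp_whiskerRight_assoc, h,
    BraidedCategory.braiding_tensor_right_hom, swap, swap]
  simp only [comp_whiskerRight, Category.assoc, MonoidalCategory.whiskerLeft_comp]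
  monoidal

lemma swap_swap (A A' B C : W) :
    swap (A ⊗ A') B C ≫ B ◁ ((β_ A A').hom ▷ C ≫ (α_ _ _ _).hom) =
      (β_ A A').hom ▷ (B ⊗ C) ≫ (α_ _ _ _).hom ≫ A' ◁ swap A B C ≫ swap A' B (A ⊗ C) := by
  have h := congrArg (fun f => (α_ (A ⊗ A') B C).inv ≫ (α_ A A' B).hom ▷ C ≫ f ▷ C ≫
    (α_ B (A' ⊗ A) C).hom ≫ B ◁ (α_ A' A C).hom) (BraidedCategory.yang_baxter A A' B)
  refine Eq.trans ?_ (h.symm.trans ?_)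
  · rw [swap, BraidedCategory.braiding_tensor_left_hom]
    monoidal
  · rw [swap, swap]
    monoidal

lemma swap_naturality (A B : W) {C C' : W} (g : C ⟶ C') :
    A ◁ B ◁ g ≫ swap A B C' = swap A B C ≫ B ◁ A ◁ g := by
  rw [swap, swap, associator_inv_naturality_right_assoc, whisker_exchange_assoc,
    associator_naturality_right]
  simp only [Category.assoc]

lemma swap_naturality' {A A' : W} (f : A ⟶ A') (B C : W) :
    f ▷ (B ⊗ C) ≫ swap A' B C = swap A B C ≫ B ◁ f ▷ C := by
  simp [swap, ← comp_whiskerRight_assoc]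

lemma turn_push (M : Bimodule W Y) (y : ℕ → Y) (b c : Y) {s r : ℕ} (h : s ≤ r) :
    (b ⟶[W] c) ◁ push y _ h ≫ swap _ _ _ ≫ (y r ⟶[W] y s) ◁ turn M y b c s =
      turn M y b c r ≫ push y _ h := by
  induction r, h using Nat.le_induction with
  | base =>
    rw [push_self, push_self, ← Category.assoc, swap_unit', Category.assoc, ← whisker_exchange]
    simp
  | succ r h ih =>
    rw [push_succ y _ h, push_succ y _ h, MonoidalCategory.whiskerLeft_comp, Category.assoc,
      reassoc_of% (swap_comp (b ⟶[W] c) (y (r + 1) ⟶[W] y r) (y r ⟶[W] y s) _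
        (chain y (M.obj (y 0) b) s) (eComp W (y (r + 1)) (y r) (y s))),
      reassoc_of% (swap_naturality (b ⟶[W] c) (y (r + 1) ⟶[W] y r) (push y (M.obj (y 0) b) h)),
      ← whisker_exchange, ← associator_inv_naturality_right_assoc, turn]
    simp only [← MonoidalCategory.whiskerLeft_comp_assoc, Category.assoc, ih]

lemma turn_pull (M : Bimodule W Y) (y : ℕ → Y) (b c : Y) (q : ℕ → ℕ) (hq : Monotone q) (m : ℕ) :
    (b ⟶[W] c) ◁ pull M y b q hq m ≫ turn M (fun r => y (q r)) b c m =
      turn M y b c (q m) ≫ pull M y c q hq m := by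
  induction m with
  | zero =>
    have h : (b ⟶[W] c) ◁ M.lact (y (q 0)) (y 0) b ≫ (β_ _ _).hom ≫ M.ract (y (q 0)) b c =
        swap _ _ _ ≫ (y (q 0) ⟶[W] y 0) ◁ ((β_ _ _).hom ≫ M.ract (y 0) b c) ≫
          M.lact (y (q 0)) (y 0) c := by
      rw [BraidedCategory.braiding_naturality_right_assoc, M.lact_ract,
        BraidedCategory.braiding_tensor_right_hom, swap]
      simp
    rw [pull, pull, ← Category.assoc, ← turn_push, MonoidalCategory.whiskerLeft_comp]
    simp only [Category.assoc]
    exact congrArg _ h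
  | succ m ih =>
    rw [pull, pull, ← Category.assoc (turn M y b c _), ← turn_push, turn]
    simp only [MonoidalCategory.whiskerLeft_comp, Category.assoc]
    rw [reassoc_of% (swap_naturality (b ⟶[W] c) (y (q (m + 1)) ⟶[W] y (q m)) (pull M y b q hq m))]
    simp only [← MonoidalCategory.whiskerLeft_comp, ih]

lemma turn_id (M : Bimodule W Y) (y : ℕ → Y) (b : Y) (r : ℕ) :
    eId W b ▷ _ ≫ turn M y b b r = (λ_ _).hom := by
  induction r with
  | zero =>
    rw [turn, BraidedCategory.braiding_naturality_left_assoc, M.ract_id]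
    simp
  | succ r ih =>
    rw [turn, ← Category.assoc, swap_unit, Category.assoc, ← MonoidalCategory.whiskerLeft_comp,
      Category.assoc, ih]
    simp

end Braided

section Symmetric

variable [SymmetricCategory W]

lemma braid_braid (A A' B : W) :
    (β_ (A ⊗ A') B).hom ≫ (α_ _ _ _).inv =
      (β_ A A').hom ▷ B ≫ (α_ _ _ _).hom ≫ A' ◁ (β_ A B).hom ≫ (β_ A' (B ⊗ A)).hom := by
  have h := BraidedCategory.yang_baxter A A' B
  rw [← cancel_epi (α_ A A' B).inv, BraidedCategory.braiding_tensor_left_hom,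
    BraidedCategory.braiding_tensor_right_hom]
  simp only [Category.assoc, Iso.inv_hom_id_assoc]
  rw [reassoc_of% h, ← MonoidalCategory.whiskerLeft_comp_assoc, SymmetricCategory.symmetry]
  simp

lemma turn_comp (M : Bimodule W Y) (y : ℕ → Y) (b c d : Y) (r : ℕ) :
    eComp W b c d ▷ _ ≫ turn M y b d r = (β_ _ _).hom ▷ _ ≫ (α_ _ _ _).hom ≫
      (c ⟶[W] d) ◁ turn M y b c r ≫ turn M y c d r := by
  induction r with
  | zero =>
    rw [turn, BraidedCategory.braiding_naturality_left_assoc, M.ract_comp, turn, turn,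
      MonoidalCategory.whiskerLeft_comp]
    simp only [Category.assoc]
    rw [BraidedCategory.braiding_naturality_right_assoc]
    rw [reassoc_of% (braid_braid (b ⟶[W] c) (c ⟶[W] d) (M.obj (y 0) b))]
  | succ r ih =>
    rw [turn, reassoc_of% (swap_naturality' (eComp W b c d)), ← MonoidalCategory.whiskerLeft_comp,
      ih, turn, turn]
    have h := swap_swap (b ⟶[W] c) (c ⟶[W] d) (y (r + 1) ⟶[W] y r) (chain y (M.obj (y 0) b) r)
    rw [← Category.assoc, MonoidalCategory.whiskerLeft_comp, ← Category.assoc]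
    simp only [MonoidalCategory.whiskerLeft_comp, Category.assoc] at h ⊢
    rw [reassoc_of% h, reassoc_of% (swap_naturality (c ⟶[W] d) (y (r + 1) ⟶[W] y r) (turn M y b c r))]

/-- Compose the factors of the chain to the left of `y s` and let them act on the bimodule from
the right: the effect of a composite of initial face maps. -/
def drop (M : Bimodule W Y) (y : ℕ → Y) {s r : ℕ} (h : s ≤ r) :
    chain y (M.obj (y 0) (y r)) r ⟶ chain y (M.obj (y 0) (y s)) s :=
  push y _ h ≫ turn M y (y r) (y s) s

lemma drop_self (M : Bimodule W Y) (y : ℕ → Y) (s : ℕ) : drop M y (le_refl s) = 𝟙 _ := by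
  rw [drop, push_self, Category.assoc, turn_id, Iso.inv_hom_id]

lemma drop_drop (M : Bimodule W Y) (y : ℕ → Y) {t s r : ℕ} (h : s ≤ r) (h' : t ≤ s) :
    drop M y h ≫ drop M y h' = drop M y (h'.trans h) := by
  rw [drop, drop, drop, ← push_push y _ h h']
  simp only [Category.assoc]
  rw [← Category.assoc (turn M y (y r) (y s) s), ← turn_push, turn_comp]
  simp [swap]

lemma pull_drop (M : Bimodule W Y) (y : ℕ → Y) (q : ℕ → ℕ) (hq : Monotone q) {k m : ℕ}
    (h : k ≤ m) :
    pull M y (y (q m)) q hq m ≫ drop M (fun r => y (q r)) h =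
      drop M y (hq h) ≫ pull M y (y (q k)) q hq k := by
  rw [drop, drop, ← Category.assoc, pull_push, Category.assoc, turn_pull, Category.assoc]

/-- The tensor product `Y(y n, y (n-1)) ⊗ (⋯ ⊗ (Y(y 1, y 0) ⊗ M(y 0, y n)))`. -/
abbrev word (M : Bimodule W Y) (y : ℕ → Y) (n : ℕ) : W :=
  chain y (M.obj (y 0) (y n)) n

/-- The action of a simplicial operator on words: the first factors act on the bimodule from the
right, the last ones from the left, and the ones in between are composed. -/
def wordMap (M : Bimodule W Y) (y z : ℕ → Y) {n m : ℕ} (q : ℕ → ℕ) (hq : Monotone q)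
    (h : q m ≤ n) (hz : (fun r => y (q r)) = z) : word M y n ⟶ word M z m :=
  drop M y h ≫ pull M y (y (q m)) q hq m ≫ eqToHom (by rw [← hz])

lemma wordMap_comp (M : Bimodule W Y) (y z w : ℕ → Y) {n m k : ℕ} (q p t : ℕ → ℕ)
    (hq : Monotone q) (hp : Monotone p) (ht : Monotone t) (h : q m ≤ n) (h' : p k ≤ m)
    (h'' : t k ≤ n) (hz : (fun r => y (q r)) = z) (hw : (fun r => z (p r)) = w)
    (hw' : (fun r => y (t r)) = w) (hqp : ∀ r, q (p r) = t r) :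
    wordMap M y z q hq h hz ≫ wordMap M z w p hp h' hw = wordMap M y w t ht h'' hw' := by
  obtain rfl : (fun r => q (p r)) = t := funext hqp
  subst hz hw
  simp only [wordMap, eqToHom_refl, Category.comp_id, Category.assoc]
  rw [← Category.assoc (pull _ _ _ _ _ _), pull_drop, Category.assoc, pull_pull,
    ← Category.assoc, drop_drop]

lemma wordMap_id (M : Bimodule W Y) (y : ℕ → Y) {n : ℕ} (q : ℕ → ℕ) (hq : Monotone q)
    (h : q n ≤ n) (hz : (fun r => y (q r)) = y) (hn : ∀ r ≤ n, q r = r) :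
    wordMap M y y q hq h hz = 𝟙 _ := by
  have e : chain y (M.obj (y 0) (y (q n))) (q n) =
      chain (fun r => y (q r)) (M.obj (y (q 0)) (y (q n))) n := by
    rw [hn n le_rfl, hn 0 (Nat.zero_le n), hz]
  rw [wordMap, pull_id M y _ q hq n hn e, eqToHom_trans]
  have key : ∀ (a : ℕ) (h : a ≤ n) (_ : a = n) (e : chain y (M.obj (y 0) (y a)) a =
      word M y n), drop M y h ≫ eqToHom e = 𝟙 _ := by
    rintro a h rfl e
    rw [drop_self]
    simp
  exact key _ h (hn n le_rfl) _

end Symmetric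

end Bar

section BarConstruction

/-- The nerve of the chaotic category on `Y`: an `n`-simplex is a list `y_0, …, y_n`. -/
def chaoticNerve (Y : Type w) : SimplexCategoryᵒᵖ ⥤ Type w where
  obj n := Fin (n.unop.len + 1) → Y
  map f := ↾fun y i => y (f.unop.toOrderHom i)

/-- The sequence `x_n, x_{n-1}, …, x_0, x_0, x_0, …`. -/
def reversed {Y : Type w} {n : ℕ} (x : Fin (n + 1) → Y) (r : ℕ) : Y :=
  x ⟨n - r, by lia⟩

/-- The monotone function `r ↦ n - f (m - r)`. -/
def reversedMap {m n : ℕ} (f : Fin (m + 1) →o Fin (n + 1)) (r : ℕ) : ℕ :=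
  n - f ⟨m - r, by lia⟩

lemma reversedMap_monotone {m n : ℕ} (f : Fin (m + 1) →o Fin (n + 1)) :
    Monotone (reversedMap f) := by
  intro r s h
  have h2 : f ⟨m - s, by lia⟩ ≤ f ⟨m - r, by lia⟩ := f.monotone (by
    rw [Fin.mk_le_mk]; lia)
  have h3 : (f ⟨m - s, by lia⟩ : ℕ) ≤ f ⟨m - r, by lia⟩ := h2
  unfold reversedMap
  lia

lemma reversed_reversedMap {Y : Type w} {m n : ℕ} (x : Fin (n + 1) → Y)
    (f : Fin (m + 1) →o Fin (n + 1)) (z : Fin (m + 1) → Y) (h : (fun i => x (f i)) = z) :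
    (fun r => reversed x (reversedMap f r)) = reversed z := by
  subst h
  funext r
  unfold reversed reversedMap
  congr 1
  apply Fin.ext
  have := (f ⟨m - r, by lia⟩).isLt
  simp only
  lia

variable {W : Type u} [Category.{v} W] [MonoidalCategory W] [SymmetricCategory W]
  {Y : Type w} [EnrichedCategory W Y] (M : Bimodule W Y)

/-- The functor `B̃(Y, M)` on the category of simplices of the chaotic nerve, with values
`Y(y_0, y_1) ⊗ (Y(y_1, y_2) ⊗ (⋯ ⊗ (Y(y_{n-1}, y_n) ⊗ M(y_n, y_0))))`. -/
def barSummand : (chaoticNerve Y).Elements ⥤ W where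
  obj x := word M (reversed x.2) x.1.unop.len
  map {x z} f := wordMap M (reversed x.2) (reversed z.2) (reversedMap f.1.unop.toOrderHom)
    (reversedMap_monotone _) (Nat.sub_le _ _)
    (reversed_reversedMap x.2 f.1.unop.toOrderHom z.2 f.2)
  map_id x := wordMap_id _ _ _ _ _ _ fun r hr => by
    change x.1.unop.len - (x.1.unop.len - r) = r
    lia
  map_comp {x y z} f g := by
    refine (wordMap_comp _ _ _ _ _ _ _ _ _ _ _ _ _ _ _ _ fun r => ?_).symm
    change x.1.unop.len - (f.1.unop.toOrderHom ⟨y.1.unop.len - (y.1.unop.len -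
      g.1.unop.toOrderHom ⟨z.1.unop.len - r, _⟩), _⟩ : ℕ) = x.1.unop.len -
      (f.1.unop.toOrderHom (g.1.unop.toOrderHom ⟨z.1.unop.len - r, _⟩) : ℕ)
    congr 3
    apply Fin.ext
    have := (g.1.unop.toOrderHom ⟨z.1.unop.len - r, by lia⟩).isLt
    simp only
    lia

end BarConstruction

section SimplicialBar

variable {W : Type u} [Category.{v} W] [MonoidalCategory W] [SymmetricCategory W] [HasColimits W]
  {Y : Type v} [EnrichedCategory W Y] (M : Bimodule W Y)

/-- The summand `B_{y_0, …, y_n}(Y, M)`. -/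
def barAt (n : SimplexCategoryᵒᵖ) (y : (chaoticNerve Y).obj n) : W :=
  (barSummand M).obj ((chaoticNerve Y).elementsMk n y)

/-- The map between summands of the simplicial bar construction induced by a simplicial operator. -/
def barAtMap {n m : SimplexCategoryᵒᵖ} (f : n ⟶ m) (y : (chaoticNerve Y).obj n) :
    barAt M n y ⟶ barAt M m ((chaoticNerve Y).map f y) :=
  (barSummand M).map (X := (chaoticNerve Y).elementsMk n y)
    (Y := (chaoticNerve Y).elementsMk m ((chaoticNerve Y).map f y)) ⟨f, rfl⟩

/-- The simplicial bar construction `B_n(Y, M) = ∐_{y_0, …, y_n} Y(y_0, y_1) ⊗ ⋯ ⊗ M(y_n, y_0)`. -/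
def bar : SimplicialObject W where
  obj n := ∐ fun y : (chaoticNerve Y).obj n => barAt M n y
  map {n m} f := Sigma.desc fun y => barAtMap M f y ≫
    Sigma.ι (fun z : (chaoticNerve Y).obj m => barAt M m z) ((chaoticNerve Y).map f y)
  map_id n := by
    refine Sigma.hom_ext _ _ fun y => ?_
    rw [Sigma.ι_desc, Category.comp_id]
    exact (congrArg (· ≫ Sigma.ι (fun z : (chaoticNerve Y).obj n => barAt M n z) y)
      ((barSummand M).map_id ((chaoticNerve Y).elementsMk n y))).trans (Category.id_comp _)
  map_comp {n m l} f g := by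
    refine Sigma.hom_ext _ _ fun y => ?_
    rw [Sigma.ι_desc, ← Category.assoc, Sigma.ι_desc, Category.assoc, Sigma.ι_desc,
      ← Category.assoc, barAtMap, barAtMap, barAtMap]
    exact congrArg (· ≫ Sigma.ι (fun z : (chaoticNerve Y).obj l => barAt M l z)
      ((chaoticNerve Y).map (f ≫ g) y)) ((barSummand M).map_comp
        (X := (chaoticNerve Y).elementsMk n y)
        (Y := (chaoticNerve Y).elementsMk m ((chaoticNerve Y).map f y))
        (Z := (chaoticNerve Y).elementsMk l ((chaoticNerve Y).map (f ≫ g) y))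
        ⟨f, rfl⟩ ⟨g, rfl⟩)

/-- The partial latching object `L_{y_0, …, y_n} B(Y, M)`. -/
def latchingAt (n : SimplexCategoryᵒᵖ) (y : (chaoticNerve Y).obj n) : W :=
  latchingObj (CategoryOfElements.π (chaoticNerve Y)) ((chaoticNerve Y).elementsMk n y)
    (barSummand M)

end SimplicialBar

section Magnitude

/-- A `W`-category is cofibrant if its hom-objects are cofibrant and its identity-assigning maps
are cofibrations. -/
def IsCofibrantEnriched (W : Type u) [Category.{v} W] [ModelCategory W] [MonoidalCategory W]
    (Y : Type w) [EnrichedCategory W Y] : Prop :=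
  (∀ a b : Y, IsCofibrant (a ⟶[W] b)) ∧ ∀ a : Y, Cofibration (eId W a)

variable {V : Type u₁} [Category.{v₁} V] [SemiCartesianMonoidalCategory V]
  {W : Type u} [Category.{v} W] [MonoidalCategory W] (S : V ⥤ W)

section UnitBimodule

open SemiCartesianMonoidalCategory Functor.LaxMonoidal

variable [S.Monoidal]

lemma unit_id_left {A : V} (e : 𝟙_ V ⟶ A) :
    (ε S ≫ S.map e) ▷ S.obj (𝟙_ V) ≫ μ S A (𝟙_ V) ≫ S.map (toUnit _) =
      (λ_ (S.obj (𝟙_ V))).hom := by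
  rw [comp_whiskerRight, Category.assoc, μ_natural_left_assoc, ← S.map_comp, left_unitality,
    toUnit_unique (e ▷ 𝟙_ V ≫ toUnit _) (λ_ (𝟙_ V)).hom]

lemma unit_id_right {A : V} (e : 𝟙_ V ⟶ A) :
    S.obj (𝟙_ V) ◁ (ε S ≫ S.map e) ≫ μ S (𝟙_ V) A ≫ S.map (toUnit _) =
      (ρ_ (S.obj (𝟙_ V))).hom := by
  rw [MonoidalCategory.whiskerLeft_comp, Category.assoc, μ_natural_right_assoc, ← S.map_comp,
    right_unitality, toUnit_unique (𝟙_ V ◁ e ≫ toUnit _) (ρ_ (𝟙_ V)).hom]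

lemma unit_comp_left {A B C : V} (f : A ⊗ B ⟶ C) :
    (μ S A B ≫ S.map f) ▷ S.obj (𝟙_ V) ≫ μ S C (𝟙_ V) ≫ S.map (toUnit _) =
      (α_ _ _ _).hom ≫ S.obj A ◁ (μ S B (𝟙_ V) ≫ S.map (toUnit _)) ≫
        μ S A (𝟙_ V) ≫ S.map (toUnit _) := by
  rw [comp_whiskerRight, Category.assoc, μ_natural_left_assoc, ← S.map_comp,
    MonoidalCategory.whiskerLeft_comp, Category.assoc, μ_natural_right_assoc, ← S.map_comp,
    ← associativity_assoc, ← S.map_comp]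
  congr 3
  exact toUnit_unique _ _

lemma unit_comp_right {A B C : V} (f : A ⊗ B ⟶ C) :
    S.obj (𝟙_ V) ◁ (μ S A B ≫ S.map f) ≫ μ S (𝟙_ V) C ≫ S.map (toUnit _) =
      (α_ _ _ _).inv ≫ (μ S (𝟙_ V) A ≫ S.map (toUnit _)) ▷ S.obj B ≫
        μ S (𝟙_ V) B ≫ S.map (toUnit _) := by
  rw [comp_whiskerRight, Category.assoc, μ_natural_left_assoc, ← S.map_comp,
    MonoidalCategory.whiskerLeft_comp, Category.assoc, μ_natural_right_assoc, ← S.map_comp,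
    ← associativity_inv_assoc, ← S.map_comp]
  congr 3
  exact toUnit_unique _ _

lemma unit_left_right (A B : V) :
    (μ S A (𝟙_ V) ≫ S.map (toUnit _)) ▷ S.obj B ≫ μ S (𝟙_ V) B ≫ S.map (toUnit _) =
      (α_ _ _ _).hom ≫ S.obj A ◁ (μ S (𝟙_ V) B ≫ S.map (toUnit _)) ≫
        μ S A (𝟙_ V) ≫ S.map (toUnit _) := by
  rw [comp_whiskerRight, Category.assoc, μ_natural_left_assoc, ← S.map_comp,
    MonoidalCategory.whiskerLeft_comp, Category.assoc, μ_natural_right_assoc, ← S.map_comp,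
    ← associativity_assoc, ← S.map_comp]
  congr 3
  exact toUnit_unique _ _

/-- The bimodule `𝟙 = ΣΔ1` over `ΣX`: it is constant at `Σ` of the terminal unit object of `V`,
with actions induced by the unique maps to that object. -/
def unitBimodule (X : Type w) [EnrichedCategory V X] :
    Bimodule W (TransportEnrichment S X) where
  obj _ _ := S.obj (𝟙_ V)
  lact a b _ := μ S (EnrichedCategory.Hom (V := V) (C := X) a b) (𝟙_ V) ≫ S.map (toUnit _)
  ract _ b c := μ S (𝟙_ V) (EnrichedCategory.Hom (V := V) (C := X) b c) ≫ S.map (toUnit _)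
  id_lact a _ := unit_id_left S (eId V (C := X) a)
  comp_lact a b c _ := unit_comp_left S (eComp V (C := X) a b c)
  ract_id _ b := unit_id_right S (eId V (C := X) b)
  ract_comp _ b c d := unit_comp_right S (eComp V (C := X) b c d)
  lact_ract a b c d := unit_left_right S (EnrichedCategory.Hom (V := V) (C := X) a b)
    (EnrichedCategory.Hom (V := V) (C := X) c d)

end UnitBimodule

variable [SymmetricCategory W] [HasColimits W] [S.Monoidal] (X : Type v) [EnrichedCategory V X]

/-- The magnitude nerve `B_•(ΣX, 𝟙)`. -/
def magnitudeNerve : SimplicialObject W := bar (unitBimodule S X)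

/-- The summand `B_{x_0, …, x_n}(ΣX, 𝟙)` of the magnitude nerve. -/
def nerveAt {n : ℕ} (x : Fin (n + 1) → X) : W :=
  barAt (unitBimodule S X) (op (SimplexCategory.mk n)) x

/-- The partial latching object `L_{x_0, …, x_n} B(ΣX, 𝟙)` of the magnitude nerve. -/
def nerveLatchingAt {n : ℕ} (x : Fin (n + 1) → X) : W :=
  latchingAt (unitBimodule S X) (op (SimplexCategory.mk n)) x

/-- `wgt(x_0, …, x_n) = χ(B_{x_0, …, x_n}(ΣX, 𝟙)) - χ(L_{x_0, …, x_n} B(ΣX, 𝟙))`. -/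
def wgt {k : Type w} [Ring k] [ModelCategory W] (χ : MultiplicativeEulerCharacteristic W k)
    {n : ℕ} (x : Fin (n + 1) → X) : k :=
  χ.val (nerveAt S X x) - χ.val (nerveLatchingAt S X x)

end Magnitude

end

end MagnitudeNerve

open MagnitudeNerve

/-! The proof has two halves, one about weights and one about realizations. In both, finiteness and
value are carried together as a membership `a ∈ χ.toPFun A`, and the task is to present each object
as a pushout along a cofibration between cofibrant objects, where inclusion-exclusion applies.

Weights. Put H = ΣX(x_0, x_1), and let B' and L' be the summand and the partial latching object of
(x_1, …, x_n). The summand of (x_0, …, x_n) is H ⊗ B'. A proper degeneracy into it either keeps the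
first two vertices apart, and is then H tensored with a proper degeneracy into B', or identifies
them. The second case requires x_0 = x_1, and the degeneracy then factors through the insertion of
an identity in front of B'. Hence the partial latching object L is H ⊗ L' if x_0 ≠ x_1
(`isIso_consLatching`), and the pushout of B' ← L' → H ⊗ L' if x_0 = x_1 (`isPushout_consLatching`).
In the second case L → H ⊗ B' is the pushout-product of I → H and L' → B', so by induction all
latching maps are cofibrations between cofibrant objects (`cofibration_nerveLatchingMap`). Thus χ(L)
is χ(H)χ(L') or χ(B') + χ(H)χ(L') - χ(L'), and subtracting it from χ(H)χ(B') leaves the factor χ(H)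
or χ(H) - 1.

Realization. The stage |B|_{n+1} arises from |B|_n by attaching B_{n+1} ⊙ Δ^{n+1} along the
pushout-product of the latching map with ∂Δ^{n+1} → Δ^{n+1} (`isPushout_attach`). Since χ(A ⊙ Δ^n) =
χ(A) and χ(A ⊙ ∂Δ^n) = χ(A)(1 - (-1)^n) for cofibrant finite A (`mem_copower_boundary`), each stage
adds (-1)^{n+1} times the difference of the Euler characteristics of B_{n+1} and its latching object
(`TruncatedRealization.mem_succ`). The latching object of the nerve is the coproduct of the partial
ones (`sigmaLatchingIso`), so for finitely many objects this difference is the sum of the weights.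
If B is n-skeletal, the later stages attach along isomorphisms and |B|_n is already |B|
(`isIso_incl_total`). -/

namespace MagnitudeNerve

noncomputable section

/-! ### Additivity of the Euler characteristic on pushouts and finite coproducts -/

section EulerCharacteristicLemmas

variable {W : Type u} [Category.{v} W] [ModelCategory W]

namespace EulerCharacteristic

variable {k : Type w} [AddCommGroup k] (χ : EulerCharacteristic W k)

variable {χ} in
lemma isFinite_of_mem {A : W} {a : k} (h : a ∈ χ.toPFun A) : χ.IsFinite A := h.1

variable {χ} in
lemma val_eq_of_mem {A : W} {a : k} (h : a ∈ χ.toPFun A) : χ.val A = a := by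
  obtain ⟨h1, h2⟩ := h
  exact (dif_pos h1).trans h2

variable {χ} in
lemma IsFinite.val_mem {A : W} (h : χ.IsFinite A) : χ.val A ∈ χ.toPFun A := by
  exact ⟨h, (dif_pos h).symm⟩

lemma mem_of_weakEquivalence {A B : W} (f : A ⟶ B) [WeakEquivalence f] {a : k}
    (h : a ∈ χ.toPFun A) : a ∈ χ.toPFun B :=
  χ.weakEquivalence f ▸ h

lemma mem_of_weakEquivalence' {A B : W} (f : A ⟶ B) [WeakEquivalence f] {a : k}
    (h : a ∈ χ.toPFun B) : a ∈ χ.toPFun A :=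
  (χ.weakEquivalence f).symm ▸ h

lemma mem_of_iso {A B : W} (e : A ≅ B) {a : k} (h : a ∈ χ.toPFun A) : a ∈ χ.toPFun B :=
  χ.mem_of_weakEquivalence e.hom h

/-- Under these cofibrancy conditions the span is its own cofibrant replacement, so the strict
pushout is a homotopy pushout. Every additive count below goes through this lemma. -/
lemma mem_of_isPushout {A B C P : W} {f : A ⟶ B} {g : A ⟶ C} {i : B ⟶ P} {j : C ⟶ P}
    (sq : IsPushout f g i j) [hA : IsCofibrant A] [hC : IsCofibrant C] [hf : Cofibration f]
    {a b c : k} (ha : a ∈ χ.toPFun A) (hb : b ∈ χ.toPFun B) (hc : c ∈ χ.toPFun C) :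
    b + c - a ∈ χ.toPFun P :=
  χ.homotopyPushout (f := f) (g := g) ⟨A, B, C, P, f, g, i, j, 𝟙 _, 𝟙 _, 𝟙 _, 𝟙 _, hA, hC, hf,
    inferInstance, inferInstance, inferInstance, inferInstance, by simp, by simp, sq⟩ ha hb hc

end EulerCharacteristic

lemma cofibration_of_isPushout {A B C P : W} {f : A ⟶ B} {g : A ⟶ C} {i : B ⟶ P} {j : C ⟶ P}
    (sq : IsPushout f g i j) [hf : Cofibration f] : Cofibration j := by
  rw [cofibration_iff] at hf ⊢
  exact MorphismProperty.of_isPushout sq.flip hf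

lemma isCofibrant_of_iso {A B : W} (e : A ≅ B) [IsCofibrant A] : IsCofibrant B :=
  isCofibrant_of_cofibration e.hom

/-- Cofibrations are the maps with the left lifting property against trivial fibrations, and lifts
out of a coproduct can be chosen summand by summand. -/
lemma isCofibrant_sigma {ι : Type w} (f : ι → W) [HasCoproduct f] [hf : ∀ i, IsCofibrant (f i)] :
    IsCofibrant (∐ f) := by
  simp only [cofibration_iff, ← trivialFibrations_llp] at hf ⊢
  intro X Y p hp
  refine ⟨fun {t b} sq => ?_⟩
  have h (i : ι) : HasLiftingProperty (initial.to (f i)) p := hf i p hp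
  have sq' (i : ι) : CommSq (initial.to X) (initial.to (f i)) p (Sigma.ι f i ≫ b) :=
    ⟨Subsingleton.elim _ _⟩
  exact ⟨⟨Sigma.desc fun i => (sq' i).lift, Subsingleton.elim _ _,
    Sigma.hom_ext _ _ fun i => by simp⟩⟩

lemma isCofibrant_of_isInitial {A : W} (h : IsInitial A) : IsCofibrant A := by
  have : IsIso (initial.to A) := isIso_of_isInitial initialIsInitial h _
  infer_instance

lemma isPushout_sigma_option {ι : Type w} (f : Option ι → W) [HasCoproduct f]
    [HasCoproduct fun i => f (some i)] :
    IsPushout (initial.to (f none)) (initial.to (∐ fun i => f (some i))) (Sigma.ι f none)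
      (Sigma.desc fun i => Sigma.ι f (some i)) := by
  refine ⟨⟨Subsingleton.elim _ _⟩, ⟨PushoutCocone.IsColimit.mk _
    (fun s => Sigma.desc fun o => match o with
      | none => s.inl
      | some i => Sigma.ι (fun i => f (some i)) i ≫ s.inr) (fun s => by simp) (fun s => ?_)
    fun s m h1 h2 => ?_⟩⟩
  · exact Sigma.hom_ext _ _ fun i => by simp
  · refine Sigma.hom_ext _ _ fun o => ?_
    cases o with
    | none => simpa using h1
    | some i => simp [← h2]

namespace EulerCharacteristic

variable {k : Type w} [AddCommGroup k] (χ : EulerCharacteristic W k)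

lemma mem_of_isInitial {A : W} (h : IsInitial A) : 0 ∈ χ.toPFun A :=
  χ.mem_of_iso (initialIsInitial.uniqueUpToIso h) χ.initial

/-- Adding one summand is a pushout over the initial object, whose Euler characteristic `0` is what
gets subtracted. Cofibrancy of the coproduct of the other summands makes this a homotopy pushout. -/
lemma mem_sigma [HasColimits W] {ι : Type v} [Fintype ι] (f : ι → W)
    [∀ i, IsCofibrant (f i)] {a : ι → k} (ha : ∀ i, a i ∈ χ.toPFun (f i)) :
    ∑ i, a i ∈ χ.toPFun (∐ f) := by
  revert f a
  refine Fintype.induction_empty_option (P := fun (ι : Type v) _ => ∀ (f : ι → W)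
    [∀ i, IsCofibrant (f i)] {a : ι → k} (_ : ∀ i, a i ∈ χ.toPFun (f i)),
    ∑ i, a i ∈ χ.toPFun (∐ f)) ?_ ?_ ?_ ι
  · intro α β _ e h f _ a ha
    let := Fintype.ofEquiv β e.symm
    have := h (fun i => f (e i)) (a := fun i => a (e i)) (fun i => ha (e i))
    rw [← e.sum_comp]
    exact χ.mem_of_iso (Sigma.whiskerEquiv (f := fun i => f (e i)) (g := f) e
      (fun i => Iso.refl _)) (by convert this)
  · intro f _ a _
    rw [Finset.univ_eq_empty, Finset.sum_empty]
    exact χ.mem_of_iso (initialIsoIsInitial (IsInitial.ofUniqueHom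
      (fun X => Sigma.desc fun i => i.elim) fun X m => Sigma.hom_ext _ _ fun i => i.elim))
      χ.initial
  · intro α _ h f _ a ha
    have := isCofibrant_sigma fun i => f (some i)
    have h2 := χ.mem_of_isPushout (isPushout_sigma_option f)
      (hA := isCofibrant_of_isInitial initialIsInitial) χ.initial (ha none) (h (fun i => f (some i)) fun i => ha (some i))
    rwa [sub_zero, ← Fintype.sum_option] at h2

end EulerCharacteristic

end EulerCharacteristicLemmas

/-! ### Copowers as left adjoints in each variable -/

section CopowerLemmas

open Simplicial

variable {W : Type u} [Category.{v} W] [SimplicialCategory W]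

section

variable [HasCopowers W]

/-- The unit `K ⟶ sHom A (A ⊙ K)` of the copower bifunctor. -/
def copowerFunctorUnit (A : W) (K : SSet.{v}) :
    K ⟶ A ⟶[SSet.{v}] ((copowerFunctor W).obj A).obj K :=
  copowerUnit A K

lemma copowerFunctorUnit_map (A : W) {K K' : SSet.{v}} (s : K ⟶ K') :
    copowerFunctorUnit A K ≫ eHomWhiskerLeft SSet.{v} A (((copowerFunctor W).obj A).map s) =
      s ≫ copowerFunctorUnit A K' :=
  copower_fac (s ≫ copowerUnit A K')

lemma copowerFunctorUnit_map_app {A A' : W} (K : SSet.{v}) (a : A ⟶ A') :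
    copowerFunctorUnit A K ≫ eHomWhiskerLeft SSet.{v} A (((copowerFunctor W).map a).app K) =
      copowerFunctorUnit A' K ≫ eHomWhiskerRight SSet.{v} a _ :=
  copower_fac (copowerUnit A' K ≫ eHomWhiskerRight SSet.{v} a _)

/-- Maps out of a copower `A ⊙ K` correspond to maps from `K` to the simplicial hom. -/
def copowerEquiv (A : W) (K : SSet.{v}) (B : W) :
    (((copowerFunctor W).obj A).obj K ⟶ B) ≃ (K ⟶ A ⟶[SSet.{v}] B) :=
  Equiv.ofBijective (fun f => copowerFunctorUnit A K ≫ eHomWhiskerLeft SSet.{v} A f)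
    (copower_bijective A K B)

lemma copowerEquiv_apply {A : W} {K : SSet.{v}} {B : W}
    (f : ((copowerFunctor W).obj A).obj K ⟶ B) :
    copowerEquiv A K B f = copowerFunctorUnit A K ≫ eHomWhiskerLeft SSet.{v} A f := rfl

lemma copowerEquiv_comp {A : W} {K : SSet.{v}} {B B' : W}
    (f : ((copowerFunctor W).obj A).obj K ⟶ B) (g : B ⟶ B') :
    copowerEquiv A K B' (f ≫ g) = copowerEquiv A K B f ≫ eHomWhiskerLeft SSet.{v} A g := by
  rw [copowerEquiv_apply, copowerEquiv_apply, eHomWhiskerLeft_comp, Category.assoc]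

lemma copowerEquiv_map_comp {A : W} {K K' : SSet.{v}} {B : W} (s : K ⟶ K')
    (f : ((copowerFunctor W).obj A).obj K' ⟶ B) :
    copowerEquiv A K B (((copowerFunctor W).obj A).map s ≫ f) = s ≫ copowerEquiv A K' B f := by
  rw [copowerEquiv_apply, copowerEquiv_apply, eHomWhiskerLeft_comp, ← Category.assoc,
    copowerFunctorUnit_map, Category.assoc]

lemma copowerEquiv_map_app_comp {A A' : W} {K : SSet.{v}} {B : W} (a : A ⟶ A')
    (f : ((copowerFunctor W).obj A').obj K ⟶ B) :
    copowerEquiv A K B (((copowerFunctor W).map a).app K ≫ f) =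
      copowerEquiv A' K B f ≫ eHomWhiskerRight SSet.{v} a B := by
  rw [copowerEquiv_apply, copowerEquiv_apply, eHomWhiskerLeft_comp, ← Category.assoc,
    copowerFunctorUnit_map_app, Category.assoc, ← eHom_whisker_exchange, Category.assoc]

variable (W) in
/-- The functor `A ⊙ -` is left adjoint to the simplicial hom out of `A`. -/
def copowerAdjunction (A : W) : (copowerFunctor W).obj A ⊣ (eHomFunctor SSet.{v} W).obj (op A) :=
  Adjunction.mkOfHomEquiv
    { homEquiv K B := copowerEquiv A K B
      homEquiv_naturality_left_symm {K' K B} s g :=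
        (Equiv.symm_apply_eq (copowerEquiv A K' B)).2 ((congrArg (s ≫ ·)
          (Equiv.apply_symm_apply (copowerEquiv A K B) g)).symm.trans
          (copowerEquiv_map_comp s _).symm)
      homEquiv_naturality_right f g := copowerEquiv_comp f g }

instance (A : W) : ((copowerFunctor W).obj A).IsLeftAdjoint :=
  (copowerAdjunction W A).isLeftAdjoint

/-- The right adjoint is the power `B ↦ B^K`. Hence `- ⊙ K` preserves initial objects and the
colimits that define latching objects. -/
instance [HasPowers W] (K : SSet.{v}) : ((copowerFunctor W).flip.obj K).IsLeftAdjoint := by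
  choose P η h using fun B : W => HasPowers.exists_power B K
  have h' (B A : W) : Function.Bijective
      (fun f : A ⟶ P B => η B ≫ eHomWhiskerRight SSet.{v} f B) := by
    have h2 := (((λ_ K).homFromEquiv (Z := A ⟶[SSet.{v}] B)).bijective.comp
      (h B A (𝟙_ SSet.{v}))).comp (eHomEquiv SSet.{v} (X := A) (Y := P B)).bijective
    convert h2 using 1
    funext f
    change _ = (λ_ K).inv ≫ (eHomEquiv SSet.{v} f ⊗ₘ η B) ≫ eComp SSet.{v} A (P B) B
    rw [MonoidalCategory.tensorHom_def', Category.assoc, ← leftUnitor_inv_naturality_assoc]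
    rfl
  refine (Adjunction.adjunctionOfEquivRight (F := (copowerFunctor W).flip.obj K) (G_obj := P)
    (fun A B => (copowerEquiv A K B).trans (Equiv.ofBijective _ (h' B A)).symm)
    fun A' A B a f => ?_).isLeftAdjoint
  rw [Equiv.trans_apply, Equiv.symm_apply_eq]
  change copowerEquiv A' K B (((copowerFunctor W).map a).app K ≫ f) = η B ≫
    eHomWhiskerRight SSet.{v} (a ≫ (Equiv.ofBijective _ (h' B A)).symm (copowerEquiv A K B f)) B
  rw [copowerEquiv_map_app_comp, eHomWhiskerRight_comp, ← Category.assoc]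
  congr 1
  exact (Equiv.apply_symm_apply (Equiv.ofBijective _ (h' B A)) _).symm

/-- A natural family of maps indexed by the simplices of `K` defines a unique map out of
`A ⊙ K`. -/
lemma copower_existsUnique_desc {A : W} {K : SSet.{v}} {B : W}
    (t : ∀ p : SimplexCategory, (SSet.stdSimplex.{v}.obj p ⟶ K) →
      (((copowerFunctor W).obj A).obj (SSet.stdSimplex.obj p) ⟶ B))
    (ht : ∀ (p q : SimplexCategory) (α : p ⟶ q) (s : SSet.stdSimplex.obj q ⟶ K),
      ((copowerFunctor W).obj A).map (SSet.stdSimplex.map α) ≫ t q s =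
        t p (SSet.stdSimplex.map α ≫ s)) :
    ∃! f : ((copowerFunctor W).obj A).obj K ⟶ B, ∀ p (s : SSet.stdSimplex.obj p ⟶ K),
      ((copowerFunctor W).obj A).map s ≫ f = t p s := by
  -- The adjoint of the map sought: by Yoneda, a simplex of `K` goes to the simplex of the
  -- simplicial hom that corresponds to its member of the family `t`.
  let g : K ⟶ A ⟶[SSet.{v}] B :=
    { app p := ↾fun x => SSet.yonedaEquiv (copowerEquiv A _ B (t p.unop (SSet.yonedaEquiv.symm x)))
      naturality p q α := by
        ext x
        change SSet.yonedaEquiv (copowerEquiv A _ B (t q.unop (SSet.yonedaEquiv.symm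
            (K.map α.unop.op x)))) = (A ⟶[SSet.{v}] B).map α.unop.op (SSet.yonedaEquiv
          (copowerEquiv A _ B (t p.unop (SSet.yonedaEquiv.symm x))))
        rw [SSet.yonedaEquiv_naturality, ← copowerEquiv_map_comp, ht,
          SSet.yonedaEquiv_symm_naturality_left] }
  have hg (p : SimplexCategory) (s : SSet.stdSimplex.obj p ⟶ K) :
      s ≫ g = copowerEquiv A _ B (t p s) := by
    apply SSet.yonedaEquiv.injective
    rw [SSet.yonedaEquiv_comp]
    change SSet.yonedaEquiv (copowerEquiv A _ B (t p (SSet.yonedaEquiv.symm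
      (SSet.yonedaEquiv s)))) = _
    rw [Equiv.symm_apply_apply]
  refine ⟨(copowerEquiv A K B).symm g, fun p s => (copowerEquiv A _ B).injective ?_,
    fun f hf => ?_⟩
  · rw [copowerEquiv_map_comp, Equiv.apply_symm_apply, hg]
  · rw [Equiv.eq_symm_apply]
    ext p x
    have h := hg p.unop (SSet.yonedaEquiv.symm x)
    rw [← hf, copowerEquiv_map_comp] at h
    have h2 := congrArg SSet.yonedaEquiv h
    rwa [SSet.yonedaEquiv_comp, SSet.yonedaEquiv_comp, Equiv.apply_symm_apply, eq_comm] at h2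

lemma copower_hom_ext_simplices {A : W} {K : SSet.{v}} {B : W}
    {f g : ((copowerFunctor W).obj A).obj K ⟶ B}
    (h : ∀ (p : SimplexCategory) (s : SSet.stdSimplex.{v}.obj p ⟶ K),
      ((copowerFunctor W).obj A).map s ≫ f = ((copowerFunctor W).obj A).map s ≫ g) : f = g := by
  obtain ⟨u, -, hu⟩ := copower_existsUnique_desc (B := B)
    (fun p s => ((copowerFunctor W).obj A).map s ≫ g)
    (fun p q α s => by rw [Functor.map_comp, Category.assoc])
  rw [hu f h, hu g fun _ _ => rfl]

end

end CopowerLemmas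

/-! ### Standard simplices, horns and boundaries -/

section Boundary

open Simplicial SSet

/-- The homotopy that contracts the standard simplex to its initial vertex. -/
def stdSimplexContraction (n : ℕ) : (Δ[n] ⊗ Δ[1] : SSet.{v}) ⟶ Δ[n] where
  app m := ↾fun x => stdSimplex.objMk
    { toFun i := if stdSimplex.asOrderHom x.2 i = 0 then 0 else stdSimplex.asOrderHom x.1 i
      monotone' i j h := by
        have h1 := (stdSimplex.asOrderHom x.1).monotone h
        have h2 := (stdSimplex.asOrderHom x.2).monotone h
        dsimp only
        split_ifs with h3 h4 h4
        · exact le_rfl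
        · exact Fin.zero_le _
        · rw [h4, Fin.le_zero_iff] at h2
          exact absurd h2 h3
        · exact h1 }

/-- The vertex inclusion is a retract of its pushout-product with `Λ[1, 0] ⟶ Δ[1]`, which is
anodyne. The simplex is placed over the endpoint `1` of the interval, and the contraction to the
initial vertex retracts it. -/
lemma anodyneExtensions_initialVertex (n : ℕ) :
    anodyneExtensions (SSet.const (stdSimplex.obj₀Equiv.symm 0) : (Δ[0] : SSet.{v}) ⟶ Δ[n]) := by
  intro X Y p hp
  let i : (Δ[0] : SSet.{v}) ⟶ Δ[n] := SSet.const (stdSimplex.obj₀Equiv.symm 0)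
  have : IsSplitMono i := ⟨⟨stdSimplex.isTerminalObj₀.from _, stdSimplex.isTerminalObj₀.hom_ext _ _⟩⟩
  let sq := Functor.PushoutObjObj.ofHasPushout (curriedTensor SSet.{v}) i Λ[1, 0].ι
  have hsq := anodyneExtensions_pushoutObjObjι sq (anodyneExtensions.horn_ι 0)
  refine ⟨fun {x y} comm => ?_⟩
  -- On the pushout-product domain the contraction is constant: `Λ[1, 0]` is the vertex `0`, where
  -- everything has been contracted, and the initial vertex never moves.
  have hι : sq.ι ≫ stdSimplexContraction n = stdSimplex.isTerminalObj₀.from _ ≫ i := by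
    apply sq.hom_ext
    · rw [sq.inl_ι_assoc, ← Category.assoc, stdSimplex.isTerminalObj₀.hom_ext (_ ≫ _)
        (stdSimplex.isTerminalObj₀.from _)]
      ext ⟨⟨m⟩⟩ ⟨s, t, ht⟩ j
      refine congrArg Fin.val ?_
      change (if stdSimplex.asOrderHom t j = 0 then 0 else stdSimplex.asOrderHom s j) = 0
      rw [if_pos]
      rw [mem_horn_iff_notMem_range] at ht
      obtain ⟨l, hl, hl'⟩ := ht
      have : stdSimplex.asOrderHom t j ≠ l := fun h => hl' ⟨j, h⟩
      lia
    · rw [sq.inr_ι_assoc, ← Category.assoc, stdSimplex.isTerminalObj₀.hom_ext (_ ≫ _)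
        (stdSimplex.isTerminalObj₀.from _)]
      ext ⟨⟨m⟩⟩ ⟨s, t⟩ j
      refine congrArg Fin.val ?_
      change (if stdSimplex.asOrderHom t j = 0 then 0 else 0) = 0
      simp
  have := hsq p hp
  have sq' : CommSq (stdSimplex.isTerminalObj₀.from _ ≫ x) sq.ι p
    (stdSimplexContraction n ≫ y) := ⟨by rw [Category.assoc, comm.w, reassoc_of% hι]⟩
  let e : (Δ[n] : SSet.{v}) ⟶ Δ[n] ⊗ Δ[1] := CartesianMonoidalCategory.lift (𝟙 _)
    (SSet.const (stdSimplex.obj₀Equiv.symm 1))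
  -- The section carries the vertex into the corner `Δ[0] ⊗ Δ[1]`, so the lift for the
  -- pushout-product restricts to one for `i`.
  have he : i ≫ e = CartesianMonoidalCategory.lift (𝟙 _)
    (SSet.const (stdSimplex.obj₀Equiv.symm 1)) ≫ sq.inr ≫ sq.ι := by
    rw [sq.inr_ι]
    rfl
  refine ⟨⟨e ≫ sq'.lift, ?_, ?_⟩⟩
  · change i ≫ e ≫ _ = _
    rw [reassoc_of% he, sq'.fac_left]
    simp only [← Category.assoc]
    rw [stdSimplex.isTerminalObj₀.hom_ext (_ ≫ _) (𝟙 _), Category.id_comp]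
  · rw [Category.assoc, sq'.fac_right, ← Category.assoc]
    have h : e ≫ stdSimplexContraction n = 𝟙 _ := by
      ext ⟨⟨m⟩⟩ s j
      refine congrArg Fin.val ?_
      change (if (1 : Fin 2) = 0 then 0 else stdSimplex.asOrderHom s j) = _
      rfl
    rw [h, Category.id_comp]

/-- The faces of `Δ[n + 1]` other than the one opposite `0` form the horn, and the horn meets that
remaining face in its boundary. This is the gluing behind the induction on dimension for `A ⊙
∂Δ[n]`. -/
lemma bicartSq_boundary (n : ℕ) :
    Subcomplex.BicartSq ((boundary.{v} n).image (stdSimplex.δ 0)) (horn (n + 1) 0)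
      (stdSimplex.face {0}ᶜ) (boundary (n + 1)) where
  sup_eq := by
    refine le_antisymm (sup_le (fun m x hx => ?_) (face_singleton_compl_le_boundary 0)) ?_
    · induction m using Opposite.rec with | _ m
      rw [mem_boundary_iff_notMem_range]
      rw [mem_horn_iff_notMem_range] at hx
      obtain ⟨j, -, hj⟩ := hx
      exact ⟨j, hj⟩
    · rw [boundary_eq_iSup]
      refine iSup_le fun i => ?_
      by_cases hi : i = 0
      · rw [hi]
        exact le_sup_right
      · exact (face_le_horn i 0 hi).trans le_sup_left
  inf_eq := by
    rw [← stdSimplex.range_δ]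
    ext ⟨⟨m⟩⟩ x
    constructor
    · rintro ⟨hx, y, rfl⟩
      refine ⟨y, ?_, rfl⟩
      rw [mem_horn_iff_notMem_range] at hx
      obtain ⟨j, hj, hj'⟩ := hx
      obtain ⟨j, rfl⟩ := Fin.exists_succ_eq.2 hj
      rw [mem_boundary_iff_notMem_range]
      exact ⟨j, fun ⟨l, hl⟩ => hj' ⟨l, congrArg Fin.succ hl⟩⟩
    · rintro ⟨y, hy, rfl⟩
      refine ⟨?_, y, rfl⟩
      rw [mem_boundary_iff_notMem_range] at hy
      obtain ⟨j, hj⟩ := hy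
      rw [mem_horn_iff_notMem_range]
      exact ⟨j.succ, Fin.succ_ne_zero j, fun ⟨l, hl⟩ => hj ⟨l, Fin.succ_injective _ hl⟩⟩

end Boundary

/-! ### Copowers of cofibrant objects with simplices -/

section CopowerModel

open Simplicial SSet

variable {W : Type u} [Category.{v} W] [SimplicialCategory W]

lemma homEquiv'_comp {A B C : W} (f : A ⟶ B) (g : B ⟶ C) :
    SimplicialCategory.homEquiv' A C (f ≫ g) =
      (eHomWhiskerLeft SSet.{v} A g).app _ (SimplicialCategory.homEquiv' A B f) := by
  have h : eHomEquiv SSet.{v} (f ≫ g) = eHomEquiv SSet.{v} f ≫ eHomWhiskerLeft SSet.{v} A g := by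
    rw [eHomEquiv_comp, eHomWhiskerLeft, MonoidalCategory.tensorHom_def, unitors_inv_equal,
      Category.assoc, rightUnitor_inv_naturality_assoc]
  change (A ⟶[SSet.{v}] C).unitHomEquiv (eHomEquiv SSet.{v} (f ≫ g)) = _
  rw [h]
  rfl

section

variable [HasCopowers W]

/-- Maps out of `A ⊙ Δ[0]` are maps out of `A`. -/
def copowerPointEquiv (A B : W) :
    (((copowerFunctor W).obj A).obj Δ[0] ⟶ B) ≃ (A ⟶ B) :=
  (copowerEquiv A Δ[0] B).trans
    (SSet.yonedaEquiv.trans (SimplicialCategory.homEquiv' A B).symm)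

lemma copowerPointEquiv_comp {A B C : W} (f : ((copowerFunctor W).obj A).obj Δ[0] ⟶ B)
    (g : B ⟶ C) : copowerPointEquiv A C (f ≫ g) = copowerPointEquiv A B f ≫ g := by
  refine (Equiv.symm_apply_eq (SimplicialCategory.homEquiv' A C)).2 ?_
  rw [homEquiv'_comp, copowerEquiv_comp, SSet.yonedaEquiv_comp]
  refine congrArg _ ?_
  exact (Equiv.apply_symm_apply _ _).symm

variable (W) in
/-- The isomorphism `A ⊙ Δ[0] ≅ A`. -/
def copowerPointIso (A : W) : ((copowerFunctor W).obj A).obj Δ[0] ≅ A where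
  hom := (copowerPointEquiv A A).symm (𝟙 A)
  inv := copowerPointEquiv A _ (𝟙 _)
  hom_inv_id := (copowerPointEquiv A _).injective (by
    rw [copowerPointEquiv_comp, Equiv.apply_symm_apply, Category.id_comp])
  inv_hom_id := by
    rw [← copowerPointEquiv_comp, Category.id_comp, Equiv.apply_symm_apply]

end

variable [ModelCategory W] [IsSimplicialModelCategory W]

/-- Copowers of the initial object are initial, so the pushout-product of `∅ ⟶ A` with `s` is `A ⊙
s` itself. The empty simplicial set plays the same role in the other variable. -/
instance cofibration_copower_map (A : W) [IsCofibrant A] {K L : SSet.{v}} (s : K ⟶ L) [Mono s] :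
    Cofibration (((copowerFunctor W).obj A).map s) :=
  IsSimplicialModelCategory.cofibration (initial.to A) s
    (.ofIsInitialLeft _ _ _ initialIsInitial)

lemma weakEquivalence_copower_map (A : W) [IsCofibrant A] {K L : SSet.{v}} (s : K ⟶ L) [Mono s]
    (hs : anodyneExtensions s) : WeakEquivalence (((copowerFunctor W).obj A).map s) :=
  IsSimplicialModelCategory.weakEquivalence (initial.to A) s
    (.ofIsInitialLeft _ _ _ initialIsInitial) (Or.inr hs)

instance cofibration_copower_map_app {A B : W} (f : A ⟶ B) [Cofibration f] (K : SSet.{v}) :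
    Cofibration (((copowerFunctor W).map f).app K) :=
  IsSimplicialModelCategory.cofibration f (initial.to K)
    (.ofIsInitialRight _ _ _ initialIsInitial)

instance isCofibrant_copower (A : W) [IsCofibrant A] (K : SSet.{v}) :
    IsCofibrant (((copowerFunctor W).obj A).obj K) :=
  (isCofibrant_iff_of_isInitial (((copowerFunctor W).map (initial.to A)).app K)
    (IsInitial.isInitialObj ((copowerFunctor W).flip.obj K) _ initialIsInitial)).2 inferInstance

namespace EulerCharacteristic

variable {k : Type w} [AddCommGroup k] (χ : EulerCharacteristic W k)

/-- The initial vertex is an anodyne inclusion, so it induces a weak equivalence from `A ⊙ Δ[0] ≅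
A`. -/
lemma mem_copower_stdSimplex {A : W} [IsCofibrant A] {a : k} (ha : a ∈ χ.toPFun A) (n : ℕ) :
    a ∈ χ.toPFun (((copowerFunctor W).obj A).obj Δ[n]) :=
  let s : (Δ[0] : SSet.{v}) ⟶ Δ[n] := SSet.const (stdSimplex.obj₀Equiv.symm 0)
  have : IsSplitMono s :=
    ⟨⟨stdSimplex.isTerminalObj₀.from _, stdSimplex.isTerminalObj₀.hom_ext _ _⟩⟩
  have := weakEquivalence_copower_map A s (anodyneExtensions_initialVertex n)
  χ.mem_of_weakEquivalence (((copowerFunctor W).obj A).map s) (χ.mem_of_iso (copowerPointIso W A).symm ha)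

end EulerCharacteristic

end CopowerModel

/-! ### Euler characteristic of a copower with the boundary of a simplex -/

section

open Simplicial SSet

variable {W : Type u} [Category.{v} W] [SimplicialCategory W]
  [ModelCategory W] [IsSimplicialModelCategory W]
  {k : Type w} [Ring k] (χ : EulerCharacteristic W k)

/-- Horn and face each count `a` and are glued along the previous boundary, so the values satisfy `e
(n + 1) = a + a - e n` with `e 0 = 0`, the boundary of a point being empty. -/
lemma EulerCharacteristic.mem_copower_boundary {A : W} [IsCofibrant A] {a : k}
    (ha : a ∈ χ.toPFun A) (n : ℕ) :
    a * (1 - (-1) ^ n) ∈ χ.toPFun (((copowerFunctor W).obj A).obj (∂Δ[n] : SSet.{v})) := by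
  induction n with
  | zero =>
    rw [pow_zero, sub_self, mul_zero, boundary_zero]
    exact χ.mem_of_isInitial (IsInitial.isInitialObj ((copowerFunctor W).obj A) _
      Subcomplex.isInitialBot)
  | succ n ih =>
    have sq := (bicartSq_boundary.{v} n).isPushout.map ((copowerFunctor W).obj A)
    -- The intersection in the gluing square is an image under the monomorphism `δ 0`, hence a copy
    -- of `∂Δ[n]`.
    have e1 : (∂Δ[n] : SSet.{v}) ≅ (boundary.{v} n).image (stdSimplex.δ 0) :=
      have : Mono ((boundary.{v} n).toImage (stdSimplex.δ 0)) :=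
        mono_of_mono_fac (Subcomplex.toImage_ι (boundary.{v} n) (stdSimplex.δ 0))
      have := isIso_of_mono_of_epi ((boundary.{v} n).toImage (stdSimplex.δ 0))
      asIso ((boundary.{v} n).toImage (stdSimplex.δ 0))
    have := weakEquivalence_copower_map A _ (anodyneExtensions.horn_ι.{v} (n := n + 1) 0)
    have h := χ.mem_of_isPushout sq (χ.mem_of_iso (((copowerFunctor W).obj A).mapIso e1) ih)
      (χ.mem_of_weakEquivalence' (((copowerFunctor W).obj A).map Λ[n + 1, 0].ι)
        (χ.mem_copower_stdSimplex ha (n + 1)))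
      (χ.mem_of_iso (((copowerFunctor W).obj A).mapIso (stdSimplex.faceSingletonComplIso 0))
        (χ.mem_copower_stdSimplex ha n))
    convert h using 1
    rw [pow_succ]
    noncomm_ring

end

/-! ### Universal property of latching objects -/

section LatchingObject

variable {W : Type u} [Category.{v} W] {E : Type u₁} [Category.{v₁} E]
  (π : E ⥤ SimplexCategoryᵒᵖ) (p : E)
  [HasColimitsOfShape (IsDegeneracy π p).FullSubcategory W] (F : E ⥤ W)

/-- The map to the latching object that corresponds to a degeneracy. -/
def latchingι {q : E} (σ : q ⟶ p) (hσ : IsDegeneracy π p (Over.mk σ)) :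
    F.obj q ⟶ latchingObj π p F :=
  colimit.ι ((IsDegeneracy π p).ι ⋙ Over.forget p ⋙ F) ⟨Over.mk σ, hσ⟩

lemma latchingι_latchingMap {q : E} (σ : q ⟶ p) (hσ : IsDegeneracy π p (Over.mk σ)) :
    latchingι π p F σ hσ ≫ latchingMap π p F = F.map σ :=
  colimit.ι_desc _ _

lemma map_latchingι {q q' : E} (σ : q ⟶ p) (hσ : IsDegeneracy π p (Over.mk σ)) (σ' : q' ⟶ p)
    (hσ' : IsDegeneracy π p (Over.mk σ')) (τ : q ⟶ q') (h : τ ≫ σ' = σ) :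
    F.map τ ≫ latchingι π p F σ' hσ' = latchingι π p F σ hσ :=
  colimit.w ((IsDegeneracy π p).ι ⋙ Over.forget p ⋙ F)
    (j' := ⟨Over.mk σ, hσ⟩) (j := ⟨Over.mk σ', hσ'⟩) (ObjectProperty.homMk (Over.homMk τ h))

/-- A colimit-preserving functor `G` is built in because the property is needed for `H ⊗ L` and `L ⊙
K` as well as for the latching object `L` itself. -/
lemma latchingObj_map_existsUnique_desc {W' : Type*} [Category* W'] (G : W ⥤ W')
    [PreservesColimitsOfShape (IsDegeneracy π p).FullSubcategory G] {Z : W'}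
    (φ : ∀ (q : E) (σ : q ⟶ p) (_ : IsDegeneracy π p (Over.mk σ)), G.obj (F.obj q) ⟶ Z)
    (hφ : ∀ (q q' : E) (σ : q ⟶ p) (hσ : IsDegeneracy π p (Over.mk σ)) (σ' : q' ⟶ p)
      (hσ' : IsDegeneracy π p (Over.mk σ')) (τ : q ⟶ q') (_ : τ ≫ σ' = σ),
      G.map (F.map τ) ≫ φ q' σ' hσ' = φ q σ hσ) :
    ∃! g : G.obj (latchingObj π p F) ⟶ Z, ∀ (q : E) (σ : q ⟶ p)
      (hσ : IsDegeneracy π p (Over.mk σ)), G.map (latchingι π p F σ hσ) ≫ g = φ q σ hσ := by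
  let K := (IsDegeneracy π p).ι ⋙ Over.forget p ⋙ F
  let hc := isColimitOfPreserves G (colimit.isColimit K)
  let c : Cocone (K ⋙ G) :=
    { pt := Z
      ι :=
        { app d := φ d.obj.left d.obj.hom d.property
          naturality d d' f := (hφ _ _ _ d.property _ d'.property f.hom.left
            (Over.w f.hom)).trans (Category.comp_id _).symm } }
  exact ⟨hc.desc c, fun q σ hσ => hc.fac c ⟨Over.mk σ, hσ⟩,
    fun g hg => hc.uniq c g fun d => hg d.obj.left d.obj.hom d.property⟩

lemma latchingObj_map_hom_ext {W' : Type*} [Category* W'] (G : W ⥤ W')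
    [PreservesColimitsOfShape (IsDegeneracy π p).FullSubcategory G] {Z : W'}
    {f g : G.obj (latchingObj π p F) ⟶ Z}
    (h : ∀ (q : E) (σ : q ⟶ p) (hσ : IsDegeneracy π p (Over.mk σ)),
      G.map (latchingι π p F σ hσ) ≫ f = G.map (latchingι π p F σ hσ) ≫ g) : f = g := by
  obtain ⟨u, -, hu⟩ := latchingObj_map_existsUnique_desc π p F G
    (fun q σ hσ => G.map (latchingι π p F σ hσ) ≫ g) (fun q q' σ hσ σ' hσ' τ hτ => by
      rw [← Category.assoc, ← G.map_comp, map_latchingι π p F σ hσ σ' hσ' τ hτ])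
  rw [hu f h, hu g fun _ _ _ => rfl]

end LatchingObject

/-! ### Coends over truncations of the simplex category, and the attaching maps -/

section TruncatedRealization

open Simplicial

variable {W : Type u} [Category.{v} W] [SimplicialCategory W] [HasCopowers W]

/-- The object `B_m ⊙ Δ^p`. -/
abbrev cellObj (B : SimplicialObject W) (m p : SimplexCategory) : W :=
  ((copowerFunctor W).obj (B.obj (op m))).obj (SSet.stdSimplex.{v}.obj p)

/-- The covariant functoriality of `B_m ⊙ Δ^p` in `p`. -/
abbrev cellMap (B : SimplicialObject W) (m : SimplexCategory) {p q : SimplexCategory} (α : p ⟶ q) :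
    cellObj B m p ⟶ cellObj B m q :=
  ((copowerFunctor W).obj (B.obj (op m))).map (SSet.stdSimplex.{v}.map α)

/-- The contravariant functoriality of `B_m ⊙ Δ^p` in `m`. -/
abbrev cellOp (B : SimplicialObject W) {m m' : SimplexCategory} (β : m ⟶ m')
    (p : SimplexCategory) : cellObj B m' p ⟶ cellObj B m p :=
  ((copowerFunctor W).map (B.map β.op)).app (SSet.stdSimplex.{v}.obj p)

lemma stdSimplex_map_comp {p q r : SimplexCategory} (α : p ⟶ q) (β : q ⟶ r) :
    SSet.stdSimplex.{v}.map (α ≫ β) = SSet.stdSimplex.map α ≫ SSet.stdSimplex.map β :=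
  CategoryTheory.Functor.map_comp _ _ _

lemma cellMap_comp (B : SimplicialObject W) (m : SimplexCategory) {p q r : SimplexCategory}
    (α : p ⟶ q) (β : q ⟶ r) : cellMap B m (α ≫ β) = cellMap B m α ≫ cellMap B m β := by
  rw [cellMap, stdSimplex_map_comp, Functor.map_comp]

lemma cellOp_comp (B : SimplicialObject W) {m m' m'' : SimplexCategory} (β : m ⟶ m')
    (β' : m' ⟶ m'') (p : SimplexCategory) :
    cellOp B (β ≫ β') p = cellOp B β' p ≫ cellOp B β p := by
  rw [cellOp, op_comp, Functor.map_comp, Functor.map_comp, NatTrans.comp_app]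

lemma cellMap_cellOp (B : SimplicialObject W) {m m' p q : SimplexCategory} (β : m ⟶ m')
    (α : p ⟶ q) : cellMap B m' α ≫ cellOp B β q = cellOp B β p ≫ cellMap B m α :=
  ((copowerFunctor W).map (B.map β.op)).naturality _

/-- The coend of the objects `B_m ⊙ Δ^m` over the objects `[m]` of the simplex category with
`P m`. -/
structure TruncatedRealization (B : SimplicialObject W) (P : ℕ → Prop) where
  /-- The coend. -/
  pt : W
  /-- The inclusion of a diagonal value. -/
  ι (m : SimplexCategory) (hm : P m.len) : cellObj B m m ⟶ pt
  condition {i j : SimplexCategory} (hi : P i.len) (hj : P j.len) (f : i ⟶ j) :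
    cellOp B f i ≫ ι i hi = cellMap B j f ≫ ι j hj
  existsUnique {Z : W} (φ : ∀ m : SimplexCategory, P m.len → (cellObj B m m ⟶ Z))
    (hφ : ∀ {i j : SimplexCategory} (hi : P i.len) (hj : P j.len) (f : i ⟶ j),
      cellOp B f i ≫ φ i hi = cellMap B j f ≫ φ j hj) :
    ∃! u : pt ⟶ Z, ∀ m hm, ι m hm ≫ u = φ m hm

section

variable [HasColimits W]

/-- The realization is the coend over all objects. -/
def totalRealization (B : SimplicialObject W) : TruncatedRealization B fun _ => True where
  pt := realization B
  ι m _ := coend.ι (realizationDiagram B) m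
  condition _ _ f := coend.condition (realizationDiagram B) f
  existsUnique φ hφ := ⟨coend.desc (F := realizationDiagram B) (fun m => φ m trivial)
      fun _ _ f => hφ trivial trivial f,
    fun _ _ => coend.ι_desc (F := realizationDiagram B) _ _ _,
    fun _ hu => coend.hom_ext (F := realizationDiagram B) fun m => (hu m trivial).trans
      (coend.ι_desc (F := realizationDiagram B) (fun m => φ m trivial)
        (fun _ _ f => hφ trivial trivial f) m).symm⟩

/-- The skeletal realization is the coend over the objects of dimension at most `n`. -/
def boundedRealization (n : ℕ) (B : SimplicialObject W) :
    TruncatedRealization B fun m => m ≤ n :=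
  let F := (SimplexCategory.Truncated.inclusion n).op ⋙ realizationDiagram B ⋙
      (Functor.whiskeringLeft _ _ _).obj (SimplexCategory.Truncated.inclusion n)
  { pt := skeletalRealization n B
    ι m hm := coend.ι F ⟨m, hm⟩
    condition hi hj f :=
      coend.condition F (i := ⟨_, hi⟩) (j := ⟨_, hj⟩) (ObjectProperty.homMk f)
    existsUnique φ hφ := ⟨coend.desc (F := F) (fun m => φ m.obj m.property)
        fun i j f => hφ i.property j.property f.hom,
      fun m hm => coend.ι_desc (F := F) _ _ ⟨m, hm⟩,
      fun _ hu => coend.hom_ext (F := F) fun m => (hu m.obj m.property).trans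
        (coend.ι_desc (F := F) (fun m => φ m.obj m.property)
        (fun i j f => hφ i.property j.property f.hom) m).symm⟩ }

end

namespace TruncatedRealization

variable {B : SimplicialObject W} {P Q : ℕ → Prop}

lemma hom_ext (C : TruncatedRealization B P) {Z : W} {u u' : C.pt ⟶ Z}
    (h : ∀ m hm, C.ι m hm ≫ u = C.ι m hm ≫ u') : u = u' := by
  obtain ⟨w, -, hw⟩ := C.existsUnique (fun m hm => C.ι m hm ≫ u') (fun hi hj f => by
    rw [← Category.assoc, C.condition hi hj f, Category.assoc])
  rw [hw u h, hw u' fun _ _ => rfl]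

/-- Maps out of a truncated realization. -/
def desc (C : TruncatedRealization B P) {Z : W}
    (φ : ∀ m : SimplexCategory, P m.len → (cellObj B m m ⟶ Z))
    (hφ : ∀ {i j : SimplexCategory} (hi : P i.len) (hj : P j.len) (f : i ⟶ j),
      cellOp B f i ≫ φ i hi = cellMap B j f ≫ φ j hj) : C.pt ⟶ Z :=
  (C.existsUnique φ hφ).choose

lemma ι_desc (C : TruncatedRealization B P) {Z : W}
    (φ : ∀ m : SimplexCategory, P m.len → (cellObj B m m ⟶ Z))
    (hφ : ∀ {i j : SimplexCategory} (hi : P i.len) (hj : P j.len) (f : i ⟶ j),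
      cellOp B f i ≫ φ i hi = cellMap B j f ≫ φ j hj)
    (m : SimplexCategory) (hm : P m.len) : C.ι m hm ≫ C.desc φ hφ = φ m hm :=
  (C.existsUnique φ hφ).choose_spec.1 m hm

/-- The map between the coends over two families of objects. -/
def incl (C : TruncatedRealization B P) (C' : TruncatedRealization B Q) (h : ∀ m, P m → Q m) :
    C.pt ⟶ C'.pt :=
  C.desc (fun m hm => C'.ι m (h _ hm)) fun hi hj f => C'.condition (h _ hi) (h _ hj) f

lemma ι_incl (C : TruncatedRealization B P) (C' : TruncatedRealization B Q) (h : ∀ m, P m → Q m)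
    (m : SimplexCategory) (hm : P m.len) : C.ι m hm ≫ C.incl C' h = C'.ι m (h _ hm) :=
  C.ι_desc (fun m hm => C'.ι m (h _ hm)) (fun hi hj f => C'.condition (h _ hi) (h _ hj) f) m hm

/-- The composite `B_N ⊙ Δ^p ⟶ B_N ⊙ Δ^r ⟶ B_r ⊙ Δ^r ⟶ C` for `α : p ⟶ r` and `β : r ⟶ N`. -/
def trace (C : TruncatedRealization B P) {p r N : SimplexCategory} (hr : P r.len) (α : p ⟶ r)
    (β : r ⟶ N) : cellObj B N p ⟶ C.pt :=
  cellMap B N α ≫ cellOp B β r ≫ C.ι r hr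

lemma trace_comp (C : TruncatedRealization B P) {p r r' N : SimplexCategory} (hr : P r.len)
    (hr' : P r'.len) (α : p ⟶ r) (γ : r ⟶ r') (β : r' ⟶ N) :
    C.trace hr' (α ≫ γ) β = C.trace hr α (γ ≫ β) := by
  rw [trace, trace, cellMap_comp, cellOp_comp, Category.assoc, Category.assoc,
    C.condition hr hr' γ, reassoc_of% @cellMap_cellOp]

/-- Both traces equal the one through the image of the common composite: dinaturality moves the
middle object from `r` to the image of `β`, and from there to the image of the composite, and these
images still have dimension at most `n`. So the way in which a simplex factors through low
dimensions is irrelevant. -/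
lemma trace_eq {n : ℕ} (C : TruncatedRealization B fun m => m ≤ n) {p r r' N : SimplexCategory}
    (hr : r.len ≤ n) (hr' : r'.len ≤ n) (α : p ⟶ r) (β : r ⟶ N) (α' : p ⟶ r') (β' : r' ⟶ N)
    (h : α ≫ β = α' ≫ β') : C.trace hr α β = C.trace hr' α' β' := by
  have key (s : p ⟶ N) (hs : (image s).len ≤ n) (r : SimplexCategory) (hr : r.len ≤ n)
      (α : p ⟶ r) (β : r ⟶ N) (h : α ≫ β = s) :
      C.trace hr α β = C.trace hs (factorThruImage s) (image.ι s) := by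
    have hi : (image β).len ≤ n := (SimplexCategory.len_le_of_epi (factorThruImage β)).trans hr
    let F : MonoFactorisation s :=
      { I := image β, m := image.ι β, e := α ≫ factorThruImage β, fac := by simp [h] }
    rw [← image.lift_fac F, ← trace_comp C hs hi, image.fac_lift]
    change _ = C.trace hi (α ≫ factorThruImage β) (image.ι β)
    rw [trace_comp C hr hi, image.fac]
  have hs : (image (α ≫ β)).len ≤ n := by
    let F : MonoFactorisation (α ≫ β) :=
      { I := image β, m := image.ι β, e := α ≫ factorThruImage β }
    have : Mono (image.lift F) := inferInstance
    exact (SimplexCategory.len_le_of_mono (image.lift F)).trans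
      ((SimplexCategory.len_le_of_epi (factorThruImage β)).trans hr)
  rw [key _ hs r hr α β rfl, key _ hs r' hr' α' β' h.symm]

lemma cellMap_trace (C : TruncatedRealization B P) {q p r N : SimplexCategory} (hr : P r.len)
    (γ : q ⟶ p) (α : p ⟶ r) (β : r ⟶ N) :
    cellMap B N γ ≫ C.trace hr α β = C.trace hr (γ ≫ α) β := by
  rw [trace, trace, cellMap_comp, Category.assoc]

lemma cellOp_trace (C : TruncatedRealization B P) {p r N N' : SimplexCategory} (hr : P r.len)
    (α : p ⟶ r) (β : r ⟶ N) (γ : N ⟶ N') :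
    cellOp B γ p ≫ C.trace hr α β = C.trace hr α (β ≫ γ) := by
  rw [trace, trace, cellOp_comp, Category.assoc, ← reassoc_of% cellMap_cellOp B γ α]

lemma cellOp_cellMap_ι (C : TruncatedRealization B P) {N q q' : SimplexCategory} (hq : P q.len)
    (hq' : P q'.len) (f : N ⟶ q) (f' : N ⟶ q') (τ : q' ⟶ q) (h : f' ≫ τ = f) :
    cellOp B τ N ≫ cellMap B q' f' ≫ C.ι q' hq' = cellMap B q f ≫ C.ι q hq := by
  rw [← reassoc_of% @cellMap_cellOp, C.condition hq' hq, ← h, cellMap_comp, Category.assoc]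

lemma boundary_exists_factor {n : ℕ} {p : SimplexCategory}
    (s : SSet.stdSimplex.obj p ⟶ (∂Δ[n + 1] : SSet.{v})) :
    ∃ (α : p ⟶ ⦋n⦌) (β : ⦋n⦌ ⟶ ⦋n + 1⦌),
      s ≫ ∂Δ[n + 1].ι = SSet.stdSimplex.map (α ≫ β) := by
  obtain ⟨f, hf⟩ := SSet.stdSimplex.map_surjective (s ≫ ∂Δ[n + 1].ι)
  have h : ¬ Function.Surjective f.toOrderHom := by
    have h1 := ((SSet.yonedaEquiv s).2 : _ ∈ ∂Δ[n + 1].obj (op p))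
    have h2 : ((SSet.yonedaEquiv s).1 : Δ[n + 1].obj (op p)) =
        SSet.stdSimplex.objEquiv.symm f := by
      rw [← SSet.yonedaEquiv_map, hf, SSet.yonedaEquiv_comp]
      rfl
    rw [h2] at h1
    exact h1
  obtain ⟨i, θ, rfl⟩ := SimplexCategory.eq_comp_δ_of_not_surjective f h
  exact ⟨θ, SimplexCategory.δ i, hf.symm⟩

variable {n : ℕ}

/-- A simplex of the boundary factors through some `[n] ⟶ [n + 1]`. By `trace_eq` its trace does not
depend on the factorization, so the traces form a compatible family on the simplices. -/
lemma existsUnique_attachBoundary (C : TruncatedRealization B fun m => m ≤ n) :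
    ∃! g : ((copowerFunctor W).obj (B.obj (op ⦋n + 1⦌))).obj (∂Δ[n + 1] : SSet.{v}) ⟶ C.pt,
      ∀ (p r : SimplexCategory) (hr : r.len ≤ n)
        (s : SSet.stdSimplex.obj p ⟶ (∂Δ[n + 1] : SSet.{v})) (α : p ⟶ r) (β : r ⟶ ⦋n + 1⦌)
        (_ : s ≫ ∂Δ[n + 1].ι = SSet.stdSimplex.map (α ≫ β)),
        ((copowerFunctor W).obj (B.obj (op ⦋n + 1⦌))).map s ≫ g = C.trace hr α β := by
  have hs (p : SimplexCategory) (s : SSet.stdSimplex.obj p ⟶ (∂Δ[n + 1] : SSet.{v})) :=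
    boundary_exists_factor s
  choose α β h using hs
  obtain ⟨g, hg, hg'⟩ := copower_existsUnique_desc (A := B.obj (op ⦋n + 1⦌))
    (K := (∂Δ[n + 1] : SSet.{v})) (B := C.pt)
    (fun p s => C.trace le_rfl (α p s) (β p s)) (fun p q γ s => by
      refine (C.cellMap_trace _ _ _ _).trans (C.trace_eq _ _ _ _ _ _ ?_)
      apply SSet.stdSimplex.{v}.map_injective
      rw [← h, Category.assoc, stdSimplex_map_comp, ← h, Category.assoc])
  refine ⟨g, fun p r hr s α' β' hs => ?_, fun g' hg2 => hg' g' fun p s =>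
    hg2 p _ le_rfl s _ _ (h p s)⟩
  rw [hg]
  refine C.trace_eq _ _ _ _ _ _ (SSet.stdSimplex.{v}.map_injective ?_)
  rw [← h, hs]

/-- On the part of the latching object coming from a degeneracy `σ`, the simplex is collapsed along
`σ` and lands in a cell of dimension at most `n`. Copowers with `Δ[n + 1]` preserve the latching
colimit. -/
lemma existsUnique_attachLatching [HasColimits W] [HasPowers W]
    (C : TruncatedRealization B fun m => m ≤ n) :
    ∃! g : ((copowerFunctor W).obj (latchingObj (𝟭 _) (op ⦋n + 1⦌) B)).obj Δ[n + 1] ⟶ C.pt,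
      ∀ (q : SimplexCategoryᵒᵖ) (σ : q ⟶ op ⦋n + 1⦌)
        (hσ : IsDegeneracy (𝟭 _) (op ⦋n + 1⦌) (Over.mk σ)),
        ((copowerFunctor W).map (latchingι (𝟭 _) (op ⦋n + 1⦌) B σ hσ)).app Δ[n + 1] ≫ g =
        cellMap B q.unop σ.unop ≫ C.ι q.unop (Nat.le_of_lt_succ hσ.2) :=
  latchingObj_map_existsUnique_desc (𝟭 _) (op ⦋n + 1⦌) B ((copowerFunctor W).flip.obj Δ[n + 1])
    (fun q σ hσ => cellMap B q.unop σ.unop ≫ C.ι q.unop (Nat.le_of_lt_succ hσ.2))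
    fun _ _ _ _ _ _ τ hτ => C.cellOp_cellMap_ι _ _ _ _ τ.unop (congrArg Quiver.Hom.unop hτ)

end TruncatedRealization

end TruncatedRealization

/-! ### The pushout that attaches the cells of dimension n + 1 -/

section SkeletalPushout

open Simplicial

variable {W : Type u} [Category.{v} W] [SimplicialCategory W] [HasCopowers W]

namespace TruncatedRealization

variable {B : SimplicialObject W} {n : ℕ}

lemma cellOp_id (m p : SimplexCategory) : cellOp B (𝟙 m) p = 𝟙 _ := by
  rw [cellOp, op_id, CategoryTheory.Functor.map_id, CategoryTheory.Functor.map_id, NatTrans.id_app]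

lemma cellMap_id (m p : SimplexCategory) : cellMap B m (𝟙 p) = 𝟙 _ := by
  have h : SSet.stdSimplex.{v}.map (𝟙 p) = 𝟙 _ := CategoryTheory.Functor.map_id _ _
  rw [cellMap, h, CategoryTheory.Functor.map_id]

lemma trace_id {P : ℕ → Prop} (C : TruncatedRealization B P) {p r : SimplexCategory}
    (hr : P r.len) (α : p ⟶ r) : C.trace hr α (𝟙 r) = cellMap B r α ≫ C.ι r hr := by
  rw [trace, cellOp_id, Category.id_comp]

lemma trace_incl {P Q : ℕ → Prop} (C : TruncatedRealization B P) (C' : TruncatedRealization B Q)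
    (h : ∀ m, P m → Q m) {p r N : SimplexCategory} (hr : P r.len) (α : p ⟶ r) (β : r ⟶ N) :
    C.trace hr α β ≫ C.incl C' h = C'.trace (h _ hr) α β := by
  rw [trace, trace, Category.assoc, Category.assoc, ι_incl]

lemma exists_lift_boundary {r : SimplexCategory} (hr : r.len ≤ n) (f : r ⟶ ⦋n + 1⦌) :
    ∃ s : SSet.stdSimplex.obj r ⟶ (∂Δ[n + 1] : SSet.{v}),
      s ≫ ∂Δ[n + 1].ι = SSet.stdSimplex.map f :=
  ⟨SSet.yonedaEquiv.symm ⟨SSet.stdSimplex.objEquiv.symm f, by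
    have := SSet.boundary_obj_eq_univ.{v} r.len (n + 1) (Nat.lt_succ_of_le hr)
    exact this.symm ▸ Set.mem_univ _⟩, rfl⟩

section

variable (C : TruncatedRealization B fun m => m ≤ n)

/-- The attaching map on `B_{n+1} ⊙ ∂Δ^{n+1}`. -/
def attachBoundary :
    ((copowerFunctor W).obj (B.obj (op ⦋n + 1⦌))).obj (∂Δ[n + 1] : SSet.{v}) ⟶ C.pt :=
  C.existsUnique_attachBoundary.choose

lemma map_attachBoundary {p r : SimplexCategory} (hr : r.len ≤ n)
    (s : SSet.stdSimplex.obj p ⟶ (∂Δ[n + 1] : SSet.{v})) (α : p ⟶ r) (β : r ⟶ ⦋n + 1⦌)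
    (h : s ≫ ∂Δ[n + 1].ι = SSet.stdSimplex.map (α ≫ β)) :
    ((copowerFunctor W).obj (B.obj (op ⦋n + 1⦌))).map s ≫ C.attachBoundary = C.trace hr α β :=
  C.existsUnique_attachBoundary.choose_spec.1 p r hr s α β h

variable [HasColimits W] [HasPowers W]

/-- The attaching map on `L_{n+1}B ⊙ Δ^{n+1}`. -/
def attachLatching :
    ((copowerFunctor W).obj (latchingObj (𝟭 _) (op ⦋n + 1⦌) B)).obj Δ[n + 1] ⟶ C.pt :=
  C.existsUnique_attachLatching.choose

lemma map_attachLatching {q : SimplexCategory} (σ : ⦋n + 1⦌ ⟶ q)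
    (hσ : IsDegeneracy (𝟭 _) (op ⦋n + 1⦌) (Over.mk σ.op)) :
    ((copowerFunctor W).map (latchingι (𝟭 _) (op ⦋n + 1⦌) B σ.op hσ)).app Δ[n + 1] ≫
      C.attachLatching = cellMap B q σ ≫ C.ι q (Nat.le_of_lt_succ hσ.2) :=
  C.existsUnique_attachLatching.choose_spec.1 _ σ.op hσ

omit C in
lemma latching_copower_hom_ext {K : SSet.{v}} {Z : W}
    {f g : ((copowerFunctor W).obj (latchingObj (𝟭 _) (op ⦋n + 1⦌) B)).obj K ⟶ Z}
    (h : ∀ (q : SimplexCategory) (σ : ⦋n + 1⦌ ⟶ q)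
      (hσ : IsDegeneracy (𝟭 _) (op ⦋n + 1⦌) (Over.mk σ.op)),
      ((copowerFunctor W).map (latchingι (𝟭 _) (op ⦋n + 1⦌) B σ.op hσ)).app K ≫ f =
      ((copowerFunctor W).map (latchingι (𝟭 _) (op ⦋n + 1⦌) B σ.op hσ)).app K ≫ g) : f = g :=
  latchingObj_map_hom_ext (𝟭 _) (op ⦋n + 1⦌) B ((copowerFunctor W).flip.obj K)
    fun q σ hσ => h q.unop σ.unop hσ

omit C [HasPowers W] in
lemma copower_latchingι_latchingMap {q : SimplexCategory} (σ : ⦋n + 1⦌ ⟶ q)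
    (hσ : IsDegeneracy (𝟭 _) (op ⦋n + 1⦌) (Over.mk σ.op)) (K : SSet.{v}) :
    ((copowerFunctor W).map (latchingι (𝟭 _) (op ⦋n + 1⦌) B σ.op hσ)).app K ≫
      ((copowerFunctor W).map (latchingMap (𝟭 _) (op ⦋n + 1⦌) B)).app K =
    ((copowerFunctor W).map (B.map σ.op)).app K := by
  rw [← NatTrans.comp_app, ← Functor.map_comp, latchingι_latchingMap]

/-- Tested on a simplex of the boundary and on a degeneracy `σ`, both sides are the trace through
`[n]` whose second map is followed by `σ`. -/
lemma attach_w :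
    ((copowerFunctor W).map (latchingMap (𝟭 _) (op ⦋n + 1⦌) B)).app (∂Δ[n + 1] : SSet.{v}) ≫
      C.attachBoundary =
    ((copowerFunctor W).obj (latchingObj (𝟭 _) (op ⦋n + 1⦌) B)).map ∂Δ[n + 1].ι ≫
      C.attachLatching := by
  refine copower_hom_ext_simplices fun p s => latching_copower_hom_ext fun q σ hσ => ?_
  obtain ⟨α, β, h⟩ := boundary_exists_factor s
  have hd : q.len ≤ n := Nat.le_of_lt_succ hσ.2
  trans C.trace le_rfl α (β ≫ σ)
  · rw [← NatTrans.naturality_assoc, reassoc_of% @copower_latchingι_latchingMap,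
      NatTrans.naturality_assoc, C.map_attachBoundary le_rfl s α β h]
    exact C.cellOp_trace _ _ _ _
  · rw [← Functor.map_comp_assoc, h, ← NatTrans.naturality_assoc, C.map_attachLatching σ hσ]
    refine Eq.trans ?_ ((congrArg (fun f => f ≫ C.ι q hd)
      (cellMap_comp B q (α ≫ β) σ)).trans (Category.assoc _ _ _))
    rw [← trace_id, Category.assoc α, C.trace_comp le_rfl hd, Category.comp_id]

variable (sq : (copowerFunctor W).PushoutObjObj (latchingMap (𝟭 _) (op ⦋n + 1⦌) B)
  (∂Δ[n + 1] : SSet.Subcomplex.{v} _).ι)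

/-- The attaching map of the `(n+1)`st stage of the skeletal filtration. -/
def attach : sq.pt ⟶ C.pt :=
  sq.isPushout.desc C.attachBoundary C.attachLatching C.attach_w

lemma attach_incl (C' : TruncatedRealization B fun m => m ≤ n + 1) :
    C.attach sq ≫ C.incl C' (fun _ => Nat.le_succ_of_le) = sq.ι ≫ C'.ι ⦋n + 1⦌ le_rfl := by
  refine sq.hom_ext ?_ ?_
  · rw [attach, sq.isPushout.inl_desc_assoc, sq.inl_ι_assoc]
    refine copower_hom_ext_simplices fun p s => ?_
    obtain ⟨α, β, h⟩ := boundary_exists_factor s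
    rw [← Category.assoc, C.map_attachBoundary le_rfl s α β h, trace_incl,
      ← Functor.map_comp_assoc, h]
    refine Eq.trans ?_ (C'.trace_id le_rfl (α ≫ β))
    rw [C'.trace_comp (Nat.le_succ n) le_rfl, Category.comp_id]
  · rw [attach, sq.isPushout.inr_desc_assoc, sq.inr_ι_assoc]
    refine latching_copower_hom_ext fun q σ hσ => ?_
    rw [← Category.assoc, C.map_attachLatching σ hσ, reassoc_of% @copower_latchingι_latchingMap,
      Category.assoc, ι_incl]
    exact (C'.condition _ _ σ).symm

omit [HasColimits W] [HasPowers W] in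
variable {C} in
-- The map `β` from a lower dimension is a simplex of the boundary, so agreement on `B_{n+1} ⊙
-- ∂Δ^{n+1}` already contains this coend relation.
lemma cell_compat {Z : W} {u : C.pt ⟶ Z} {f : cellObj B ⦋n + 1⦌ ⦋n + 1⦌ ⟶ Z}
    (h1 : ((copowerFunctor W).obj (B.obj (op ⦋n + 1⦌))).map ∂Δ[n + 1].ι ≫ f =
      C.attachBoundary ≫ u) {r : SimplexCategory} (hr : r.len ≤ n) (β : r ⟶ ⦋n + 1⦌) :
    cellOp B β r ≫ C.ι r hr ≫ u = cellMap B ⦋n + 1⦌ β ≫ f := by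
  obtain ⟨s, hs⟩ := exists_lift_boundary hr β
  have h := C.map_attachBoundary hr s (𝟙 r) β (by rw [hs, Category.id_comp])
  rw [cellMap, ← hs, Functor.map_comp, Category.assoc, h1, reassoc_of% h, trace, cellMap_id,
    Category.id_comp, Category.assoc]

variable {C} in
-- For a surjection this relation is agreement on the latching object. A general `α` is a surjection
-- followed by a monomorphism between objects of dimension at most `n`, where the relation holds in
-- `C`.
lemma cell_compat' {Z : W} {u : C.pt ⟶ Z} {f : cellObj B ⦋n + 1⦌ ⦋n + 1⦌ ⟶ Z}
    (h2 : ((copowerFunctor W).map (latchingMap (𝟭 _) (op ⦋n + 1⦌) B)).app Δ[n + 1] ≫ f =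
      C.attachLatching ≫ u) {q : SimplexCategory} (hq : q.len ≤ n) (α : ⦋n + 1⦌ ⟶ q) :
    cellOp B α ⦋n + 1⦌ ≫ f = cellMap B q α ≫ C.ι q hq ≫ u := by
  have key {r : SimplexCategory} (hr : r.len ≤ n) (σ : ⦋n + 1⦌ ⟶ r) [Epi σ] :
      cellOp B σ ⦋n + 1⦌ ≫ f = cellMap B r σ ≫ C.ι r hr ≫ u := by
    have hσ : IsDegeneracy (𝟭 _) (op ⦋n + 1⦌) (Over.mk σ.op) :=
      ⟨SimplexCategory.epi_iff_surjective.1 (inferInstance : Epi σ), Nat.lt_succ_of_le hr⟩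
    rw [cellOp, ← copower_latchingι_latchingMap σ hσ, Category.assoc, h2, ← Category.assoc,
      C.map_attachLatching σ hσ, Category.assoc]
  have hi : (image α).len ≤ n := (SimplexCategory.len_le_of_mono (image.ι α)).trans hq
  rw [← image.fac α, cellOp_comp, Category.assoc, key hi, cellMap_comp, Category.assoc,
    ← reassoc_of% C.condition hi hq, reassoc_of% @cellMap_cellOp]

/-- Allowing dimension `n + 1` adds one new cell to the coend, with relations for the maps into and
out of `[n + 1]`. Maps from lower dimensions give the relations on the boundary, maps to lower
dimensions those on the latching object, and endomorphisms of `[n + 1]` give nothing new. Together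
they say that the new cell is glued along the pushout-product. -/
lemma isPushout_attach (C' : TruncatedRealization B fun m => m ≤ n + 1) :
    IsPushout (C.attach sq) sq.ι (C.incl C' fun _ => Nat.le_succ_of_le)
      (C'.ι ⦋n + 1⦌ le_rfl) := by
  refine ⟨⟨C.attach_incl sq C'⟩, ⟨PushoutCocone.isColimitAux' _ fun s => ?_⟩⟩
  have h1 : ((copowerFunctor W).obj (B.obj (op ⦋n + 1⦌))).map ∂Δ[n + 1].ι ≫ s.inr =
      C.attachBoundary ≫ s.inl := by
    have := congrArg (sq.inl ≫ ·) s.condition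
    simp only [attach, sq.isPushout.inl_desc_assoc, sq.inl_ι_assoc] at this
    exact this.symm
  have h2 : ((copowerFunctor W).map (latchingMap (𝟭 _) (op ⦋n + 1⦌) B)).app Δ[n + 1] ≫ s.inr =
      C.attachLatching ≫ s.inl := by
    have := congrArg (sq.inr ≫ ·) s.condition
    simp only [attach, sq.isPushout.inr_desc_assoc, sq.inr_ι_assoc] at this
    exact this.symm
  have hm (m : SimplexCategory) (hm : m.len ≤ n + 1) (h : ¬ m.len ≤ n) : ⦋n + 1⦌ = m :=
    SimplexCategory.ext (by change n + 1 = m.len; lia)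
  -- The family on the larger coend: old cells go through `s.inl`, the cell of dimension `n + 1`
  -- through `s.inr`.
  let φ (m : SimplexCategory) (h : m.len ≤ n + 1) : cellObj B m m ⟶ s.pt :=
    if h' : m.len ≤ n then C.ι m h' ≫ s.inl else hm m h h' ▸ s.inr
  have φ1 (m : SimplexCategory) (h : m.len ≤ n + 1) (h' : m.len ≤ n) :
      φ m h = C.ι m h' ≫ s.inl := dif_pos h'
  have φ2 : φ ⦋n + 1⦌ le_rfl = s.inr := dif_neg (Nat.not_succ_le_self n)
  have hφ {i j : SimplexCategory} (hi : i.len ≤ n + 1) (hj : j.len ≤ n + 1) (f : i ⟶ j) :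
      cellOp B f i ≫ φ i hi = cellMap B j f ≫ φ j hj := by
    by_cases hi' : i.len ≤ n
    · rw [φ1 i hi hi']
      by_cases hj' : j.len ≤ n
      · rw [φ1 j hj hj', reassoc_of% C.condition hi' hj' f]
      · obtain rfl := hm j hj hj'
        rw [φ2]
        exact cell_compat h1 hi' f
    · obtain rfl := hm i hi hi'
      rw [φ2]
      by_cases hj' : j.len ≤ n
      · rw [φ1 j hj hj']
        exact cell_compat' h2 hj' f
      · obtain rfl := hm j hj hj'
        rw [φ2]
        -- A surjective endomorphism of `[n + 1]` is the identity; any other factors through `[n]`,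
        -- where the two mixed relations combine.
        by_cases hf : Function.Surjective f.toOrderHom
        · have : Epi f := SimplexCategory.epi_iff_surjective.2 hf
          rw [SimplexCategory.eq_id_of_epi f, cellOp_id, cellMap_id]
        · obtain ⟨i, θ, rfl⟩ := SimplexCategory.eq_comp_δ_of_not_surjective f hf
          rw [cellOp_comp, Category.assoc, cell_compat' h2 (le_refl n) θ, cellMap_comp,
            Category.assoc, ← cell_compat h1 (le_refl n) (SimplexCategory.δ i),
            reassoc_of% @cellMap_cellOp]
  refine ⟨C'.desc φ hφ, ?_, ?_, fun {m} hm1 hm2 => ?_⟩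
  · refine C.hom_ext fun m h => ?_
    change C.ι m h ≫ C.incl C' (fun _ => Nat.le_succ_of_le) ≫ _ = _
    rw [reassoc_of% @ι_incl, ι_desc]
    exact φ1 m (Nat.le_succ_of_le h) h
  · exact (C'.ι_desc φ hφ _ _).trans φ2
  · refine C'.hom_ext fun j hj => ?_
    rw [ι_desc]
    by_cases hj' : j.len ≤ n
    · rw [φ1 j hj hj', ← hm1]
      exact (congrArg (· ≫ m) (C.ι_incl C' (fun _ => Nat.le_succ_of_le) j hj')).symm.trans
        (Category.assoc _ _ _)
    · obtain rfl := hm j hj hj'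
      rw [φ2]
      exact hm2

/-- The pushout-product with an isomorphism is an isomorphism, and so is its pushout along the
attaching map. -/
lemma isIso_incl_of_isIso (C' : TruncatedRealization B fun m => m ≤ n + 1)
    [h : IsIso (latchingMap (𝟭 _) (op ⦋n + 1⦌) B)] :
    IsIso (C.incl C' fun _ => Nat.le_succ_of_le) := by
  let sq := Functor.PushoutObjObj.ofHasPushout (copowerFunctor W)
    (latchingMap (𝟭 _) (op ⦋n + 1⦌) B) (∂Δ[n + 1] : SSet.Subcomplex.{v} _).ι
  have : IsIso sq.inr := sq.isPushout.isIso_inr_of_isIso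
  have : IsIso (sq.inr ≫ sq.ι) := by rw [sq.inr_ι]; infer_instance
  have : IsIso sq.ι := IsIso.of_isIso_comp_left sq.inr sq.ι
  exact (C.isPushout_attach sq C').isIso_inl_of_isIso

end

end TruncatedRealization

end SkeletalPushout

/-! ### The skeletal filtration and its Euler characteristics -/

section SkeletalFiltration

open Simplicial

namespace TruncatedRealization

variable {W : Type u} [Category.{v} W] [SimplicialCategory W] [HasCopowers W]
  {B : SimplicialObject W}

lemma isIso_ι_zero (C : TruncatedRealization B fun m => m ≤ 0) : IsIso (C.ι ⦋0⦌ le_rfl) := by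
  have h0 (m : SimplexCategory) (hm : m.len ≤ 0) : m = ⦋0⦌ :=
    SimplexCategory.ext (by change m.len = 0; lia)
  let φ (m : SimplexCategory) (hm : m.len ≤ 0) : cellObj B m m ⟶ cellObj B ⦋0⦌ ⦋0⦌ :=
    eqToHom (by rw [h0 m hm])
  have hφ {i j : SimplexCategory} (hi : i.len ≤ 0) (hj : j.len ≤ 0) (f : i ⟶ j) :
      cellOp B f i ≫ φ i hi = cellMap B j f ≫ φ j hj := by
    obtain rfl := h0 i hi
    obtain rfl := h0 j hj
    rw [Subsingleton.elim f (𝟙 _), cellOp_id, cellMap_id]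
  have h1 : C.ι ⦋0⦌ le_rfl ≫ C.desc φ hφ = 𝟙 _ := C.ι_desc φ hφ ⦋0⦌ le_rfl
  refine ⟨C.desc φ hφ, h1, C.hom_ext fun m hm => ?_⟩
  obtain rfl := h0 m hm
  rw [reassoc_of% h1, Category.comp_id]

lemma incl_incl {P Q R : ℕ → Prop} (C : TruncatedRealization B P) (D : TruncatedRealization B Q)
    (E : TruncatedRealization B R) (h : ∀ m, P m → Q m) (h' : ∀ m, Q m → R m) :
    C.incl D h ≫ D.incl E h' = C.incl E fun m hm => h' m (h m hm) :=
  C.hom_ext fun m hm => by rw [reassoc_of% @ι_incl, ι_incl, ι_incl]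

lemma incl_self {P : ℕ → Prop} (C : TruncatedRealization B P) (h : ∀ m, P m → P m) :
    C.incl C h = 𝟙 _ :=
  C.hom_ext fun m hm => by rw [ι_incl, Category.comp_id]

variable [HasColimits W]

lemma isIso_incl_of_isSkeletal [HasPowers W] {n : ℕ} (hB : IsSkeletal n B)
    (C : ∀ m, TruncatedRealization B fun i => i ≤ m) {m : ℕ} (h : n ≤ m) :
    IsIso ((C n).incl (C m) fun _ hi => hi.trans h) := by
  induction m, h using Nat.le_induction with
  | base => rw [incl_self]; infer_instance
  | succ m h ih =>
    have := hB (m + 1) (Nat.lt_succ_of_le h)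
    have := (C m).isIso_incl_of_isIso (C (m + 1))
    rw [← incl_incl _ (C m) _ (fun _ hi => hi.trans h) fun _ => Nat.le_succ_of_le]
    infer_instance

/-- From stage `n` on all inclusions of stages are isomorphisms, so a cell of any dimension reaches
stage `n` by inverting the inclusion into a stage that contains it. Compatibility of two cells is
checked in a stage containing both. -/
lemma isIso_incl_total [HasPowers W] {n : ℕ} (hB : IsSkeletal n B)
    (C : ∀ m, TruncatedRealization B fun i => i ≤ m) (D : TruncatedRealization B fun _ => True) :
    IsIso ((C n).incl D fun _ _ => trivial) := by
  have hj (m : ℕ) (h : n ≤ m) : IsIso ((C n).incl (C m) fun _ hi => hi.trans h) :=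
    isIso_incl_of_isSkeletal hB C h
  have hφ (i : SimplexCategory) : ∃ φ : cellObj B i i ⟶ (C n).pt,
      ∀ (m : ℕ) (hi : i.len ≤ m) (hm : n ≤ m),
        φ ≫ (C n).incl (C m) (fun _ hi => hi.trans hm) = (C m).ι i hi := by
    have := hj (max i.len n) (le_max_right _ _)
    refine ⟨(C (max i.len n)).ι i (le_max_left _ _) ≫
      inv ((C n).incl (C (max i.len n)) fun _ hi => hi.trans (le_max_right _ _)),
      fun m hi hm => ?_⟩
    rw [← incl_incl _ (C (max i.len n)) _ (fun _ h => h.trans (le_max_right _ _))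
      fun _ h => h.trans (max_le hi hm), Category.assoc, IsIso.inv_hom_id_assoc, ι_incl]
  choose φ hφ using hφ
  have hφ' {i i' : SimplexCategory} (f : i ⟶ i') :
      cellOp B f i ≫ φ i = cellMap B i' f ≫ φ i' := by
    have hm : n ≤ max n (max i.len i'.len) := le_max_left _ _
    have hi : i.len ≤ max n (max i.len i'.len) := by lia
    have hi' : i'.len ≤ max n (max i.len i'.len) := by lia
    have := hj _ hm
    rw [← cancel_mono ((C n).incl (C _) fun _ hi => hi.trans hm), Category.assoc, Category.assoc,
      hφ i _ hi hm, hφ i' _ hi' hm, (C _).condition hi hi' f]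
  refine ⟨D.desc (fun i _ => φ i) fun _ _ f => hφ' f, ?_, ?_⟩
  · refine hom_ext _ fun i hi => ?_
    have h := hφ i n hi le_rfl
    rw [incl_self, Category.comp_id] at h
    rw [reassoc_of% @ι_incl, ι_desc, Category.comp_id, h]
  · refine hom_ext _ fun i hi => ?_
    have h := hφ i _ (le_max_left _ n) (le_max_right _ _)
    rw [reassoc_of% @ι_desc, Category.comp_id, ← incl_incl _ (C (max i.len n)) _
      (fun _ h => h.trans (le_max_right _ _)) fun _ _ => trivial, reassoc_of% h, ι_incl]

end TruncatedRealization

section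

variable {W : Type u} [Category.{v} W] [ModelCategory W] [HasColimits W] [SimplicialCategory W]
  [IsSimplicialModelCategory W] {k : Type w} [Ring k] (χ : EulerCharacteristic W k)
  (B : SimplicialObject W)

lemma nonempty_iso_of_isSkeletal {n : ℕ} (hB : IsSkeletal n B) :
    Nonempty (skeletalRealization n B ≅ realization B) :=
  have := TruncatedRealization.isIso_incl_total hB (fun m => boundedRealization m B)
    (totalRealization B)
  ⟨(@asIso _ _ (boundedRealization n B).pt (totalRealization B).pt _ this :)⟩

variable (W) in
lemma nonempty_iso_skeletalRealization_zero :
    Nonempty (skeletalRealization 0 B ≅ B.obj (op ⦋0⦌)) :=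
  have := (boundedRealization 0 B).isIso_ι_zero
  ⟨(asIso ((boundedRealization 0 B).ι ⦋0⦌ le_rfl)).symm ≪≫ copowerPointIso W _⟩

variable {B} in
-- With `s = (-1) ^ (n + 1)`, the domain of the pushout-product counts `b * (1 - s) + l - l * (1 -
-- s)`, and attaching adds `b` minus this, that is `(b - l) * s`. Cofibrancy of the new stage is
-- recorded because the next attachment requires it.
lemma TruncatedRealization.mem_succ {n : ℕ} (C : TruncatedRealization B fun m => m ≤ n)
    (C' : TruncatedRealization B fun m => m ≤ n + 1)
    [IsCofibrant (latchingObj (𝟭 _) (op ⦋n + 1⦌) B)]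
    [Cofibration (latchingMap (𝟭 _) (op ⦋n + 1⦌) B)] [IsCofibrant C.pt]
    {l b c : k} (hl : l ∈ χ.toPFun (latchingObj (𝟭 _) (op ⦋n + 1⦌) B))
    (hb : b ∈ χ.toPFun (B.obj (op ⦋n + 1⦌))) (hc : c ∈ χ.toPFun C.pt) :
    IsCofibrant C'.pt ∧ c + (-1) ^ (n + 1) * (b - l) ∈ χ.toPFun C'.pt := by
  have : IsCofibrant (B.obj (op ⦋n + 1⦌)) :=
    isCofibrant_of_cofibration (latchingMap (𝟭 _) (op ⦋n + 1⦌) B)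
  let sq := Functor.PushoutObjObj.ofHasPushout (copowerFunctor W)
    (latchingMap (𝟭 _) (op ⦋n + 1⦌) B) (∂Δ[n + 1] : SSet.Subcomplex.{v} _).ι
  have hsq : Cofibration sq.ι := IsSimplicialModelCategory.cofibration _ _ sq
  have po := (C.isPushout_attach sq C').flip
  have : Cofibration sq.inr := cofibration_of_isPushout sq.isPushout
  have : IsCofibrant sq.pt := isCofibrant_of_cofibration sq.inr
  have hp := χ.mem_of_isPushout sq.isPushout (χ.mem_copower_boundary hl (n + 1))
    (χ.mem_copower_boundary hb (n + 1)) (χ.mem_copower_stdSimplex hl (n + 1))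
  have h := χ.mem_of_isPushout po hp (χ.mem_copower_stdSimplex hb (n + 1)) hc
  have hi := cofibration_of_isPushout po
  refine ⟨isCofibrant_of_cofibration (C.incl C' fun _ => Nat.le_succ_of_le), ?_⟩
  convert h using 1
  -- The gluing count has the sign on the right; powers of `-1` commute with everything even if `k`
  -- is not commutative.
  rw [((Commute.neg_one_left (b - l)).pow_left (n + 1)).eq]
  noncomm_ring

end

end SkeletalFiltration

/-! ### Inserting identities into chains -/

section Spread

variable {W : Type u} [Category.{v} W] [MonoidalCategory W]

lemma eqToHom_whiskerLeft_eqToHom {A A' A'' C C' D D' : W} (hA : A = A') (hA' : A' = A'')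
    (hC : C = C') (s : C' ⟶ D) (hD : D = D') (h : A ⊗ C = A' ⊗ C') (h' : A' ⊗ D = A'' ⊗ D') :
    eqToHom h ≫ A' ◁ s ≫ eqToHom h' =
      A ◁ (eqToHom hC ≫ s ≫ eqToHom hD) ≫ eqToHom (hA.trans hA') ▷ D' := by
  subst hA hA' hC hD
  simp

variable {Y : Type w} [EnrichedCategory W Y]

/-- Insert identities in a chain along a monotone `q` with `q 0 = 0`, and compose the hom-factors
between consecutive values of `q`. -/
def spread (y : ℕ → Y) (Z : W) (q : ℕ → ℕ) (hq : Monotone q) (h0 : q 0 = 0) :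
    ∀ m : ℕ, chain y Z (q m) ⟶ chain (fun r => y (q r)) Z m
  | 0 => eqToHom (by rw [h0])
  | m + 1 => push y Z (hq (Nat.le_succ m)) ≫ _ ◁ spread y Z q hq h0 m

/-- A variant of `spread` between chains that are given up to equality. -/
def spreadTo (y z : ℕ → Y) (Z : W) (q : ℕ → ℕ) (hq : Monotone q) (h0 : q 0 = 0) {k m : ℕ}
    (hk : q m = k) (hz : ∀ r ≤ m, y (q r) = z r) : chain y Z k ⟶ chain z Z m :=
  eqToHom (by rw [hk]) ≫ spread y Z q hq h0 m ≫ eqToHom (chain_congr _ _ _ _ hz)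

variable (y z : ℕ → Y) (Z : W) (q : ℕ → ℕ) (hq : Monotone q) (h0 : q 0 = 0) {k m : ℕ}

lemma push_eq_of_eq {a b : ℕ} (h : a ≤ b) (e : b = a) :
    push y Z h = eqToHom (by rw [e]) ≫ (λ_ _).inv ≫ eId W (y a) ▷ chain y Z a ≫
      eqToHom (by rw [e]) := by
  subst e
  rw [push_self]
  simp

lemma eId_whiskerRight_eqToHom {a b c d : Y} (hb : a = b) (hc : a = c) (hd : a = d) {C D D' : W}
    (s : C ⟶ D) (hD : D = D') (h : ((a ⟶[W] a) ⊗ C : W) = (b ⟶[W] a) ⊗ C)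
    (h' : ((b ⟶[W] a) ⊗ D : W) = (d ⟶[W] c) ⊗ D') (h'' : (c ⟶[W] c) = d ⟶[W] c) :
    (λ_ C).inv ≫ eId W a ▷ C ≫ eqToHom h ≫ (b ⟶[W] a) ◁ s ≫ eqToHom h' =
      (s ≫ eqToHom hD) ≫ (λ_ D').inv ≫ eId W c ▷ D' ≫ eqToHom h'' ▷ D' := by
  subst hb hc hd hD
  simp [← whisker_exchange]

lemma push_eq_of_eq_succ {a b : ℕ} (h : a ≤ b) (e : b = a + 1) :
    push y Z h = eqToHom (by rw [e]) := by
  subst e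
  exact push_one y Z a

/-- When `q` increases by one there is a single hom-factor to compose, so `push` is a transport and
the leftmost factor stays untouched. -/
lemma spreadTo_succ (hk : q m = k) (hk' : q (m + 1) = k + 1) (hz : ∀ r ≤ m + 1, y (q r) = z r) :
    spreadTo y z Z q hq h0 hk' hz =
      (y (k + 1) ⟶[W] y k) ◁ spreadTo y z Z q hq h0 hk (fun r hr => hz r (Nat.le_succ_of_le hr)) ≫
        eqToHom (by rw [← hz m (Nat.le_succ m), ← hz (m + 1) le_rfl, hk, hk']) ▷ _ := by
  subst hk
  rw [spreadTo, spread, push_eq_of_eq_succ _ _ _ hk', Category.assoc, eqToHom_trans_assoc]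
  exact eqToHom_whiskerLeft_eqToHom (by rw [hk'])
    (by rw [hz m (Nat.le_succ m), hz (m + 1) le_rfl]) rfl (spread y Z q hq h0 m) _ _ _

/-- When `q` is stationary, `push` inserts an identity, which the interchange law slides past the
remaining map to become the new leftmost factor. -/
lemma spreadTo_of_eq (hk : q m = k) (hk' : q (m + 1) = k) (hz : ∀ r ≤ m + 1, y (q r) = z r) :
    spreadTo y z Z q hq h0 hk' hz =
      spreadTo y z Z q hq h0 hk (fun r hr => hz r (Nat.le_succ_of_le hr)) ≫
        (λ_ _).inv ≫ eId W (z m) ▷ _ ≫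
        eqToHom (by rw [← hz m (Nat.le_succ m), ← hz (m + 1) le_rfl, hk, hk']) ▷ _ := by
  subst hk
  rw [spreadTo, spread, push_eq_of_eq _ _ _ hk']
  simp only [Category.assoc, eqToHom_trans_assoc]
  rw [eId_whiskerRight_eqToHom (by rw [hk']) (hz m (Nat.le_succ m))
    (by rw [← hz (m + 1) le_rfl, hk']) (spread y Z q hq h0 m)
    (chain_congr _ _ _ _ fun r hr => hz r (Nat.le_succ_of_le hr)) _ _
    (by rw [← hz m (Nat.le_succ m), ← hz (m + 1) le_rfl, hk']), spreadTo]
  simp only [Category.assoc, eqToHom_refl, Category.id_comp]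

lemma eqToHom_eId_whiskerRight {a a' : Y} {B B' C C' : W} (ha : a = a') (hC : C' = C)
    (e : (a ⟶[W] a) = B) (e' : (a' ⟶[W] a') = B') (h : B' ⊗ C' = B ⊗ C) :
    eqToHom hC ≫ (λ_ C).inv ≫ eId W a ▷ C ≫ eqToHom e ▷ C =
      (λ_ C').inv ≫ eId W a' ▷ C' ≫ eqToHom e' ▷ C' ≫ eqToHom h := by
  subst ha hC e e'
  simp

lemma whiskerLeft_conj_eqToHom {A A' B B' C C' D D' : W} (s : C' ⟶ D') (hA : A = A')
    (hC : C = C') (hD : D' = D) (hB : A = B) (hB' : A' = B') (h : A ⊗ C = A' ⊗ C')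
    (h' : B' ⊗ D' = B ⊗ D) :
    A ◁ (eqToHom hC ≫ s ≫ eqToHom hD) ≫ eqToHom hB ▷ D =
      eqToHom h ≫ (A' ◁ s ≫ eqToHom hB' ▷ D') ≫ eqToHom h' := by
  subst hA hC hD hB hB'
  simp

/-- Chains are indexed by functions on all of `ℕ`, but only an initial segment matters. Words of a
list and of its tail agree only there, so their maps are compared up to transport, by induction over
steps which `hs` restricts to size zero or one. -/
lemma spreadTo_congr {y' z' : ℕ → Y} {q' : ℕ → ℕ} (hq' : Monotone q') (h0' : q' 0 = 0)
    (hk : q m = k) (hz : ∀ r ≤ m, y (q r) = z r) (hk' : q' m = k)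
    (hz' : ∀ r ≤ m, y' (q' r) = z' r) (hy : ∀ r ≤ k, y r = y' r) (hzz : ∀ r ≤ m, z r = z' r)
    (hqq : ∀ r ≤ m, q r = q' r) (hs : ∀ r < m, q (r + 1) ≤ q r + 1) :
    spreadTo y z Z q hq h0 hk hz = eqToHom (chain_congr _ _ _ _ hy) ≫
      spreadTo y' z' Z q' hq' h0' hk' hz' ≫ eqToHom (chain_congr _ _ _ _ hzz).symm := by
  induction m generalizing k with
  | zero =>
    subst hk
    simp [spreadTo, spread]
  | succ m ih =>
    have hz1 := fun r (hr : r ≤ m) => hz r (Nat.le_succ_of_le hr)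
    have hz1' := fun r (hr : r ≤ m) => hz' r (Nat.le_succ_of_le hr)
    have hkk := hk'
    rcases (hq (Nat.le_succ m)).eq_or_lt with h | h
    · have h1 : q m = k := h.trans hk
      have h1' : q' m = k := (hqq m (Nat.le_succ m)).symm.trans h1
      rw [spreadTo_of_eq y z Z q hq h0 h1 hk hz, spreadTo_of_eq y' z' Z q' hq' h0' h1' hk' hz',
        ih h1 hz1 h1' hz1' hy (fun r hr => hzz r (Nat.le_succ_of_le hr))
          (fun r hr => hqq r (Nat.le_succ_of_le hr)) fun r hr => hs r (Nat.lt_succ_of_lt hr)]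
      simp only [Category.assoc]
      rw [eqToHom_eId_whiskerRight (hzz m (Nat.le_succ m))]
    · obtain ⟨l, rfl⟩ : ∃ l, k = l + 1 := ⟨q m, by have := hs m (Nat.lt_succ_self m); lia⟩
      have h1 : q m = l := by have := hs m (Nat.lt_succ_self m); lia
      have h1' : q' m = l := (hqq m (Nat.le_succ m)).symm.trans h1
      rw [spreadTo_succ y z Z q hq h0 h1 hk hz, spreadTo_succ y' z' Z q' hq' h0' h1' hk' hz',
        ih h1 hz1 h1' hz1' (fun r hr => hy r (Nat.le_succ_of_le hr))
          (fun r hr => hzz r (Nat.le_succ_of_le hr))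
          (fun r hr => hqq r (Nat.le_succ_of_le hr)) fun r hr => hs r (Nat.lt_succ_of_lt hr)]
      exact whiskerLeft_conj_eqToHom _ (by rw [hy _ le_rfl, hy _ (Nat.le_succ l)]) _ _ _ _ _ _

end Spread

/-! ### Degeneracies of the magnitude nerve as maps of chains -/

section Degeneracies

lemma monotone_surjective_zero {n k : ℕ} {f : Fin (n + 1) →o Fin (k + 1)}
    (hf : Function.Surjective f) : f 0 = 0 := by
  obtain ⟨i, hi⟩ := hf 0
  exact Fin.le_zero_iff.1 ((f.monotone (Fin.zero_le i)).trans hi.le)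

lemma monotone_surjective_last {n k : ℕ} {f : Fin (n + 1) →o Fin (k + 1)}
    (hf : Function.Surjective f) : f (Fin.last n) = Fin.last k := by
  obtain ⟨i, hi⟩ := hf (Fin.last k)
  exact Fin.last_le_iff.1 (hi.ge.trans (f.monotone (Fin.le_last i)))

/-- A larger jump would leave the value `f i + 1` without a preimage. -/
lemma monotone_surjective_step {n k : ℕ} {f : Fin (n + 1) →o Fin (k + 1)}
    (hf : Function.Surjective f) {i j : Fin (n + 1)} (h : (j : ℕ) = i + 1) :
    (f j : ℕ) ≤ f i + 1 := by
  by_contra! hlt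
  obtain ⟨l, hl⟩ := hf ⟨f i + 1, by have := (f j).isLt; lia⟩
  have hl' : (f l : ℕ) = f i + 1 := by rw [hl]
  rcases le_or_gt l i with h1 | h1
  · have : (f l : ℕ) ≤ f i := f.monotone h1
    lia
  · have h2 : j ≤ l := by
      rw [Fin.le_def, h]
      exact h1
    have : (f j : ℕ) ≤ f l := f.monotone h2
    lia

lemma reversedMap_zero {n k : ℕ} {f : Fin (n + 1) →o Fin (k + 1)}
    (hf : f (Fin.last n) = Fin.last k) : reversedMap f 0 = 0 := by
  have h : (⟨n - 0, by lia⟩ : Fin (n + 1)) = Fin.last n := rfl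
  rw [reversedMap, h, hf, Fin.val_last, Nat.sub_self]

lemma reversedMap_of_add_eq {n k : ℕ} (f : Fin (n + 1) →o Fin (k + 1)) {r : ℕ} {i : Fin (n + 1)}
    (h : r + i = n) : reversedMap f r = k - f i := by
  have h : (⟨n - r, by lia⟩ : Fin (n + 1)) = i := Fin.ext (by simp only; lia)
  rw [reversedMap, h]

lemma reversed_of_add_eq {Y : Type w} {n : ℕ} (x : Fin (n + 1) → Y) {r : ℕ} {i : Fin (n + 1)}
    (h : r + i = n) : reversed x r = x i := by
  have h : (⟨n - r, by lia⟩ : Fin (n + 1)) = i := Fin.ext (by simp only; lia)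
  rw [reversed, h]

lemma reversed_tail {Y : Type w} {n : ℕ} (x : Fin (n + 2) → Y) (r : ℕ) (h : r ≤ n) :
    reversed x r = reversed (Fin.tail x) r := by
  rw [reversed_of_add_eq x (i := ⟨n + 1 - r, by lia⟩) (by simp only; lia),
    reversed_of_add_eq (Fin.tail x) (i := ⟨n - r, by lia⟩) (by simp only; lia), Fin.tail]
  congr 1
  apply Fin.ext
  simp only [Fin.succ_mk]
  lia

lemma reversedMap_step {n k : ℕ} {f : Fin (n + 1) →o Fin (k + 1)}
    (hf : Function.Surjective f) {r : ℕ} (h : r < n) :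
    reversedMap f (r + 1) ≤ reversedMap f r + 1 := by
  rw [reversedMap_of_add_eq f (i := ⟨n - (r + 1), by lia⟩) (by simp only; lia),
    reversedMap_of_add_eq f (i := ⟨n - r, by lia⟩) (by simp only; lia)]
  have := monotone_surjective_step hf (i := ⟨n - (r + 1), by lia⟩) (j := ⟨n - r, by lia⟩)
    (by simp only; lia)
  lia

lemma reversedMap_last {n k : ℕ} {f : Fin (n + 1) →o Fin (k + 1)}
    (hf : f 0 = 0) : reversedMap f n = k := by
  rw [reversedMap_of_add_eq f (i := 0) (by simp), hf, Fin.val_zero, Nat.sub_zero]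

lemma comp_spec {Y : Type*} {l k n : ℕ} {g : Fin (k + 1) →o Fin (l + 1)}
    {f : Fin (n + 1) →o Fin (k + 1)} {z : Fin (l + 1) → Y} {y : Fin (k + 1) → Y}
    {x : Fin (n + 1) → Y} (h : ∀ i, z (g i) = y i) (h' : ∀ i, y (f i) = x i) (i : Fin (n + 1)) :
    z (g.comp f i) = x i :=
  (h (f i)).trans (h' i)

variable {V : Type u₁} [Category.{v₁} V] [SemiCartesianMonoidalCategory V]
  {W : Type u} [Category.{v} W] [MonoidalCategory W] (S : V ⥤ W) [S.Monoidal]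
  (X : Type v) [EnrichedCategory V X]

lemma pull_unitBimodule (y : ℕ → TransportEnrichment S X) (c : TransportEnrichment S X)
    (q : ℕ → ℕ) (hq : Monotone q) (h0 : q 0 = 0) (m : ℕ) :
    pull (unitBimodule S X) y c q hq m = spread y (S.obj (𝟙_ V)) q hq h0 m := by
  induction m with
  | zero =>
    have key (a : ℕ) (h : 0 ≤ a) (ha : a = 0)
        (e : chain y ((unitBimodule S X).obj (y 0) c) a = (unitBimodule S X).obj (y a) c) :
        push y _ h ≫ (unitBimodule S X).lact (y a) (y 0) c = eqToHom e := by
      subst ha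
      have := push_self y ((unitBimodule S X).obj (y 0) c) 0
      rw [this, Category.assoc, Bimodule.id_lact, Iso.inv_hom_id]
      rfl
    exact key (q 0) (Nat.zero_le _) h0 (congrArg (chain y (S.obj (𝟙_ V))) h0)
  | succ m ih =>
    exact congrArg (fun t => push y _ (hq (Nat.le_succ m)) ≫ _ ◁ t) ih

lemma drop_eq_eqToHom [SymmetricCategory W] {Y : Type w} [EnrichedCategory W Y] (M : Bimodule W Y)
    (y : ℕ → Y) {a r : ℕ} (h : a ≤ r) (e : a = r) :
    drop M y h = eqToHom (by rw [e]) := by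
  subst e
  exact drop_self M y a

variable [SymmetricCategory W] {X}

/-- The structure maps between the summands of the magnitude nerve. -/
def degMap {k n : ℕ} (f : Fin (n + 1) →o Fin (k + 1)) (y : Fin (k + 1) → X)
    (x : Fin (n + 1) → X) (h : ∀ i, y (f i) = x i) : nerveAt S X y ⟶ nerveAt S X x :=
  (barSummand (unitBimodule S X)).map
    (X := (chaoticNerve (TransportEnrichment S X)).elementsMk (op (SimplexCategory.mk k)) y)
    (Y := (chaoticNerve (TransportEnrichment S X)).elementsMk (op (SimplexCategory.mk n)) x)
    ⟨(SimplexCategory.mkHom f).op, funext h⟩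

lemma degMap_comp {l k n : ℕ} (g : Fin (k + 1) →o Fin (l + 1)) (f : Fin (n + 1) →o Fin (k + 1))
    (z : Fin (l + 1) → X) (y : Fin (k + 1) → X) (x : Fin (n + 1) → X) (h : ∀ i, z (g i) = y i)
    (h' : ∀ i, y (f i) = x i) : degMap S g z y h ≫ degMap S f y x h' =
      degMap S (g.comp f) z x (comp_spec h h') :=
  ((barSummand (unitBimodule S X)).map_comp
    (X := (chaoticNerve (TransportEnrichment S X)).elementsMk (op (SimplexCategory.mk l)) z)
    (Y := (chaoticNerve (TransportEnrichment S X)).elementsMk (op (SimplexCategory.mk k)) y)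
    (Z := (chaoticNerve (TransportEnrichment S X)).elementsMk (op (SimplexCategory.mk n)) x)
    ⟨(SimplexCategory.mkHom g).op, funext h⟩ ⟨(SimplexCategory.mkHom f).op, funext h'⟩).symm

/-- A surjection preserves both end vertices, so no hom-object acts on the bimodule from either
side: `drop` is trivial and `pull` reduces to `spread`. -/
lemma degMap_eq_spreadTo {k n : ℕ} {f : Fin (n + 1) →o Fin (k + 1)} (hf : Function.Surjective f)
    (y : Fin (k + 1) → X) (x : Fin (n + 1) → X) (h : ∀ i, y (f i) = x i) :
    degMap S f y x h = spreadTo (Y := TransportEnrichment S X) (reversed y) (reversed x)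
      (S.obj (𝟙_ V)) (reversedMap f) (reversedMap_monotone f)
      (reversedMap_zero (monotone_surjective_last hf))
      (reversedMap_last (monotone_surjective_zero hf))
      fun r _ => congrFun (reversed_reversedMap y f x (funext h)) r := by
  have h1 := drop_eq_eqToHom (unitBimodule S X) (reversed (Y := TransportEnrichment S X) y) (Nat.sub_le _ _)
    (reversedMap_last (monotone_surjective_zero hf))
  have h2 := pull_unitBimodule S X (reversed (Y := TransportEnrichment S X) y) (reversed y (reversedMap f n)) (reversedMap f)
    (reversedMap_monotone f) (reversedMap_zero (monotone_surjective_last hf)) n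
  exact congr (congrArg (fun a b => a ≫ b ≫ eqToHom _) h1) h2

/-- Words are built from the right, so the first hom-object is the outermost factor of the
recursion. What remains is the word of the tail because the bimodule is constant. -/
lemma nerveAt_eq_tensorObj {n : ℕ} (x : Fin (n + 2) → X) {a b : X} (ha : x 0 = a) (hb : x 1 = b) :
    nerveAt S X x = S.obj (a ⟶[V] b) ⊗ nerveAt S X (Fin.tail x) := by
  have h1 : reversed x (n + 1) = a := (reversed_of_add_eq x (i := 0) (by simp)).trans ha
  have h2 : reversed x n = b := (reversed_of_add_eq x (i := 1) (by simp)).trans hb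
  have h3 := chain_congr (Y := TransportEnrichment S X) (reversed x) (reversed (Fin.tail x)) (S.obj (𝟙_ V)) n
    (reversed_tail x)
  exact congr (congrArg (fun A B : W => A ⊗ B)
    (congr (congrArg (fun a b : X => S.obj (a ⟶[V] b)) h1) h2)) h3

/-- Split off the first hom-object of a summand of the magnitude nerve. -/
def consIso {n : ℕ} (x : Fin (n + 2) → X) {a b : X} (ha : x 0 = a) (hb : x 1 = b) :
    nerveAt S X x ≅ S.obj (a ⟶[V] b) ⊗ nerveAt S X (Fin.tail x) :=
  eqToIso (nerveAt_eq_tensorObj S x ha hb)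

end Degeneracies

/-! ### Recursion of degeneracies on the first hom-object -/

section DegeneracyRecursion

variable {W : Type u} [Category.{v} W] [MonoidalCategory W]

lemma whiskerLeft_conj_eqToHom' {A A' B C C' D D' : W} (s : C' ⟶ D') (hC : C = C') (hD : D' = D)
    (hB : A = B) (hA : A = A') (hB' : B = A') (h : A ⊗ C = A' ⊗ C') (h' : B ⊗ D = A' ⊗ D') :
    (A ◁ (eqToHom hC ≫ s ≫ eqToHom hD) ≫ eqToHom hB ▷ D) ≫ eqToHom h' =
      eqToHom h ≫ A' ◁ s := by
  subst hA hC hD hB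
  simp

lemma eqToHom_eId_whiskerRight' {Y : Type w} [EnrichedCategory W Y] {a a' : Y} {B C C' D : W}
    (s : D ⟶ C') (ha : a = a') (hC : C' = C) (e : (a ⟶[W] a) = B)
    (h : B ⊗ C = (a' ⟶[W] a') ⊗ C') :
    ((s ≫ eqToHom hC) ≫ (λ_ C).inv ≫ eId W a ▷ C ≫ eqToHom e ▷ C) ≫ eqToHom h =
      s ≫ (λ_ C').inv ≫ eId W a' ▷ C' := by
  subst ha hC e
  simp

variable {V : Type u₁} [Category.{v₁} V] [SemiCartesianMonoidalCategory V] (S : V ⥤ W) [S.Monoidal]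
  {X : Type v} [EnrichedCategory V X] [SymmetricCategory W]

/-- In the reversed indexing the edge between the first two vertices is the last step of the
recursion. There `reversedMap f` increases by one, so this hom-factor is carried along unchanged. -/
lemma degMap_cons {k n : ℕ} {f : Fin (n + 2) →o Fin (k + 2)} {f' : Fin (n + 1) →o Fin (k + 1)}
    (hf : Function.Surjective f) (hf' : Function.Surjective f') (hs : ∀ i, f i.succ = (f' i).succ)
    (y : Fin (k + 2) → X) (x : Fin (n + 2) → X) (h : ∀ i, y (f i) = x i)
    (h' : ∀ i, Fin.tail y (f' i) = Fin.tail x i) {a b : X} (hx0 : x 0 = a) (hx1 : x 1 = b)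
    (hy0 : y 0 = a) (hy1 : y 1 = b) :
    degMap S f y x h ≫ (consIso S x hx0 hx1).hom =
      (consIso S y hy0 hy1).hom ≫ S.obj (a ⟶[V] b) ◁ degMap S f' (Fin.tail y) (Fin.tail x) h' := by
  have f1 : f 1 = 1 := (hs 0).trans (by rw [monotone_surjective_zero hf']; rfl)
  have hk : reversedMap f n = k := by
    rw [reversedMap_of_add_eq f (i := 1) (by simp), f1]
    simp
  have hq (r : ℕ) (hr : r ≤ n) : reversedMap f r = reversedMap f' r := by
    have : (f' ⟨n - r, by lia⟩ : ℕ) < k + 1 := Fin.isLt _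
    rw [reversedMap_of_add_eq f (i := Fin.succ ⟨n - r, by lia⟩) (by simp only [Fin.succ_mk]; lia),
      hs, reversedMap_of_add_eq f' (i := ⟨n - r, by lia⟩) (by simp only; lia), Fin.val_succ]
    lia
  rw [degMap_eq_spreadTo S hf, degMap_eq_spreadTo S hf']
  have e1 := spreadTo_succ (Y := TransportEnrichment S X) (reversed y) (reversed x) (S.obj (𝟙_ V))
    (reversedMap f) (reversedMap_monotone f) (reversedMap_zero (monotone_surjective_last hf)) hk
    (reversedMap_last (monotone_surjective_zero hf))
    fun r _ => congrFun (reversed_reversedMap y f x (funext h)) r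
  have e2 := spreadTo_congr (Y := TransportEnrichment S X) (reversed y) (reversed x)
    (S.obj (𝟙_ V)) (reversedMap f) (reversedMap_monotone f)
    (reversedMap_zero (monotone_surjective_last hf)) (reversedMap_monotone f')
    (reversedMap_zero (monotone_surjective_last hf')) hk
    (fun r _ => congrFun (reversed_reversedMap y f x (funext h)) r)
    (reversedMap_last (monotone_surjective_zero hf'))
    (fun r _ => congrFun (reversed_reversedMap (Fin.tail y) f' (Fin.tail x) (funext h')) r)
    (reversed_tail y) (reversed_tail x) hq
    fun r hr => reversedMap_step hf (Nat.lt_succ_of_lt hr)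
  rw [e2] at e1
  refine (congrArg (fun t => t ≫ (consIso S x hx0 hx1).hom) e1).trans ?_
  have g1 : (reversed (Y := TransportEnrichment S X) y (k + 1) ⟶[W]
      reversed (Y := TransportEnrichment S X) y k) = S.obj (a ⟶[V] b) := by
    have h1 : reversed y (k + 1) = a := (reversed_of_add_eq y (i := 0) (by simp)).trans hy0
    have h2 : reversed y k = b := (reversed_of_add_eq y (i := 1) (by simp)).trans hy1
    exact congr (congrArg (fun a b : X => S.obj (a ⟶[V] b)) h1) h2
  have g2 : (reversed (Y := TransportEnrichment S X) x (n + 1) ⟶[W]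
      reversed (Y := TransportEnrichment S X) x n) = S.obj (a ⟶[V] b) := by
    have h1 : reversed x (n + 1) = a := (reversed_of_add_eq x (i := 0) (by simp)).trans hx0
    have h2 : reversed x n = b := (reversed_of_add_eq x (i := 1) (by simp)).trans hx1
    exact congr (congrArg (fun a b : X => S.obj (a ⟶[V] b)) h1) h2
  exact whiskerLeft_conj_eqToHom' _ _ _ (g1.trans g2.symm) g1 g2
    (nerveAt_eq_tensorObj S y hy0 hy1) (nerveAt_eq_tensorObj S x hx0 hx1)

/-- Forget the first value of a monotone function. -/
def tailHom {k n : ℕ} (f : Fin (n + 2) →o Fin (k + 1)) : Fin (n + 1) →o Fin (k + 1) :=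
  ⟨fun i => f i.succ, fun _ _ h => f.monotone (Fin.succ_le_succ_iff.2 h)⟩

lemma tailHom_surjective {k n : ℕ} {f : Fin (n + 2) →o Fin (k + 1)} (hf : Function.Surjective f)
    (h : f 0 = f 1) : Function.Surjective (tailHom f) := by
  intro j
  obtain ⟨i, rfl⟩ := hf j
  rcases Fin.eq_zero_or_eq_succ i with rfl | ⟨i, rfl⟩
  · exact ⟨0, h.symm⟩
  · exact ⟨i, rfl⟩

lemma tailHom_spec {Y : Type*} {k n : ℕ} {f : Fin (n + 2) →o Fin (k + 1)} {y : Fin (k + 1) → Y}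
    {x : Fin (n + 2) → Y} (h : ∀ i, y (f i) = x i) (i : Fin (n + 1)) :
    y (tailHom f i) = Fin.tail x i :=
  h i.succ

/-- The unit `I ⟶ Σ X(a, a)` of the enriched category `ΣX`. -/
abbrev transportId (a : X) : 𝟙_ W ⟶ S.obj (a ⟶[V] a) :=
  eId W (C := TransportEnrichment S X) a

/-- In the reversed indexing `f 0 = f 1` makes `reversedMap f` stationary at its last step, which is
where the recursion inserts an identity on the far left. -/
lemma degMap_collapse {k n : ℕ} {f : Fin (n + 2) →o Fin (k + 1)}
    (hf : Function.Surjective f) (h01 : f 0 = f 1)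
    (y : Fin (k + 1) → X) (x : Fin (n + 2) → X) (h : ∀ i, y (f i) = x i) {a : X}
    (hx0 : x 0 = a) (hx1 : x 1 = a) :
    degMap S f y x h ≫ (consIso S x hx0 hx1).hom =
      degMap S (tailHom f) y (Fin.tail x) (tailHom_spec h) ≫ (λ_ _).inv ≫
        transportId S a ▷ nerveAt S X (Fin.tail x) := by
  have hf' := tailHom_surjective hf h01
  have hk : reversedMap f n = k := by
    rw [reversedMap_of_add_eq f (i := 1) (by simp), ← h01, monotone_surjective_zero hf]
    simp
  have hq (r : ℕ) (hr : r ≤ n) : reversedMap f r = reversedMap (tailHom f) r := by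
    rw [reversedMap_of_add_eq f (i := Fin.succ ⟨n - r, by lia⟩) (by simp only [Fin.succ_mk]; lia),
      reversedMap_of_add_eq (tailHom f) (i := ⟨n - r, by lia⟩) (by simp only; lia)]
    rfl
  have e1 := spreadTo_of_eq (Y := TransportEnrichment S X) (reversed y) (reversed x) (S.obj (𝟙_ V))
    (reversedMap f) (reversedMap_monotone f) (reversedMap_zero (monotone_surjective_last hf)) hk
    (reversedMap_last (monotone_surjective_zero hf))
    fun r _ => congrFun (reversed_reversedMap y f x (funext h)) r
  have e2 := spreadTo_congr (Y := TransportEnrichment S X) (reversed y) (reversed x)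
    (S.obj (𝟙_ V)) (reversedMap f) (reversedMap_monotone f)
    (reversedMap_zero (monotone_surjective_last hf)) (reversedMap_monotone (tailHom f))
    (reversedMap_zero (monotone_surjective_last hf')) hk
    (fun r _ => congrFun (reversed_reversedMap y f x (funext h)) r)
    (reversedMap_last (monotone_surjective_zero hf'))
    (fun r _ => congrFun (reversed_reversedMap y (tailHom f) (Fin.tail x)
      (funext (tailHom_spec h))) r)
    (fun _ _ => rfl) (reversed_tail x) hq
    fun r hr => reversedMap_step hf (Nat.lt_succ_of_lt hr)
  rw [e2.trans (Category.id_comp _)] at e1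
  refine (congrArg (fun t => t ≫ (consIso S x hx0 hx1).hom)
    ((degMap_eq_spreadTo S hf y x h).trans e1)).trans (Eq.trans ?_ (congrArg (fun t => t ≫
      (λ_ _).inv ≫ transportId S a ▷ nerveAt S X (Fin.tail x))
      (degMap_eq_spreadTo S hf' y (Fin.tail x) (tailHom_spec h)).symm))
  have h2 : reversed x n = a := (reversed_of_add_eq x (i := 1) (by simp)).trans hx1
  exact eqToHom_eId_whiskerRight' (Y := TransportEnrichment S X) _ h2 _ _
    (nerveAt_eq_tensorObj S x hx0 hx1)

end DegeneracyRecursion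

/-! ### Partial latching objects in terms of monotone surjections -/

section PartialLatching

variable {V : Type u₁} [Category.{v₁} V] [SemiCartesianMonoidalCategory V]
  {W : Type u} [Category.{v} W] [MonoidalCategory W] [SymmetricCategory W] [HasColimits W]
  (S : V ⥤ W) [S.Monoidal] {X : Type v} [EnrichedCategory V X] {n : ℕ}

/-- The map `L_{x_0, …, x_n} B ⟶ B_{x_0, …, x_n}`. -/
def nerveLatchingMap (x : Fin (n + 1) → X) : nerveLatchingAt S X x ⟶ nerveAt S X x :=
  latchingMap (CategoryOfElements.π (chaoticNerve (TransportEnrichment S X)))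
    ((chaoticNerve (TransportEnrichment S X)).elementsMk (op (SimplexCategory.mk n)) x)
    (barSummand (unitBimodule S X))

/-- The map to the partial latching object that corresponds to a degeneracy. -/
def degι {k : ℕ} (f : Fin (n + 1) →o Fin (k + 1)) (hf : Function.Surjective f) (hk : k < n)
    (y : Fin (k + 1) → X) (x : Fin (n + 1) → X) (h : ∀ i, y (f i) = x i) :
    nerveAt S X y ⟶ nerveLatchingAt S X x :=
  latchingι (CategoryOfElements.π (chaoticNerve (TransportEnrichment S X)))
    ((chaoticNerve (TransportEnrichment S X)).elementsMk (op (SimplexCategory.mk n)) x)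
    (barSummand (unitBimodule S X))
    (q := (chaoticNerve (TransportEnrichment S X)).elementsMk (op (SimplexCategory.mk k)) y)
    ⟨(SimplexCategory.mkHom f).op, funext h⟩ ⟨hf, hk⟩

lemma degι_nerveLatchingMap {k : ℕ} (f : Fin (n + 1) →o Fin (k + 1)) (hf : Function.Surjective f)
    (hk : k < n) (y : Fin (k + 1) → X) (x : Fin (n + 1) → X) (h : ∀ i, y (f i) = x i) :
    degι S f hf hk y x h ≫ nerveLatchingMap S x = degMap S f y x h :=
  latchingι_latchingMap _ _ _ _ _

lemma surjective_of_surjective_comp {l k : ℕ} {g : Fin (k + 1) →o Fin (l + 1)}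
    {f : Fin (n + 1) →o Fin (k + 1)} (hgf : Function.Surjective (g.comp f)) :
    Function.Surjective g :=
  Function.Surjective.of_comp (g := f) hgf

lemma le_of_surjective {l k : ℕ} {g : Fin (k + 1) →o Fin (l + 1)}
    (hg : Function.Surjective g) : l ≤ k := by
  simpa using Fintype.card_le_of_surjective g hg

lemma degMap_degι {l k : ℕ} (g : Fin (k + 1) →o Fin (l + 1)) (f : Fin (n + 1) →o Fin (k + 1))
    (hf : Function.Surjective f) (hgf : Function.Surjective (g.comp f)) (hk : k < n)
    (z : Fin (l + 1) → X) (y : Fin (k + 1) → X) (x : Fin (n + 1) → X) (h : ∀ i, z (g i) = y i)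
    (h' : ∀ i, y (f i) = x i) :
    degMap S g z y h ≫ degι S f hf hk y x h' = degι S (g.comp f) hgf
      ((le_of_surjective (surjective_of_surjective_comp hgf)).trans_lt hk) z x
      (comp_spec h h') :=
  map_latchingι _ _ _ _ _ _ _ _ rfl

lemma nerveLatchingAt_map_existsUnique_desc {W' : Type*} [Category* W'] (G : W ⥤ W')
    [G.IsLeftAdjoint] (x : Fin (n + 1) → X) {Z : W'}
    (φ : ∀ {k : ℕ} (f : Fin (n + 1) →o Fin (k + 1)) (_ : Function.Surjective f) (_ : k < n)
      (y : Fin (k + 1) → X) (_ : ∀ i, y (f i) = x i), G.obj (nerveAt S X y) ⟶ Z)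
    (hφ : ∀ {l k : ℕ} (g : Fin (k + 1) →o Fin (l + 1)) (f : Fin (n + 1) →o Fin (k + 1))
      (hf : Function.Surjective f) (hgf : Function.Surjective (g.comp f)) (hk : k < n) (hl : l < n)
      (z : Fin (l + 1) → X) (y : Fin (k + 1) → X) (h : ∀ i, z (g i) = y i)
      (h' : ∀ i, y (f i) = x i), G.map (degMap S g z y h) ≫ φ f hf hk y h' =
        φ (g.comp f) hgf hl z (comp_spec h h')) :
    ∃! u : G.obj (nerveLatchingAt S X x) ⟶ Z, ∀ {k : ℕ} (f : Fin (n + 1) →o Fin (k + 1))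
      (hf : Function.Surjective f) (hk : k < n) (y : Fin (k + 1) → X) (h : ∀ i, y (f i) = x i),
      G.map (degι S f hf hk y x h) ≫ u = φ f hf hk y h := by
  obtain ⟨u, hu, hu'⟩ := latchingObj_map_existsUnique_desc
    (CategoryOfElements.π (chaoticNerve (TransportEnrichment S X)))
    ((chaoticNerve (TransportEnrichment S X)).elementsMk (op (SimplexCategory.mk n)) x)
    (barSummand (unitBimodule S X)) G (Z := Z)
    (fun q σ hσ => φ σ.1.unop.toOrderHom hσ.1 hσ.2 q.2 fun i => congrFun σ.2 i) (by
      rintro q q' σ hσ σ' hσ' τ rfl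
      exact hφ τ.1.unop.toOrderHom σ'.1.unop.toOrderHom hσ'.1 hσ.1 hσ'.2 hσ.2 q.2 q'.2
        (fun i => congrFun τ.2 i) fun i => congrFun σ'.2 i)
  exact ⟨u, fun f hf hk y h => hu _ _ _, fun u' h' => hu' u' fun q σ hσ =>
    h' σ.1.unop.toOrderHom hσ.1 hσ.2 q.2 fun i => congrFun σ.2 i⟩

lemma nerveLatchingAt_map_hom_ext {W' : Type*} [Category* W'] (G : W ⥤ W')
    [G.IsLeftAdjoint] (x : Fin (n + 1) → X) {Z : W'} {u u' : G.obj (nerveLatchingAt S X x) ⟶ Z}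
    (h : ∀ {k : ℕ} (f : Fin (n + 1) →o Fin (k + 1)) (hf : Function.Surjective f) (hk : k < n)
      (y : Fin (k + 1) → X) (h : ∀ i, y (f i) = x i),
      G.map (degι S f hf hk y x h) ≫ u = G.map (degι S f hf hk y x h) ≫ u') : u = u' := by
  refine latchingObj_map_hom_ext
    (CategoryOfElements.π (chaoticNerve (TransportEnrichment S X)))
    ((chaoticNerve (TransportEnrichment S X)).elementsMk (op (SimplexCategory.mk n)) x)
    (barSummand (unitBimodule S X)) G fun q σ hσ =>
      h σ.1.unop.toOrderHom hσ.1 hσ.2 q.2 fun i => congrFun σ.2 i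

omit [HasColimits W] in
lemma degMap_id (x : Fin (n + 1) → X) (h : ∀ i, x ((OrderHom.id : Fin (n + 1) →o _) i) = x i) :
    degMap S OrderHom.id x x h = 𝟙 _ :=
  (barSummand (unitBimodule S X)).map_id _

end PartialLatching

/-! ### Monotone surjections that do or do not identify the first two vertices -/

section MonotoneMaps

variable {n k : ℕ}

/-- Extend a monotone map by sending a new least element to a new least element. -/
def consHom (f : Fin (n + 1) →o Fin (k + 1)) : Fin (n + 2) →o Fin (k + 2) where
  toFun := Fin.cons 0 fun i => (f i).succ
  monotone' i j h := by
    rcases Fin.eq_zero_or_eq_succ i with rfl | ⟨i, rfl⟩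
    · exact Fin.zero_le _
    · rcases Fin.eq_zero_or_eq_succ j with rfl | ⟨j, rfl⟩
      · exact absurd h (not_le.2 (Fin.succ_pos i))
      · exact Fin.succ_le_succ_iff.2 (f.monotone (Fin.succ_le_succ_iff.1 h))

lemma consHom_surjective {f : Fin (n + 1) →o Fin (k + 1)} (hf : Function.Surjective f) :
    Function.Surjective (consHom f) := by
  intro j
  rcases Fin.eq_zero_or_eq_succ j with rfl | ⟨j, rfl⟩
  · exact ⟨0, rfl⟩
  · obtain ⟨i, rfl⟩ := hf j
    exact ⟨i.succ, rfl⟩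

variable (n) in
/-- The first degeneracy operator. -/
def firstDegeneracy : Fin (n + 2) →o Fin (n + 1) where
  toFun := Fin.cons 0 id
  monotone' i j h := by
    rcases Fin.eq_zero_or_eq_succ i with rfl | ⟨i, rfl⟩
    · exact Fin.zero_le _
    · rcases Fin.eq_zero_or_eq_succ j with rfl | ⟨j, rfl⟩
      · exact absurd h (not_le.2 (Fin.succ_pos i))
      · exact Fin.succ_le_succ_iff.1 h

lemma firstDegeneracy_surjective : Function.Surjective (firstDegeneracy n) :=
  fun i => ⟨i.succ, rfl⟩

lemma tailHom_comp_firstDegeneracy (f : Fin (n + 2) →o Fin (k + 1)) (h : f 0 = f 1) :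
    (tailHom f).comp (firstDegeneracy n) = f := by
  ext i : 2
  rcases Fin.eq_zero_or_eq_succ i with rfl | ⟨i, rfl⟩
  · exact h.symm
  · rfl

/-- Here `f 0 = 0`, and since `f 1` differs from it, monotonicity makes all later values positive.
They can be lowered by one, and surjectivity survives because `0` is hit only at `0`. -/
lemma exists_shift {f : Fin (n + 2) →o Fin (k + 2)} (hf : Function.Surjective f) (h : f 0 ≠ f 1) :
    ∃ f' : Fin (n + 1) →o Fin (k + 1), Function.Surjective f' ∧ ∀ i, f i.succ = (f' i).succ := by
  have h0 := monotone_surjective_zero hf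
  have hpos (i : Fin (n + 1)) : f i.succ ≠ 0 := by
    have h1 : f 1 ≤ f i.succ := f.monotone (Fin.succ_le_succ_iff.2 (Fin.zero_le i))
    rw [h0] at h
    exact ((Fin.pos_iff_ne_zero.2 h.symm).trans_le h1).ne'
  refine ⟨⟨fun i => (f i.succ).pred (hpos i), fun i j hij => Fin.pred_le_pred_iff.2
    (f.monotone (Fin.succ_le_succ_iff.2 hij))⟩, fun j => ?_,
    fun i => (Fin.succ_pred _ (hpos i)).symm⟩
  obtain ⟨i, hi⟩ := hf j.succ
  rcases Fin.eq_zero_or_eq_succ i with rfl | ⟨i, rfl⟩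
  · exact absurd (h0.symm.trans hi) (Fin.succ_ne_zero j).symm
  · exact ⟨i, (Fin.pred_eq_iff_eq_succ (hpos i)).2 hi⟩

lemma eq_consHom {f : Fin (n + 2) →o Fin (k + 2)} {f' : Fin (n + 1) →o Fin (k + 1)}
    (hf : Function.Surjective f) (hs : ∀ i, f i.succ = (f' i).succ) : f = consHom f' := by
  ext i : 2
  rcases Fin.eq_zero_or_eq_succ i with rfl | ⟨i, rfl⟩
  · exact monotone_surjective_zero hf
  · exact hs i

end MonotoneMaps

/-! ### Two kinds of maps into a partial latching object -/

section LatchingRecursion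

lemma inv_comp_eq_comp_inv {W : Type u} [Category.{v} W] {A A' B B' : W} (c : A ≅ A') (d : B ≅ B')
    (f : A ⟶ B) (g : A' ⟶ B') (e : f ≫ d.hom = c.hom ≫ g) : c.inv ≫ f = g ≫ d.inv := by
  rw [Iso.inv_comp_eq, ← Category.assoc, Iso.eq_comp_inv, e]

lemma comp_inv_comp_eq {W : Type u} [Category.{v} W] {A A' B B' Z : W} (c : A ≅ A') (d : B ≅ B')
    (f : A ⟶ B) (g : A' ⟶ B') (e : f ≫ d.hom = c.hom ≫ g) (p : B ⟶ Z) (q : A ⟶ Z)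
    (h : f ≫ p = q) : g ≫ d.inv ≫ p = c.inv ≫ q := by
  rw [← h, Iso.eq_inv_comp, ← reassoc_of% e, Iso.hom_inv_id_assoc]

variable {V : Type u₁} [Category.{v₁} V] [SemiCartesianMonoidalCategory V]
  {W : Type u} [Category.{v} W] [MonoidalCategory W] [SymmetricCategory W] [HasColimits W]
  (S : V ⥤ W) [S.Monoidal] {X : Type v} [EnrichedCategory V X]

/-- The unit `I ⟶ Σ X(a, b)` for `a = b`. -/
def unitOfEq {a b : X} (e : a = b) : 𝟙_ W ⟶ S.obj (a ⟶[V] b) :=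
  transportId S a ≫ eqToHom (by rw [e])

omit [SymmetricCategory W] [HasColimits W] in
lemma unitOfEq_rfl (a : X) : unitOfEq S (rfl : a = a) = transportId S a := by
  simp [unitOfEq]

/-- Insert an identity into a tensor product. -/
abbrev insertUnit {a b : X} (e : a = b) (A : W) : A ⟶ S.obj (a ⟶[V] b) ⊗ A :=
  (λ_ A).inv ≫ unitOfEq S e ▷ A

omit [SymmetricCategory W] [HasColimits W] in
lemma insertUnit_naturality {a b : X} (e : a = b) {A A' : W} (g : A ⟶ A') :
    insertUnit S e A ≫ S.obj (a ⟶[V] b) ◁ g = g ≫ insertUnit S e A' := by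
  simp [insertUnit, ← whisker_exchange]

variable {n : ℕ} (x : Fin (n + 2) → X) {a b : X}

omit [HasColimits W] in
lemma degMap_eq_insertUnit {k : ℕ} {f : Fin (n + 2) →o Fin (k + 1)}
    (hf : Function.Surjective f) (h01 : f 0 = f 1)
    (y : Fin (k + 1) → X) (h : ∀ i, y (f i) = x i) (ha : x 0 = a) (hb : x 1 = b) (e : a = b) :
    degMap S f y x h ≫ (consIso S x ha hb).hom =
      degMap S (tailHom f) y (Fin.tail x) (tailHom_spec h) ≫ insertUnit S e _ := by
  subst e
  rw [degMap_collapse S hf h01, insertUnit, unitOfEq_rfl]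

omit [Category.{v₁} V] [SemiCartesianMonoidalCategory V] [EnrichedCategory V X] in
lemma tail_firstDegeneracy (ha : x 0 = a) (hb : x 1 = b) (e : a = b) (i : Fin (n + 2)) :
    Fin.tail x (firstDegeneracy n i) = x i := by
  rcases Fin.eq_zero_or_eq_succ i with rfl | ⟨i, rfl⟩
  · exact hb.trans (e.symm.trans ha.symm)
  · rfl

/-- The map `B_{x_1, …, x_n} ⟶ L_{x_0, …, x_n} B` for `x_0 = x_1`. -/
def collapseι (ha : x 0 = a) (hb : x 1 = b) (e : a = b) : nerveAt S X (Fin.tail x) ⟶ nerveLatchingAt S X x :=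
  degι S (firstDegeneracy n) firstDegeneracy_surjective (Nat.lt_succ_self n) _ x
    (tail_firstDegeneracy x ha hb e)

omit [HasColimits W] in
lemma degMap_firstDegeneracy (ha : x 0 = a) (hb : x 1 = b) (e : a = b) :
    degMap S (firstDegeneracy n) (Fin.tail x) x (tail_firstDegeneracy x ha hb e) =
      insertUnit S e _ ≫ (consIso S x ha hb).inv := by
  rw [Iso.eq_comp_inv, degMap_eq_insertUnit S x firstDegeneracy_surjective rfl _ _ ha hb e]
  exact (congrArg (fun t => t ≫ insertUnit S e _) (degMap_id S _ _)).trans (Category.id_comp _)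

lemma collapseι_nerveLatchingMap (ha : x 0 = a) (hb : x 1 = b) (e : a = b) :
    collapseι S x ha hb e ≫ nerveLatchingMap S x =
      insertUnit S e _ ≫ (consIso S x ha hb).inv := by
  rw [collapseι, degι_nerveLatchingMap, degMap_firstDegeneracy S x ha hb e]

lemma degι_congr {n k : ℕ} {f f' : Fin (n + 1) →o Fin (k + 1)} (e : f = f')
    (hf : Function.Surjective f) (hk : k < n) (y : Fin (k + 1) → X) (x : Fin (n + 1) → X)
    (h : ∀ i, y (f i) = x i) :
    degι S f hf hk y x h = degι S f' (e ▸ hf) hk y x (e ▸ h) := by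
  subst e
  rfl

/-- A surjection that identifies `0` and `1` factors through the first degeneracy. -/
lemma degι_eq_collapseι {k : ℕ} {f : Fin (n + 2) →o Fin (k + 1)}
    (hf : Function.Surjective f) (hk : k < n + 1) (h01 : f 0 = f 1)
    (y : Fin (k + 1) → X) (h : ∀ i, y (f i) = x i) (ha : x 0 = a) (hb : x 1 = b) (e : a = b) :
    degι S f hf hk y x h = degMap S (tailHom f) y (Fin.tail x) (tailHom_spec h) ≫
      collapseι S x ha hb e := by
  have h2 : Function.Surjective ((tailHom f).comp (firstDegeneracy n)) :=
    (tailHom_comp_firstDegeneracy f h01).symm ▸ hf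
  exact (degι_congr S (tailHom_comp_firstDegeneracy f h01).symm hf hk y x h).trans
    (degMap_degι S (tailHom f) (firstDegeneracy n) firstDegeneracy_surjective h2
      (Nat.lt_succ_self n) y (Fin.tail x) x (tailHom_spec h)
      (tail_firstDegeneracy x ha hb e)).symm

/-- Split off the first hom-object of a summand of the magnitude nerve. -/
def consFinIso (a : X) {k : ℕ} (y : Fin (k + 1) → X) (hy : y 0 = b) :
    nerveAt S X (Fin.cons a y : Fin (k + 2) → X) ≅ S.obj (a ⟶[V] b) ⊗ nerveAt S X y :=
  consIso S (Fin.cons a y : Fin (k + 2) → X) rfl hy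

omit [Category.{v₁} V] [SemiCartesianMonoidalCategory V] [EnrichedCategory V X] in
variable {x} in
lemma apply_zero_eq (hb : x 1 = b) {k : ℕ} {f : Fin (n + 1) →o Fin (k + 1)}
    (hf : Function.Surjective f) {y : Fin (k + 1) → X} (h : ∀ i, y (f i) = Fin.tail x i) :
    y 0 = b := by
  rw [← hb]
  exact (congrArg y (monotone_surjective_zero hf)).symm.trans (h 0)

omit [Category.{v₁} V] [SemiCartesianMonoidalCategory V] [EnrichedCategory V X] in
variable {x} in
lemma consHom_spec (ha : x 0 = a) {k : ℕ} {f : Fin (n + 1) →o Fin (k + 1)} {y : Fin (k + 1) → X}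
    (h : ∀ i, y (f i) = Fin.tail x i) (i : Fin (n + 2)) :
    (Fin.cons a y : Fin (k + 2) → X) (consHom f i) = x i := by
  rcases Fin.eq_zero_or_eq_succ i with rfl | ⟨i, rfl⟩
  · exact ha.symm
  · exact h i

/-- The map `Σ X(a, b) ⊗ B_y ⟶ L_{x_0, …, x_n} B` that corresponds to a degeneracy with target
`B_{x_1, …, x_n}`. -/
def consDegι (ha : x 0 = a) (hb : x 1 = b) {k : ℕ} (f : Fin (n + 1) →o Fin (k + 1))
    (hf : Function.Surjective f) (hk : k < n) (y : Fin (k + 1) → X)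
    (h : ∀ i, y (f i) = Fin.tail x i) :
    S.obj (a ⟶[V] b) ⊗ nerveAt S X y ⟶ nerveLatchingAt S X x :=
  (consFinIso S a y (apply_zero_eq hb hf h)).inv ≫
    degι S (consHom f) (consHom_surjective hf) (Nat.succ_lt_succ hk) _ x (consHom_spec ha h)

lemma consDegι_tail (ha : x 0 = a) (hb : x 1 = b) {k : ℕ} {f : Fin (n + 2) →o Fin (k + 2)}
    {f' : Fin (n + 1) →o Fin (k + 1)} (hf : Function.Surjective f) (hf' : Function.Surjective f')
    (hs : ∀ i, f i.succ = (f' i).succ) (hk : k + 1 < n + 1) (hk' : k < n) (y : Fin (k + 2) → X)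
    (h : ∀ i, y (f i) = x i) (h' : ∀ i, Fin.tail y (f' i) = Fin.tail x i) (hy0 : y 0 = a)
    (hy1 : y 1 = b) :
    (consIso S y hy0 hy1).hom ≫ consDegι S x ha hb f' hf' hk' (Fin.tail y) h' =
      degι S f hf hk y x h := by
  obtain rfl := eq_consHom hf hs
  obtain ⟨y', rfl⟩ : ∃ y', y = Fin.cons a y' := ⟨Fin.tail y, by rw [← hy0, Fin.cons_self_tail]⟩
  exact (consIso S _ hy0 hy1).hom_inv_id_assoc _

/-- This is the cocone condition that lets the maps `consDegι` descend to `H ⊗ L`; it rests on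
`consHom` respecting composition. -/
lemma whiskerLeft_degMap_consDegι (ha : x 0 = a) (hb : x 1 = b) {l k : ℕ}
    (g : Fin (k + 1) →o Fin (l + 1)) (f : Fin (n + 1) →o Fin (k + 1))
    (hf : Function.Surjective f) (hgf : Function.Surjective (g.comp f)) (hk : k < n) (hl : l < n)
    (z : Fin (l + 1) → X) (y : Fin (k + 1) → X) (h : ∀ i, z (g i) = y i)
    (h' : ∀ i, y (f i) = Fin.tail x i) :
    S.obj (a ⟶[V] b) ◁ degMap S g z y h ≫ consDegι S x ha hb f hf hk y h' =
      consDegι S x ha hb (g.comp f) hgf hl z (comp_spec h h') := by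
  have hg := surjective_of_surjective_comp hgf
  have hy : y 0 = b := apply_zero_eq hb hf h'
  have hz : z 0 = b := by
    rw [← hy, ← h 0, monotone_surjective_zero hg]
  have e := degMap_cons S (consHom_surjective hg) hg (fun _ => rfl)
    (Fin.cons a z : Fin (l + 2) → X) (Fin.cons a y : Fin (k + 2) → X)
    (Fin.cases rfl h) h (a := a) (b := b) rfl hy rfl hz
  have hc : (consHom g).comp (consHom f) = consHom (g.comp f) :=
    eq_consHom ((consHom_surjective hg).comp (consHom_surjective hf)) fun _ => rfl
  have e' := degMap_degι S (consHom g) (consHom f) (consHom_surjective hf)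
    ((consHom_surjective hg).comp (consHom_surjective hf)) (Nat.succ_lt_succ hk)
    (Fin.cons a z : Fin (l + 2) → X) (Fin.cons a y : Fin (k + 2) → X) x
    (Fin.cases rfl h) (consHom_spec ha h')
  exact comp_inv_comp_eq _ _ _ _ e _ _ (e'.trans (degι_congr S hc _ _ _ _ _))

variable [MonoidalClosed W]

/-- As the monoidal structure is closed, tensoring with the hom-object preserves the colimit over
the degeneracies into the tail. -/
lemma existsUnique_consLatching (ha : x 0 = a) (hb : x 1 = b) :
    ∃! θ : S.obj (a ⟶[V] b) ⊗ nerveLatchingAt S X (Fin.tail x) ⟶ nerveLatchingAt S X x,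
    ∀ {k : ℕ} (f : Fin (n + 1) →o Fin (k + 1)) (hf : Function.Surjective f) (hk : k < n)
      (y : Fin (k + 1) → X) (h : ∀ i, y (f i) = Fin.tail x i),
      S.obj (a ⟶[V] b) ◁ degι S f hf hk y (Fin.tail x) h ≫ θ = consDegι S x ha hb f hf hk y h :=
  nerveLatchingAt_map_existsUnique_desc S (tensorLeft (S.obj (a ⟶[V] b))) (Fin.tail x)
    (fun f hf hk y h => consDegι S x ha hb f hf hk y h) fun g f hf hgf hk hl z y h h' =>
      whiskerLeft_degMap_consDegι S x ha hb g f hf hgf hk hl z y h h'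

end LatchingRecursion

/-! ### The pushout formula for partial latching objects -/

section LatchingPushout

variable {V : Type u₁} [Category.{v₁} V] [SemiCartesianMonoidalCategory V]
  {W : Type u} [Category.{v} W] [MonoidalCategory W] [SymmetricCategory W] [HasColimits W]
  (S : V ⥤ W) [S.Monoidal] {X : Type v} [EnrichedCategory V X] [MonoidalClosed W]
  {n : ℕ} (x : Fin (n + 2) → X) {a b : X} (ha : x 0 = a) (hb : x 1 = b)

/-- The map `Σ X(x_0, x_1) ⊗ L_{x_1, …, x_n} B ⟶ L_{x_0, …, x_n} B`. -/
def consLatching :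
    S.obj (a ⟶[V] b) ⊗ nerveLatchingAt S X (Fin.tail x) ⟶ nerveLatchingAt S X x :=
  (existsUnique_consLatching S x ha hb).choose

lemma whiskerLeft_degι_consLatching {k : ℕ} (f : Fin (n + 1) →o Fin (k + 1))
    (hf : Function.Surjective f) (hk : k < n)
    (y : Fin (k + 1) → X) (h : ∀ i, y (f i) = Fin.tail x i) :
    S.obj (a ⟶[V] b) ◁ degι S f hf hk y (Fin.tail x) h ≫ consLatching S x ha hb =
      consDegι S x ha hb f hf hk y h :=
  (existsUnique_consLatching S x ha hb).choose_spec.1 f hf hk y h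

lemma whiskerLeft_latching_hom_ext {H Z : W} (x : Fin (n + 1) → X)
    {u u' : H ⊗ nerveLatchingAt S X x ⟶ Z}
    (h : ∀ {k : ℕ} (f : Fin (n + 1) →o Fin (k + 1)) (hf : Function.Surjective f) (hk : k < n)
      (y : Fin (k + 1) → X) (h : ∀ i, y (f i) = x i),
      H ◁ degι S f hf hk y x h ≫ u = H ◁ degι S f hf hk y x h ≫ u') : u = u' :=
  nerveLatchingAt_map_hom_ext S (tensorLeft H) x fun f hf hk y h' => h f hf hk y h'

lemma consLatching_nerveLatchingMap : consLatching S x ha hb ≫ nerveLatchingMap S x =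
    S.obj (a ⟶[V] b) ◁ nerveLatchingMap S (Fin.tail x) ≫ (consIso S x ha hb).inv := by
  refine whiskerLeft_latching_hom_ext S _ fun f hf hk y h => ?_
  rw [reassoc_of% @whiskerLeft_degι_consLatching, ← MonoidalCategory.whiskerLeft_comp_assoc,
    degι_nerveLatchingMap, consDegι, Category.assoc, degι_nerveLatchingMap]
  have e := degMap_cons S (consHom_surjective hf) hf (fun _ => rfl)
    (Fin.cons a y : Fin _ → X) x (consHom_spec ha h) h ha hb rfl (apply_zero_eq hb hf h)
  exact inv_comp_eq_comp_inv _ _ _ _ e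

/-- Inserting an identity in front commutes with degeneracies of the rest, by the simplicial
identity `hc`. This is the commutativity of the pushout square. -/
lemma insertUnit_consLatching (e : a = b) :
    insertUnit S e _ ≫ consLatching S x ha hb =
      nerveLatchingMap S (Fin.tail x) ≫ collapseι S x ha hb e := by
  refine nerveLatchingAt_map_hom_ext S (𝟭 _) (Fin.tail x) fun {k} f hf hk y h => ?_
  change degι S f hf hk y _ h ≫ _ = degι S f hf hk y _ h ≫ _
  rw [reassoc_of% @degι_nerveLatchingMap, ← Category.assoc, ← insertUnit_naturality, Category.assoc,
    whiskerLeft_degι_consLatching, consDegι, ← Category.assoc]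
  have hy := apply_zero_eq hb hf h
  have hσ : ∀ i, y (firstDegeneracy k i) = (Fin.cons a y : Fin (k + 2) → X) i :=
    Fin.cases (hy.trans e.symm) fun _ => rfl
  have e1 : degMap S (firstDegeneracy k) y (Fin.cons a y : Fin (k + 2) → X) hσ =
      insertUnit S e _ ≫ (consFinIso S a y hy).inv :=
    degMap_firstDegeneracy S (Fin.cons a y : Fin (k + 2) → X) rfl hy e
  have hc : f.comp (firstDegeneracy n) = (firstDegeneracy k).comp (consHom f) := by
    have h0 := monotone_surjective_zero hf
    ext i : 2
    rcases Fin.eq_zero_or_eq_succ i with rfl | ⟨i, rfl⟩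
    · exact h0
    · rfl
  have hs : Function.Surjective (f.comp (firstDegeneracy n)) := hf.comp firstDegeneracy_surjective
  rw [← e1, collapseι, degMap_degι S (firstDegeneracy k) (consHom f) _ (hc ▸ hs),
    degMap_degι S f (firstDegeneracy n) _ hs]
  exact (degι_congr S hc _ _ _ _ _).symm

variable {Z : W} (s : a = b → (nerveAt S X (Fin.tail x) ⟶ Z))
  (t : S.obj (a ⟶[V] b) ⊗ nerveLatchingAt S X (Fin.tail x) ⟶ Z)

/-- A map out of the domain of a degeneracy, defined by cases. -/
def latchingCase : ∀ {k : ℕ} (f : Fin (n + 2) →o Fin (k + 1)) (_ : Function.Surjective f)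
    (_ : k < n + 1) (y : Fin (k + 1) → X) (_ : ∀ i, y (f i) = x i), nerveAt S X y ⟶ Z
  -- A map to `Fin 1` identifies all vertices, so only the collapsing case occurs.
  | 0, f, _, _, y, h => degMap S (tailHom f) y (Fin.tail x) (tailHom_spec h) ≫
      s (by rw [← ha, ← hb, ← h, ← h, Fin.subsingleton_one.elim (f 0) (f 1)])
  | k + 1, f, hf, hk, y, h =>
    open Classical in
    if h01 : f 0 = f 1 then
      degMap S (tailHom f) y (Fin.tail x) (tailHom_spec h) ≫
        s (by rw [← ha, ← hb, ← h, ← h, h01])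
    else
      have hs := exists_shift hf h01
      have h0 := monotone_surjective_zero hf
      have h1 : f 1 = 1 := (hs.choose_spec.2 0).trans
        (by rw [monotone_surjective_zero hs.choose_spec.1]; rfl)
      (consIso S y ((congrArg y h0).symm.trans ((h 0).trans ha))
        ((congrArg y h1).symm.trans ((h 1).trans hb))).hom ≫
      S.obj (a ⟶[V] b) ◁ degι S hs.choose hs.choose_spec.1 (Nat.lt_of_succ_lt_succ hk)
        (Fin.tail y) (Fin.tail x)
        (fun i => (congrArg y (hs.choose_spec.2 i)).symm.trans (h i.succ)) ≫ t

omit [MonoidalClosed W] in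
lemma latchingCase_of_eq {k : ℕ} (f : Fin (n + 2) →o Fin (k + 1)) (hf : Function.Surjective f)
    (hk : k < n + 1) (y : Fin (k + 1) → X) (h : ∀ i, y (f i) = x i) (h01 : f 0 = f 1) (e : a = b) :
    latchingCase S x ha hb s t f hf hk y h =
      degMap S (tailHom f) y (Fin.tail x) (tailHom_spec h) ≫ s e := by
  cases k with
  | zero => rfl
  | succ k => exact dif_pos h01

omit [MonoidalClosed W] in
lemma latchingCase_of_ne {k : ℕ} (f : Fin (n + 2) →o Fin (k + 2)) (hf : Function.Surjective f)
    (hk : k + 1 < n + 1) (y : Fin (k + 2) → X) (h : ∀ i, y (f i) = x i)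
    (f' : Fin (n + 1) →o Fin (k + 1)) (hf' : Function.Surjective f')
    (hs : ∀ i, f i.succ = (f' i).succ) (hk' : k < n) (h' : ∀ i, Fin.tail y (f' i) = Fin.tail x i)
    (hy0 : y 0 = a) (hy1 : y 1 = b) :
    latchingCase S x ha hb s t f hf hk y h = (consIso S y hy0 hy1).hom ≫
      S.obj (a ⟶[V] b) ◁ degι S f' hf' hk' (Fin.tail y) (Fin.tail x) h' ≫ t := by
  have h01 : f 0 ≠ f 1 := by
    rw [monotone_surjective_zero hf]
    exact fun e => Fin.succ_ne_zero (f' 0) ((hs 0).symm.trans e.symm)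
  -- A shift is determined by `hs`, so the one chosen in the definition is `f'`.
  have e : (exists_shift hf h01).choose = f' := by
    ext i : 2
    exact Fin.succ_injective _ (((exists_shift hf h01).choose_spec.2 i).symm.trans (hs i))
  subst e
  exact dif_neg h01

omit [HasColimits W] [MonoidalClosed W] in
lemma degMap_congr {n k : ℕ} {f f' : Fin (n + 1) →o Fin (k + 1)} (e : f = f')
    (y : Fin (k + 1) → X) (x : Fin (n + 1) → X) (h : ∀ i, y (f i) = x i) :
    degMap S f y x h = degMap S f' y x (e ▸ h) := by
  subst e
  rfl

omit [MonoidalClosed W] in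
-- If `f` collapses the first edge, so does the composite; if neither `f` nor `g` does, everything
-- is a shift. Only when `f` is a shift and `g` collapses do the two branches meet, and there the
-- compatibility `w` is needed.
lemma degMap_latchingCase
    (w : ∀ e : a = b, insertUnit S e _ ≫ t = nerveLatchingMap S (Fin.tail x) ≫ s e)
    {l k : ℕ} (g : Fin (k + 1) →o Fin (l + 1)) (f : Fin (n + 2) →o Fin (k + 1))
    (hf : Function.Surjective f) (hgf : Function.Surjective (g.comp f)) (hk : k < n + 1)
    (hl : l < n + 1)
    (z : Fin (l + 1) → X) (y : Fin (k + 1) → X) (h : ∀ i, z (g i) = y i)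
    (h' : ∀ i, y (f i) = x i) :
    degMap S g z y h ≫ latchingCase S x ha hb s t f hf hk y h' =
      latchingCase S x ha hb s t (g.comp f) hgf hl z (comp_spec h h') := by
  have hg := surjective_of_surjective_comp hgf
  by_cases h01 : f 0 = f 1
  · have e : a = b := by rw [← ha, ← hb, ← h', ← h', h01]
    have gf01 : (g.comp f) 0 = (g.comp f) 1 := congrArg g h01
    rw [latchingCase_of_eq _ _ _ _ _ _ _ _ _ _ _ h01 e,
      latchingCase_of_eq _ _ _ _ _ _ _ _ _ _ _ gf01 e, ← Category.assoc]
    exact congrArg (fun t => t ≫ s e) (degMap_comp S g (tailHom f) _ _ _ _ _)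
  · have hk0 : k ≠ 0 := by
      rintro rfl
      exact h01 (Fin.subsingleton_one.elim _ _)
    obtain ⟨k, rfl⟩ := Nat.exists_eq_succ_of_ne_zero hk0
    obtain ⟨f', hf', hs⟩ := exists_shift hf h01
    have f0 := monotone_surjective_zero hf
    have f1 : f 1 = 1 := (hs 0).trans (by rw [monotone_surjective_zero hf']; rfl)
    have hy0 : y 0 = a := (congrArg y f0).symm.trans ((h' 0).trans ha)
    have hy1 : y 1 = b := (congrArg y f1).symm.trans ((h' 1).trans hb)
    have hk' := Nat.lt_of_succ_lt_succ hk
    have hfy (i) : Fin.tail y (f' i) = Fin.tail x i :=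
      (congrArg y (hs i)).symm.trans (h' i.succ)
    rw [latchingCase_of_ne S x ha hb s t f hf hk y h' f' hf' hs hk' hfy hy0 hy1]
    by_cases g01 : g 0 = g 1
    · have e : a = b := by rw [← hy0, ← hy1, ← h, ← h, g01]
      have gf01 : (g.comp f) 0 = (g.comp f) 1 := by
        change g (f 0) = g (f 1)
        rw [f0, f1, g01]
      rw [latchingCase_of_eq _ _ _ _ _ _ _ _ _ _ _ gf01 e,
        ← Category.assoc, degMap_eq_insertUnit S y hg g01 z h hy0 hy1 e,
        Category.assoc, ← Category.assoc (insertUnit S e _), insertUnit_naturality, Category.assoc,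
        w e, reassoc_of% @degι_nerveLatchingMap, ← Category.assoc, degMap_comp]
      refine congrArg (fun t => t ≫ s e) (degMap_congr S ?_ _ _ _)
      ext i : 2
      exact (congrArg g (hs i)).symm
    · have hl0 : l ≠ 0 := by
        rintro rfl
        exact g01 (Fin.subsingleton_one.elim _ _)
      obtain ⟨l, rfl⟩ := Nat.exists_eq_succ_of_ne_zero hl0
      obtain ⟨g', hg', hgs⟩ := exists_shift hg g01
      have hz0 : z 0 = a := by
        rw [← hy0, ← h 0, monotone_surjective_zero hg]
      have g1 : g 1 = 1 := (hgs 0).trans (by rw [monotone_surjective_zero hg']; rfl)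
      have hz1 : z 1 = b := by
        rw [← hy1, ← h 1, g1]
      have hzy (i) : Fin.tail z (g' i) = Fin.tail y i := (congrArg z (hgs i)).symm.trans (h i.succ)
      rw [latchingCase_of_ne S x ha hb s t (g.comp f) hgf hl z _ (g'.comp f')
        (hg'.comp hf') (fun i => (congrArg g (hs i)).trans (hgs _)) (Nat.lt_of_succ_lt_succ hl)
        (comp_spec hzy hfy) hz0 hz1, ← Category.assoc,
        degMap_cons S hg hg' hgs z y h hzy hy0 hy1 hz0 hz1, Category.assoc,
        ← MonoidalCategory.whiskerLeft_comp_assoc,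
        degMap_degι S g' f' hf' (hg'.comp hf') hk']

/-- Every proper degeneracy collapses the first edge or is a shift of a proper degeneracy into the
tail, so these two kinds determine the colimit. The component `s` is asked for only when `a = b`,
which treats both cases of the recursion at once. -/
lemma existsUnique_latching_desc
    (w : ∀ e : a = b, insertUnit S e _ ≫ t = nerveLatchingMap S (Fin.tail x) ≫ s e) :
    ∃! u : nerveLatchingAt S X x ⟶ Z, consLatching S x ha hb ≫ u = t ∧
      ∀ e : a = b, collapseι S x ha hb e ≫ u = s e := by
  obtain ⟨u, hu, hu'⟩ := nerveLatchingAt_map_existsUnique_desc S (𝟭 W) x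
    (fun f hf hk y h => latchingCase S x ha hb s t f hf hk y h)
    fun g f hf hgf hk hl z y h h' => degMap_latchingCase S x ha hb s t w g f hf hgf hk hl z y h h'
  refine ⟨u, ⟨whiskerLeft_latching_hom_ext S _ fun f hf hk y h => ?_, fun e => ?_⟩,
    fun v ⟨hv, hv'⟩ => hu' v fun {k} f hf hk y h => ?_⟩
  · rw [reassoc_of% @whiskerLeft_degι_consLatching, consDegι, Category.assoc]
    exact (congrArg (fun t => _ ≫ t) ((hu (consHom f) _ (Nat.succ_lt_succ hk) _ _).trans
      (latchingCase_of_ne S x ha hb s t (consHom f) (consHom_surjective hf) _ _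
        (consHom_spec ha h) f hf (fun _ => rfl) hk h rfl (apply_zero_eq hb hf h)))).trans
      (Iso.inv_hom_id_assoc _ _)
  · refine (hu (firstDegeneracy n) firstDegeneracy_surjective (Nat.lt_succ_self n) _
      (tail_firstDegeneracy x ha hb e)).trans ?_
    rw [latchingCase_of_eq S x ha hb s t (firstDegeneracy n) _ _ _
      (tail_firstDegeneracy x ha hb e) rfl e]
    exact (congrArg (fun t => t ≫ s e) (degMap_id S _ _)).trans (Category.id_comp _)
  · change degι S f hf hk y x h ≫ v = _
    by_cases h01 : f 0 = f 1
    · have e : a = b := by rw [← ha, ← hb, ← h, ← h, h01]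
      rw [degι_eq_collapseι S x hf hk h01 y h ha hb e, Category.assoc, hv',
        latchingCase_of_eq S x ha hb s t f hf hk y h h01 e]
    · have hk0 : k ≠ 0 := by
        rintro rfl
        exact h01 (Fin.subsingleton_one.elim _ _)
      obtain ⟨k, rfl⟩ := Nat.exists_eq_succ_of_ne_zero hk0
      obtain ⟨f', hf', hs⟩ := exists_shift hf h01
      have f1 : f 1 = 1 := (hs 0).trans (by rw [monotone_surjective_zero hf']; rfl)
      have hy0 : y 0 = a := (congrArg y (monotone_surjective_zero hf)).symm.trans ((h 0).trans ha)
      have hy1 : y 1 = b := (congrArg y f1).symm.trans ((h 1).trans hb)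
      have hk' := Nat.lt_of_succ_lt_succ hk
      have hfy (i) : Fin.tail y (f' i) = Fin.tail x i :=
        (congrArg y (hs i)).symm.trans (h i.succ)
      rw [latchingCase_of_ne S x ha hb s t f hf hk y h f' hf' hs hk' hfy hy0 hy1,
        ← consDegι_tail S x ha hb hf hf' hs hk hk' y h hfy hy0 hy1, Category.assoc,
        ← whiskerLeft_degι_consLatching, Category.assoc, hv]

lemma isPushout_consLatching (e : a = b) :
    IsPushout (nerveLatchingMap S (Fin.tail x)) (insertUnit S e _) (collapseι S x ha hb e)
      (consLatching S x ha hb) := by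
  refine ⟨⟨(insertUnit_consLatching S x ha hb e).symm⟩, ⟨PushoutCocone.isColimitAux' _ fun c => ?_⟩⟩
  have h := existsUnique_latching_desc S x ha hb (fun _ => c.inl) c.inr fun _ => c.condition.symm
  exact ⟨h.choose, h.choose_spec.1.2 e, h.choose_spec.1.1, fun {m} h1 h2 =>
    h.choose_spec.2 m ⟨h2, fun _ => h1⟩⟩

/-- No degeneracy can collapse an edge between distinct objects, so `s` is vacuous and the universal
property becomes that of `H ⊗ L` alone. -/
lemma isIso_consLatching (hab : a ≠ b) : IsIso (consLatching S x ha hb) := by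
  obtain ⟨u, ⟨hu, -⟩, -⟩ := existsUnique_latching_desc S x ha hb (fun e => absurd e hab) (𝟙 _)
    fun e => absurd e hab
  refine ⟨u, hu, ?_⟩
  exact (existsUnique_latching_desc S x ha hb (fun e => absurd e hab) (consLatching S x ha hb)
    fun e => absurd e hab).unique ⟨by rw [reassoc_of% hu], fun e => absurd e hab⟩
    ⟨Category.comp_id _, fun e => absurd e hab⟩

end LatchingPushout

/-! ### Tensoring with cofibrant objects -/

section MonoidalModel

variable {W : Type u} [Category.{v} W] [ModelCategory W] [MonoidalCategory W]
  [SymmetricCategory W] [MonoidalClosed W]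

instance isLeftAdjoint_curriedTensor_flip (A : W) :
    ((curriedTensor W).flip.obj A).IsLeftAdjoint :=
  Functor.isLeftAdjoint_of_iso (F := tensorLeft A) (BraidedCategory.tensorLeftIsoTensorRight A)

variable [IsMonoidalModelCategory W]

instance cofibration_whiskerLeft (H : W) [IsCofibrant H] {A B : W} (i : A ⟶ B) [Cofibration i] :
    Cofibration (H ◁ i) :=
  IsMonoidalModelCategory.cofibration (initial.to H) i
    (.ofIsInitialLeft _ _ _ initialIsInitial)

instance isCofibrant_tensorObj (H A : W) [IsCofibrant H] [IsCofibrant A] : IsCofibrant (H ⊗ A) :=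
  (isCofibrant_iff_of_isInitial (H ◁ initial.to A)
    (IsInitial.isInitialObj (tensorLeft H) _ initialIsInitial)).2 inferInstance

end MonoidalModel

/-! ### Cofibrancy of latching maps, and the recursion for weights -/

section Weights

variable {V : Type u₁} [Category.{v₁} V] [SemiCartesianMonoidalCategory V]
  {W : Type u} [Category.{v} W] [ModelCategory W] [HasColimits W] [MonoidalCategory W]
  [SymmetricCategory W] [MonoidalClosed W] [IsMonoidalModelCategory W]
  {S : V ⥤ W} [S.Monoidal] {X : Type v} [EnrichedCategory V X]

omit [SymmetricCategory W] [MonoidalClosed W] [IsMonoidalModelCategory W] in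
lemma IsCofibrantEnriched.isCofibrant_obj
    (hX : IsCofibrantEnriched W (TransportEnrichment S X)) (a b : X) :
    IsCofibrant (S.obj (a ⟶[V] b)) :=
  hX.1 a b

omit [SymmetricCategory W] [MonoidalClosed W] [IsMonoidalModelCategory W] [HasColimits W] in
lemma IsCofibrantEnriched.cofibration_unitOfEq
    (hX : IsCofibrantEnriched W (TransportEnrichment S X)) {a b : X} (e : a = b) :
    Cofibration (unitOfEq S e) := by
  subst e
  rw [unitOfEq_rfl]
  exact hX.2 a

variable (S) in
/-- The pushout-product square of the latching recursion. -/
def latchingPushoutObjObj {n : ℕ} (x : Fin (n + 2) → X) {a b : X} (ha : x 0 = a) (hb : x 1 = b)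
    (e : a = b) :
    (curriedTensor W).PushoutObjObj (unitOfEq S e) (nerveLatchingMap S (Fin.tail x)) where
  pt := nerveLatchingAt S X x
  inl := consLatching S x ha hb
  inr := (λ_ _).hom ≫ collapseι S x ha hb e
  -- The left unitor turns the corners `I ⊗ -` of the pushout-product into those of the pushout
  -- already known.
  isPushout := (isPushout_consLatching S x ha hb e).flip.of_iso (λ_ _).symm (Iso.refl _)
    (λ_ _).symm (Iso.refl _) (by simp [insertUnit]) (by simp) (by simp) (by simp)
  ι := nerveLatchingMap S x ≫ (consIso S x ha hb).hom
  inl_ι := by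
    rw [← Category.assoc, consLatching_nerveLatchingMap]
    simp
  inr_ι := by
    rw [Category.assoc, ← Category.assoc (collapseι S x ha hb e), collapseι_nerveLatchingMap]
    simp [insertUnit]

/-- For equal objects the latching map is, up to isomorphism, the pushout-product of an
identity-assigning map with the previous latching map. For distinct ones it is the previous latching
map tensored with a cofibrant hom-object. -/
lemma cofibration_nerveLatchingMap_succ (hX : IsCofibrantEnriched W (TransportEnrichment S X))
    {n : ℕ} (x : Fin (n + 2) → X) (h : Cofibration (nerveLatchingMap S (Fin.tail x)))
    [IsCofibrant (nerveLatchingAt S X (Fin.tail x))] :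
    Cofibration (nerveLatchingMap S x) ∧ IsCofibrant (nerveLatchingAt S X x) := by
  have := hX.isCofibrant_obj (x 0) (x 1)
  by_cases e : x 0 = x 1
  · have := hX.cofibration_unitOfEq e
    have h1 : Cofibration (nerveLatchingMap S x ≫ (consIso S x rfl rfl).hom) :=
      IsMonoidalModelCategory.cofibration _ _ (latchingPushoutObjObj S x rfl rfl e)
    have h2 := cofibration_of_isPushout (isPushout_consLatching S x rfl rfl e)
    refine ⟨?_, isCofibrant_of_cofibration (consLatching S x rfl rfl)⟩
    have : Cofibration ((nerveLatchingMap S x ≫ (consIso S x rfl rfl).hom) ≫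
      (consIso S x rfl rfl).inv) := inferInstance
    rwa [Category.assoc, Iso.hom_inv_id, Category.comp_id] at this
  · have := isIso_consLatching S x rfl rfl e
    refine ⟨?_, isCofibrant_of_iso (asIso (consLatching S x rfl rfl))⟩
    have h1 : nerveLatchingMap S x = inv (consLatching S x rfl rfl) ≫
        S.obj (x 0 ⟶[V] x 1) ◁ nerveLatchingMap S (Fin.tail x) ≫ (consIso S x rfl rfl).inv := by
      rw [← consLatching_nerveLatchingMap, IsIso.inv_hom_id_assoc]
    rw [h1]
    infer_instance

variable (S) in
/-- A partial latching object in dimension zero is initial. -/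
def isInitialNerveLatchingAt (x : Fin 1 → X) : IsInitial (nerveLatchingAt S X x) :=
  IsInitial.ofUniqueHom (fun Z => (nerveLatchingAt_map_existsUnique_desc S (𝟭 W) x (Z := Z)
    (fun _ _ hk _ _ => absurd hk (Nat.not_lt_zero _))
    (fun _ _ _ _ hk => absurd hk (Nat.not_lt_zero _))).choose) fun _ _ =>
      nerveLatchingAt_map_hom_ext S (𝟭 W) x fun _ _ hk => absurd hk (Nat.not_lt_zero _)

variable (S) in
/-- The summands of the magnitude nerve in dimension zero are isomorphic to the unit. -/
def nerveAtZeroIso (x : Fin 1 → X) : 𝟙_ W ≅ nerveAt S X x :=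
  Functor.Monoidal.εIso S

lemma cofibration_nerveLatchingMap (hX : IsCofibrantEnriched W (TransportEnrichment S X)) :
    ∀ {n : ℕ} (x : Fin (n + 1) → X),
      Cofibration (nerveLatchingMap S x) ∧ IsCofibrant (nerveLatchingAt S X x)
  | 0, x => by
    have := IsMonoidalModelCategory.cofibrant_unit (W := W)
    have := isCofibrant_of_iso (nerveAtZeroIso S x)
    have h := isInitialNerveLatchingAt S x
    exact ⟨(isCofibrant_iff_of_isInitial _ h).1 this, isCofibrant_of_isInitial h⟩
  | n + 1, x => by
    have h := cofibration_nerveLatchingMap hX (Fin.tail x)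
    have := h.2
    exact cofibration_nerveLatchingMap_succ hX x h.1

lemma isCofibrant_nerveAt (hX : IsCofibrantEnriched W (TransportEnrichment S X)) {n : ℕ}
    (x : Fin (n + 1) → X) : IsCofibrant (nerveAt S X x) :=
  have h := cofibration_nerveLatchingMap hX x
  have := h.1
  have := h.2
  isCofibrant_of_cofibration (nerveLatchingMap S x)

variable {k : Type w} [Ring k] (χ : MultiplicativeEulerCharacteristic W k)
  (hX : IsCofibrantEnriched W (TransportEnrichment S X))

include hX

lemma mem_nerveAt_succ {n : ℕ} (x : Fin (n + 2) → X) {h b : k}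
    (hh : h ∈ χ.toPFun (S.obj (x 0 ⟶[V] x 1))) (hb : b ∈ χ.toPFun (nerveAt S X (Fin.tail x))) :
    h * b ∈ χ.toPFun (nerveAt S X x) :=
  have := hX.isCofibrant_obj (x 0) (x 1)
  have := isCofibrant_nerveAt hX (Fin.tail x)
  χ.mem_of_iso (consIso S x rfl rfl).symm (χ.tensor hh hb)

lemma mem_nerveLatchingAt_of_ne {n : ℕ} (x : Fin (n + 2) → X) (hx : x 0 ≠ x 1) {h l : k}
    (hh : h ∈ χ.toPFun (S.obj (x 0 ⟶[V] x 1)))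
    (hl : l ∈ χ.toPFun (nerveLatchingAt S X (Fin.tail x))) :
    h * l ∈ χ.toPFun (nerveLatchingAt S X x) :=
  have := hX.isCofibrant_obj (x 0) (x 1)
  have := (cofibration_nerveLatchingMap hX (Fin.tail x)).2
  have := isIso_consLatching S x rfl rfl hx
  χ.mem_of_iso (asIso (consLatching S x rfl rfl)) (χ.tensor hh hl)

lemma mem_nerveLatchingAt_of_eq {n : ℕ} (x : Fin (n + 2) → X) (hx : x 0 = x 1) {h b l : k}
    (hh : h ∈ χ.toPFun (S.obj (x 0 ⟶[V] x 1))) (hb : b ∈ χ.toPFun (nerveAt S X (Fin.tail x)))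
    (hl : l ∈ χ.toPFun (nerveLatchingAt S X (Fin.tail x))) :
    b + h * l - l ∈ χ.toPFun (nerveLatchingAt S X x) :=
  have := hX.isCofibrant_obj (x 0) (x 1)
  have := (cofibration_nerveLatchingMap hX (Fin.tail x)).1
  have := (cofibration_nerveLatchingMap hX (Fin.tail x)).2
  χ.mem_of_isPushout (isPushout_consLatching S x rfl rfl hx) hl hb (χ.tensor hh hl)

variable (hS : ∀ A : V, χ.IsFinite (S.obj A))

include hS

lemma isFinite_nerve : ∀ {n : ℕ} (x : Fin (n + 1) → X),
    χ.IsFinite (nerveAt S X x) ∧ χ.IsFinite (nerveLatchingAt S X x)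
  | 0, x => ⟨EulerCharacteristic.isFinite_of_mem (χ.mem_of_iso (nerveAtZeroIso S x) χ.unit),
      EulerCharacteristic.isFinite_of_mem (χ.mem_of_isInitial (isInitialNerveLatchingAt S x))⟩
  | n + 1, x => by
    obtain ⟨hb, hl⟩ := isFinite_nerve (Fin.tail x)
    have hh := (hS (x 0 ⟶[V] x 1)).val_mem
    refine ⟨EulerCharacteristic.isFinite_of_mem (mem_nerveAt_succ χ hX x hh hb.val_mem), ?_⟩
    by_cases hx : x 0 = x 1
    · exact EulerCharacteristic.isFinite_of_mem
        (mem_nerveLatchingAt_of_eq χ hX x hx hh hb.val_mem hl.val_mem)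
    · exact EulerCharacteristic.isFinite_of_mem
        (mem_nerveLatchingAt_of_ne χ hX x hx hh hl.val_mem)

omit hX hS [MonoidalClosed W] [IsMonoidalModelCategory W] in
-- Nothing degenerates onto dimension zero, so the partial latching object is initial, while the
-- summand is `Σ1 ≅ I`.
lemma wgt_zero (x : Fin 1 → X) : wgt S X χ x = 1 := by
  rw [wgt, EulerCharacteristic.val_eq_of_mem (χ.mem_of_iso (nerveAtZeroIso S x) χ.unit),
    EulerCharacteristic.val_eq_of_mem (χ.mem_of_isInitial (isInitialNerveLatchingAt S x)), sub_zero]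

lemma wgt_succ_of_ne {n : ℕ} (x : Fin (n + 2) → X) (hx : x 0 ≠ x 1) :
    wgt S X χ x = χ.val (S.obj (x 0 ⟶[V] x 1)) * wgt S X χ (Fin.tail x) := by
  obtain ⟨hb, hl⟩ := isFinite_nerve χ hX hS (Fin.tail x)
  have hh := (hS (x 0 ⟶[V] x 1)).val_mem
  rw [wgt, wgt, EulerCharacteristic.val_eq_of_mem (mem_nerveAt_succ χ hX x hh hb.val_mem),
    EulerCharacteristic.val_eq_of_mem (mem_nerveLatchingAt_of_ne χ hX x hx hh hl.val_mem), mul_sub]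

/-- The copy of the tail glued into the latching object accounts for the `- 1`: `h * b - (b + h * l
- l) = (h - 1) * (b - l)`. -/
lemma wgt_succ_of_eq {n : ℕ} (x : Fin (n + 2) → X) (hx : x 0 = x 1) :
    wgt S X χ x = (χ.val (S.obj (x 0 ⟶[V] x 1)) - 1) * wgt S X χ (Fin.tail x) := by
  obtain ⟨hb, hl⟩ := isFinite_nerve χ hX hS (Fin.tail x)
  have hh := (hS (x 0 ⟶[V] x 1)).val_mem
  rw [wgt, wgt, EulerCharacteristic.val_eq_of_mem (mem_nerveAt_succ χ hX x hh hb.val_mem),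
    EulerCharacteristic.val_eq_of_mem
      (mem_nerveLatchingAt_of_eq χ hX x hx hh hb.val_mem hl.val_mem)]
  noncomm_ring

lemma wgt_eq_prod [DecidableEq X] : ∀ {n : ℕ} (x : Fin (n + 1) → X),
    wgt S X χ x = (List.ofFn fun i : Fin n =>
      χ.val (S.obj (x i.castSucc ⟶[V] x i.succ)) -
        if x i.castSucc = x i.succ then 1 else 0).prod
  | 0, x => by rw [wgt_zero]; rfl
  | n + 1, x => by
    have ih := wgt_eq_prod (Fin.tail x)
    have h : wgt S X χ x = (χ.val (S.obj (x 0 ⟶[V] x 1)) - if x 0 = x 1 then 1 else 0) *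
        wgt S X χ (Fin.tail x) := by
      split_ifs with hx
      · exact wgt_succ_of_eq χ hX hS x hx
      · rw [sub_zero]
        exact wgt_succ_of_ne χ hX hS x hx
    rw [h, ih, List.ofFn_succ, List.prod_cons]
    rfl

end Weights

/-! ### The latching object of the bar construction as a coproduct -/

section BarLatching

variable {W : Type u} [Category.{v} W] [MonoidalCategory W] [SymmetricCategory W] [HasColimits W]
  {Y : Type v} [EnrichedCategory W Y] (M : Bimodule W Y)

/-- The inclusion of a summand of the bar construction. -/
def barι (q : (chaoticNerve Y).Elements) : (barSummand M).obj q ⟶ (bar M).obj q.1 :=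
  Sigma.ι (fun y : (chaoticNerve Y).obj q.1 => barAt M q.1 y) q.2

lemma barι_map {q q' : (chaoticNerve Y).Elements} (τ : q ⟶ q') :
    barι M q ≫ (bar M).map τ.1 = (barSummand M).map τ ≫ barι M q' := by
  -- The vertex list of the target equals the image of that of `q` only propositionally;
  -- generalizing it allows substitution.
  have key {r : SimplexCategoryᵒᵖ} (t : q.1 ⟶ r) (y : (chaoticNerve Y).obj r)
      (h : (chaoticNerve Y).map t q.2 = y) : barι M q ≫ (bar M).map t =
        (barSummand M).map (X := q) (Y := (chaoticNerve Y).elementsMk r y) ⟨t, h⟩ ≫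
          barι M ((chaoticNerve Y).elementsMk r y) := by
    subst h
    exact Sigma.ι_desc _ _
  exact key τ.1 q'.2 τ.2

lemma bar_hom_ext {n : SimplexCategoryᵒᵖ} {Z : W} {f g : (bar M).obj n ⟶ Z}
    (h : ∀ y : (chaoticNerve Y).obj n, barι M ((chaoticNerve Y).elementsMk n y) ≫ f =
      barι M ((chaoticNerve Y).elementsMk n y) ≫ g) : f = g :=
  Sigma.hom_ext _ _ h

/-- Maps out of the bar construction. -/
def barDesc {n : SimplexCategoryᵒᵖ} {Z : W}
    (φ : ∀ y : (chaoticNerve Y).obj n, (barSummand M).obj ((chaoticNerve Y).elementsMk n y) ⟶ Z) :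
    (bar M).obj n ⟶ Z :=
  Sigma.desc φ

lemma barι_barDesc {n : SimplexCategoryᵒᵖ} {Z : W}
    (φ : ∀ y : (chaoticNerve Y).obj n, (barSummand M).obj ((chaoticNerve Y).elementsMk n y) ⟶ Z)
    (y : (chaoticNerve Y).obj n) :
    barι M ((chaoticNerve Y).elementsMk n y) ≫ barDesc M φ = φ y :=
  Sigma.ι_desc _ _

variable (n : SimplexCategoryᵒᵖ)

lemma existsUnique_latchingAt_desc (x : (chaoticNerve Y).obj n) :
    ∃! u : latchingAt M n x ⟶ latchingObj (𝟭 _) n (bar M),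
      ∀ (q : (chaoticNerve Y).Elements) (σ : q ⟶ (chaoticNerve Y).elementsMk n x)
        (hσ : IsDegeneracy (CategoryOfElements.π (chaoticNerve Y)) _ (Over.mk σ)),
        latchingι (CategoryOfElements.π (chaoticNerve Y)) ((chaoticNerve Y).elementsMk n x)
          (barSummand M) σ hσ ≫ u = barι M q ≫ latchingι (𝟭 _) n (bar M) σ.1 hσ :=
  latchingObj_map_existsUnique_desc (CategoryOfElements.π (chaoticNerve Y))
    ((chaoticNerve Y).elementsMk n x) (barSummand M) (𝟭 W)
    (fun q σ hσ => barι M q ≫ latchingι (𝟭 _) n (bar M) σ.1 hσ) (by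
      rintro q q' σ hσ σ' hσ' τ rfl
      have h := map_latchingι (𝟭 _) n (bar M) (τ ≫ σ').1 hσ σ'.1 hσ' τ.1 rfl
      rw [← h]
      exact (Category.assoc _ _ _).symm.trans ((congrArg (fun t => t ≫ _)
        (barι_map M τ).symm).trans (Category.assoc _ _ _)))

/-- A degeneracy sends the summand of `y` into a single summand, that of the image of `y`, so the
latching colimit splits over vertex lists. This map will be the inverse in `sigmaLatchingIso`. -/
lemma existsUnique_latchingObj_bar_desc :
    ∃! u : latchingObj (𝟭 _) n (bar M) ⟶ ∐ fun x : (chaoticNerve Y).obj n => latchingAt M n x,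
      ∀ (q : SimplexCategoryᵒᵖ) (σ : q ⟶ n)
        (hσ : IsDegeneracy (𝟭 SimplexCategoryᵒᵖ) n (Over.mk σ)),
        latchingι (𝟭 SimplexCategoryᵒᵖ) n (bar M) σ hσ ≫ u = barDesc M fun y =>
          latchingι (CategoryOfElements.π (chaoticNerve Y))
            ((chaoticNerve Y).elementsMk n ((chaoticNerve Y).map σ y)) (barSummand M)
            (q := (chaoticNerve Y).elementsMk q y) ⟨σ, rfl⟩ hσ ≫
            Sigma.ι (fun x : (chaoticNerve Y).obj n => latchingAt M n x)
              ((chaoticNerve Y).map σ y) :=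
  latchingObj_map_existsUnique_desc (𝟭 SimplexCategoryᵒᵖ) n (bar M) (𝟭 W) _ (by
    rintro q q' σ hσ σ' hσ' τ rfl
    refine bar_hom_ext M fun y => ?_
    rw [barι_barDesc]
    have h := barι_map M (q := (chaoticNerve Y).elementsMk q y)
      (q' := (chaoticNerve Y).elementsMk q' ((chaoticNerve Y).map τ y)) ⟨τ, rfl⟩
    refine ((Category.assoc _ _ _).symm.trans (congrArg (fun t => t ≫ _) h)).trans
      ((Category.assoc _ _ _).trans ?_)
    refine (congrArg (fun t => _ ≫ t) (barι_barDesc M _ _)).trans ?_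
    refine (Category.assoc _ _ _).symm.trans (congrArg (fun t => t ≫ _) ?_)
    exact map_latchingι (CategoryOfElements.π (chaoticNerve Y)) _ (barSummand M) _ _ _ _ _ rfl)

/-- The latching object of the bar construction is the coproduct of the partial latching
objects. -/
def sigmaLatchingIso :
    (∐ fun x : (chaoticNerve Y).obj n => latchingAt M n x) ≅ latchingObj (𝟭 _) n (bar M) where
  hom := Sigma.desc fun x => (existsUnique_latchingAt_desc M n x).choose
  inv := (existsUnique_latchingObj_bar_desc M n).choose
  hom_inv_id := by
    refine Sigma.hom_ext _ _ fun x => ?_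
    rw [Sigma.ι_desc_assoc, Category.comp_id]
    refine latchingObj_map_hom_ext (CategoryOfElements.π (chaoticNerve Y))
      ((chaoticNerve Y).elementsMk n x) (barSummand M) (𝟭 W) fun q σ hσ => ?_
    have h1 := (existsUnique_latchingAt_desc M n x).choose_spec.1 q σ hσ
    have h2 := (existsUnique_latchingObj_bar_desc M n).choose_spec.1 q.1 σ.1 hσ
    refine (Category.assoc _ _ _).symm.trans ((congrArg (fun t => t ≫ _) h1).trans ?_)
    refine (Category.assoc _ _ _).trans ((congrArg (fun t => _ ≫ t) h2).trans ?_)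
    refine (barι_barDesc M _ q.2).trans ?_
    have key (x : (chaoticNerve Y).obj n) (h : (chaoticNerve Y).map σ.1 q.2 = x) :
        latchingι (CategoryOfElements.π (chaoticNerve Y))
            ((chaoticNerve Y).elementsMk n ((chaoticNerve Y).map σ.1 q.2)) (barSummand M)
            (q := q) ⟨σ.1, rfl⟩ hσ ≫
            Sigma.ι (fun x : (chaoticNerve Y).obj n => latchingAt M n x)
              ((chaoticNerve Y).map σ.1 q.2) =
          latchingι (CategoryOfElements.π (chaoticNerve Y))
            ((chaoticNerve Y).elementsMk n x) (barSummand M) (q := q) ⟨σ.1, h⟩ hσ ≫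
            Sigma.ι (fun x : (chaoticNerve Y).obj n => latchingAt M n x) x := by
      subst h
      rfl
    exact key x σ.2
  inv_hom_id := by
    refine latchingObj_map_hom_ext (𝟭 SimplexCategoryᵒᵖ) n (bar M) (𝟭 W) fun q σ hσ => ?_
    refine (Category.assoc _ _ _).symm.trans ((congrArg (fun t => t ≫ _)
      ((existsUnique_latchingObj_bar_desc M n).choose_spec.1 q σ hσ)).trans
      (Eq.trans ?_ (Category.comp_id _).symm))
    refine bar_hom_ext M fun y => ?_
    refine (Category.assoc _ _ _).symm.trans ((congrArg (fun t => t ≫ _)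
      (barι_barDesc M _ y)).trans ((Category.assoc _ _ _).trans ?_))
    refine (whisker_eq _ (Sigma.ι_desc (f := fun x => latchingAt M n x)
      (fun x => (existsUnique_latchingAt_desc M n x).choose) _)).trans ?_
    exact (existsUnique_latchingAt_desc M n _).choose_spec.1
      ((chaoticNerve Y).elementsMk q y) ⟨σ, rfl⟩ hσ

lemma sigmaLatchingIso_hom_latchingMap : (sigmaLatchingIso M n).hom ≫ latchingMap (𝟭 _) n (bar M) =
    Limits.Sigma.map fun x : (chaoticNerve Y).obj n =>
      latchingMap (CategoryOfElements.π (chaoticNerve Y)) ((chaoticNerve Y).elementsMk n x)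
        (barSummand M) := by
  refine Sigma.hom_ext _ _ fun x => ?_
  refine (Category.assoc _ _ _).symm.trans ((congrArg (· ≫ latchingMap (𝟭 _) n (bar M))
    (Sigma.ι_desc _ _)).trans (Eq.trans ?_ (Sigma.ι_map _ _).symm))
  refine latchingObj_map_hom_ext (CategoryOfElements.π (chaoticNerve Y))
    ((chaoticNerve Y).elementsMk n x) (barSummand M) (𝟭 W) fun q σ hσ => ?_
  have h1 := (existsUnique_latchingAt_desc M n x).choose_spec.1 q σ hσ
  refine (Category.assoc _ _ _).symm.trans ((congrArg (fun t => t ≫ _) h1).trans ?_)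
  refine (Category.assoc _ _ _).trans ((congrArg (fun t => _ ≫ t)
    (latchingι_latchingMap (𝟭 _) n (bar M) σ.1 hσ)).trans ?_)
  refine (barι_map M σ).trans ?_
  exact ((Category.assoc _ _ _).symm.trans (congrArg (fun t => t ≫ _)
    (latchingι_latchingMap _ _ (barSummand M) σ hσ))).symm

end BarLatching

lemma cofibration_sigmaMap {W : Type u} [Category.{v} W] [ModelCategory W] {ι : Type w}
    {f g : ι → W} [HasCoproduct f] [HasCoproduct g] (p : ∀ i, f i ⟶ g i)
    [hp : ∀ i, Cofibration (p i)] : Cofibration (Limits.Sigma.map p) := by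
  simp only [cofibration_iff, ← trivialFibrations_llp] at hp ⊢
  intro X Y q hq
  refine ⟨fun {t b} sq => ?_⟩
  have h (i : ι) : HasLiftingProperty (p i) q := hp i q hq
  have sq' (i : ι) : CommSq (Sigma.ι f i ≫ t) (p i) q (Sigma.ι g i ≫ b) :=
    ⟨by rw [Category.assoc, sq.w]; simp⟩
  exact ⟨⟨Sigma.desc fun i => (sq' i).lift, Sigma.hom_ext _ _ fun i => by simp,
    Sigma.hom_ext _ _ fun i => by simp⟩⟩

/-! ### Skeleta of the realization of the magnitude nerve -/

section Realization

variable {V : Type u₁} [Category.{v₁} V] [SemiCartesianMonoidalCategory V]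
  {W : Type u} [Category.{v} W] [ModelCategory W] [HasColimits W] [MonoidalCategory W]
  [SymmetricCategory W] [MonoidalClosed W] [IsMonoidalModelCategory W]
  {S : V ⥤ W} [S.Monoidal] {X : Type v} [EnrichedCategory V X]
  (hX : IsCofibrantEnriched W (TransportEnrichment S X))

variable (S X) in
/-- The latching object of the magnitude nerve as a coproduct of partial latching objects. -/
def sigmaNerveLatchingIso (n : ℕ) : (∐ fun x : Fin (n + 1) → X => nerveLatchingAt S X x) ≅
    latchingObj (𝟭 _) (op (SimplexCategory.mk n)) (magnitudeNerve S X) :=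
  sigmaLatchingIso (unitBimodule S X) (op (SimplexCategory.mk n))

variable (S X) in
/-- The magnitude nerve as a coproduct of its summands. -/
def sigmaNerveIso (n : ℕ) : (∐ fun x : Fin (n + 1) → X => nerveAt S X x) ≅
    (magnitudeNerve S X).obj (op (SimplexCategory.mk n)) :=
  Iso.refl _

omit [ModelCategory W] [MonoidalClosed W] [IsMonoidalModelCategory W] in
variable (S X) in
lemma sigmaNerveLatchingIso_hom_latchingMap (n : ℕ) :
    (sigmaNerveLatchingIso S X n).hom ≫
      latchingMap (𝟭 _) (op (SimplexCategory.mk n)) (magnitudeNerve S X) =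
    Limits.Sigma.map (fun x : Fin (n + 1) → X => nerveLatchingMap S x) ≫
      (sigmaNerveIso S X n).hom :=
  (sigmaLatchingIso_hom_latchingMap (unitBimodule S X) (op (SimplexCategory.mk n))).trans
    (Category.comp_id _).symm

include hX

lemma isCofibrant_latchingObj_magnitudeNerve (n : ℕ) :
    IsCofibrant (latchingObj (𝟭 _) (op (SimplexCategory.mk n)) (magnitudeNerve S X)) :=
  have (x : Fin (n + 1) → X) := (cofibration_nerveLatchingMap hX x).2
  have := isCofibrant_sigma fun x : Fin (n + 1) → X => nerveLatchingAt S X x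
  isCofibrant_of_iso (sigmaNerveLatchingIso S X n)

lemma cofibration_latchingMap_magnitudeNerve (n : ℕ) :
    Cofibration (latchingMap (𝟭 _) (op (SimplexCategory.mk n)) (magnitudeNerve S X)) := by
  have (x : Fin (n + 1) → X) := (cofibration_nerveLatchingMap hX x).1
  have := cofibration_sigmaMap fun x : Fin (n + 1) → X => nerveLatchingMap S x
  have h := sigmaNerveLatchingIso_hom_latchingMap S X n
  rw [← Iso.eq_inv_comp] at h
  rw [h]
  infer_instance

variable {k : Type w} [Ring k] (χ : MultiplicativeEulerCharacteristic W k)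
  (hS : ∀ A : V, χ.IsFinite (S.obj A)) [Fintype X]

include hS

lemma mem_latchingObj_magnitudeNerve (n : ℕ) :
    ∑ x : Fin (n + 1) → X, χ.val (nerveLatchingAt S X x) ∈ χ.toPFun
      (latchingObj (𝟭 _) (op (SimplexCategory.mk n)) (magnitudeNerve S X)) :=
  have (x : Fin (n + 1) → X) := (cofibration_nerveLatchingMap hX x).2
  χ.mem_of_iso (sigmaNerveLatchingIso S X n)
    (χ.mem_sigma _ fun x => (isFinite_nerve χ hX hS x).2.val_mem)

lemma mem_magnitudeNerve (n : ℕ) :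
    ∑ x : Fin (n + 1) → X, χ.val (nerveAt S X x) ∈ χ.toPFun
      ((magnitudeNerve S X).obj (op (SimplexCategory.mk n))) :=
  have (x : Fin (n + 1) → X) := isCofibrant_nerveAt hX x
  χ.mem_of_iso (sigmaNerveIso S X n)
    (χ.mem_sigma _ fun x => (isFinite_nerve χ hX hS x).1.val_mem)

variable [SimplicialCategory W] [IsSimplicialModelCategory W]

/-- Cofibrancy of the stage is part of the induction because attaching the next cells must be a
homotopy pushout. -/
lemma mem_skeletalRealization_magnitudeNerve (n : ℕ) :
    IsCofibrant (skeletalRealization n (magnitudeNerve S X)) ∧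
      ∑ j ∈ Finset.range (n + 1), (-1) ^ j * ∑ x : Fin (j + 1) → X, wgt S X χ x ∈
        χ.toPFun (skeletalRealization n (magnitudeNerve S X)) := by
  induction n with
  | zero =>
    obtain ⟨e⟩ := nonempty_iso_skeletalRealization_zero W (magnitudeNerve S X)
    have (x : Fin 1 → X) := isCofibrant_nerveAt hX x
    have := isCofibrant_sigma fun x : Fin 1 → X => nerveAt S X x
    refine ⟨isCofibrant_of_iso (sigmaNerveIso S X 0 ≪≫ e.symm), ?_⟩
    convert χ.mem_of_iso e.symm (mem_magnitudeNerve hX χ hS 0) using 1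
    refine (Finset.sum_range_one _).trans ?_
    rw [pow_zero, one_mul]
    refine Finset.sum_congr rfl fun x _ => ?_
    -- In dimension zero the partial latching objects are initial, so weights are the Euler
    -- characteristics of the summands.
    rw [wgt, EulerCharacteristic.val_eq_of_mem (χ.mem_of_isInitial (isInitialNerveLatchingAt S x)),
      sub_zero]
  | succ n ih =>
    have : IsCofibrant (boundedRealization n (magnitudeNerve S X)).pt := ih.1
    have := isCofibrant_latchingObj_magnitudeNerve hX (n + 1)
    have := cofibration_latchingMap_magnitudeNerve hX (n + 1)
    have h := TruncatedRealization.mem_succ χ.toEulerCharacteristic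
      (boundedRealization n (magnitudeNerve S X)) (boundedRealization (n + 1) (magnitudeNerve S X))
      (mem_latchingObj_magnitudeNerve hX χ hS (n + 1)) (mem_magnitudeNerve hX χ hS (n + 1)) ih.2
    refine ⟨h.1, ?_⟩
    rw [Finset.sum_range_succ]
    unfold wgt
    rw [Finset.sum_sub_distrib]
    exact h.2

end Realization

end

end MagnitudeNerve

theorem mainTheorem10
    {V : Type u₁} [Category.{v₁} V] [SemiCartesianMonoidalCategory V]
    {W : Type u} [Category.{v} W] [ModelCategory W] [HasColimits W] [MonoidalCategory W]
    [SymmetricCategory W] [MonoidalClosed W] [IsMonoidalModelCategory W]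
    [SimplicialCategory W] [IsSimplicialModelCategory W]
    {k : Type w} [Ring k] (χ : MultiplicativeEulerCharacteristic W k)
    (S : V ⥤ W) [S.Monoidal] (hS : ∀ A : V, χ.IsFinite (S.obj A))
    (X : Type v) [DecidableEq X] [EnrichedCategory V X]
    (hX : IsCofibrantEnriched W (TransportEnrichment S X)) :
    (∀ (n : ℕ) (x : Fin (n + 1) → X),
      χ.IsFinite (nerveAt S X x) ∧ χ.IsFinite (nerveLatchingAt S X x)) ∧
    (∀ x : Fin 1 → X, wgt S X χ x = 1) ∧
    (∀ (n : ℕ) (x : Fin (n + 2) → X), x 0 ≠ x 1 →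
      wgt S X χ x = χ.val (S.obj (x 0 ⟶[V] x 1)) * wgt S X χ (Fin.tail x)) ∧
    (∀ (n : ℕ) (x : Fin (n + 2) → X), x 0 = x 1 →
      wgt S X χ x = (χ.val (S.obj (x 0 ⟶[V] x 1)) - 1) * wgt S X χ (Fin.tail x)) ∧
    (∀ (n : ℕ) (x : Fin (n + 1) → X),
      wgt S X χ x = (List.ofFn fun i : Fin n =>
        χ.val (S.obj (x i.castSucc ⟶[V] x i.succ)) -
          if x i.castSucc = x i.succ then 1 else 0).prod) ∧
    ∀ [Fintype X],
      (∀ n : ℕ, χ.IsFinite (skeletalRealization n (magnitudeNerve S X))) ∧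
      χ.val (skeletalRealization 0 (magnitudeNerve S X)) = ∑ x : Fin 1 → X, wgt S X χ x ∧
      (∀ n : ℕ, χ.val (skeletalRealization (n + 1) (magnitudeNerve S X)) =
        χ.val (skeletalRealization n (magnitudeNerve S X)) +
          (-1) ^ (n + 1) * ∑ x : Fin (n + 2) → X, wgt S X χ x) ∧
      ∀ n : ℕ, IsSkeletal n (magnitudeNerve S X) →
        χ.IsFinite (realization (magnitudeNerve S X)) ∧
        χ.val (realization (magnitudeNerve S X)) =
          ∑ j ∈ Finset.range (n + 1), (-1) ^ j * ∑ x : Fin (j + 1) → X, wgt S X χ x := by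
  refine ⟨fun n x => isFinite_nerve χ hX hS x, wgt_zero χ,
    fun n x hx => wgt_succ_of_ne χ hX hS x hx, fun n x hx => wgt_succ_of_eq χ hX hS x hx,
    fun n x => wgt_eq_prod χ hX hS x, fun {_} => ?_⟩
  have h n := (mem_skeletalRealization_magnitudeNerve hX χ hS n).2
  refine ⟨fun n => EulerCharacteristic.isFinite_of_mem (h n), ?_, fun n => ?_, fun n hn => ?_⟩
  · rw [EulerCharacteristic.val_eq_of_mem (h 0), zero_add, Finset.sum_range_one, pow_zero, one_mul]
  · rw [EulerCharacteristic.val_eq_of_mem (h (n + 1)), EulerCharacteristic.val_eq_of_mem (h n),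
      Finset.sum_range_succ]
  · obtain ⟨e⟩ := nonempty_iso_of_isSkeletal _ hn
    have h' := χ.mem_of_iso e (h n)
    exact ⟨EulerCharacteristic.isFinite_of_mem h', EulerCharacteristic.val_eq_of_mem h'⟩
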